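/- Let $R,\mu>0$. For $\delta>0$ let $D_1,D_2\subset\mathbb R^2$ be the open disks of radius $R$ centred at $(-R-\delta/2,0)$ and $(R+\delta/2,0)$, and let $D^e=\mathbb R^2\setminus\overline{D_1\cup D_2}$. Put $\psi_1=(1,0)$, $\psi_2=(0,1)$, $\psi_3=(y,-x)$ and $U_{\rm sh}(x,y)=(y,x)$ (shear flow). Consider constants $c_{ij}$ ($i=1,2$, $j=1,2,3$) and a classical solution $(u,p)$, with $u$ of class $C^1$ and $p$ continuous up to the boundary of $D^e$, of $$\mu\Delta u=\nabla p,\quad \nabla\cdot u=0 \ \text{ in } D^e,\qquad u=\sum_{j=1}^3 c_{ij}\psi_j \ \text{ on } \partial D_i,\ i=1,2,$$ with the decay $u-U_{\rm sh}=O(|x|^{-1})$, $\nabla(u-U_{\rm sh})=O(|x|^{-2})$, $p=O(|x|^{-2})$ as $|x|\to\infty$, and with the equilibrium conditions $$\int_{\partial D_i}\psi_j\cdot\sigma[u,p]\,\nu\,dl=0,\qquad i=1,2,\ j=1,2,3,\qquad \sigma[u,p]=-pI+\mu(\nabla u+\nabla u^T),$$ where $\nu$ is the unit normal on $\partial D_i$.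 Then, as $\delta\to0$, the constants determined by this problem satisfy $$c_{22}=\sqrt{R\delta}+O(\delta),\qquad c_{23}=O(1);$$ that is, there are constants $C$ and $\delta_0>0$, depending only on $R$ and $\mu$, such that $|c_{22}-\sqrt{R\delta}|\le C\delta$ and $|c_{23}|\le C$ whenever $0<\delta<\delta_0$. -/

import Mathlib

open scoped Laplacian Gradient

noncomputable section

namespace StokesTwoDisks

/-- The Euclidean plane; the coordinates of `x` are `x 0` and `x 1`. -/
abbrev Plane := EuclideanSpace ℝ (Fin 2)

/-- The centers `(-R - δ/2, 0)` and `(R + δ/2, 0)` of the two disks. -/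
def center (R δ : ℝ) : Fin 2 → Plane := ![!₂[-R - δ / 2, 0], !₂[R + δ / 2, 0]]

/-- The two open disks of radius `R`, at distance `δ` from each other. -/
def disk (R δ : ℝ) (i : Fin 2) : Set Plane := Metric.ball (center R δ i) R

/-- The fluid domain: the plane without the closed disks. -/
def exteriorDomain (R δ : ℝ) : Set Plane := (closure (disk R δ 0 ∪ disk R δ 1))ᶜ

/-- The rigid motions `(1, 0)`, `(0, 1)` and `(y, -x)`. -/
def rigidMotion : Fin 3 → Plane → Plane :=
  ![fun _ => !₂[1, 0], fun _ => !₂[0, 1], fun x => !₂[x 1, -x 0]]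

/-- The shear flow `(x, y) ↦ (y, x)`. -/
def shearFlow (x : Plane) : Plane := !₂[x 1, x 0]

/-- The Jacobian matrix of `u` at `x`, with entries `∂ⱼ uᵢ`, where `u` is regarded as a function on
the set `K`. If `u` is `C¹` on the closure `K` of a smooth open set, this is the usual Jacobian at
interior points and its continuous extension from the inside at boundary points. -/
def jacobianWithin (K : Set Plane) (u : Plane → Plane) (x : Plane) : Matrix (Fin 2) (Fin 2) ℝ :=
  Matrix.of fun i j => fderivWithin ℝ u K x (EuclideanSpace.single j 1) i

/-- The strain tensor `(∇u + ∇uᵀ) / 2`. -/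
def strain (K : Set Plane) (u : Plane → Plane) (x : Plane) : Matrix (Fin 2) (Fin 2) ℝ :=
  (1 / 2 : ℝ) • (jacobianWithin K u x + (jacobianWithin K u x).transpose)

/-- The stress tensor `-p I + 2 μ (∇u + ∇uᵀ) / 2`. -/
def stress (K : Set Plane) (μ : ℝ) (u : Plane → Plane) (p : Plane → ℝ) (x : Plane) :
    Matrix (Fin 2) (Fin 2) ℝ :=
  -(p x • (1 : Matrix (Fin 2) (Fin 2) ℝ)) + (2 * μ) • strain K u x

/-- The unit vector `(cos t, sin t)`. -/
def unitVec (t : ℝ) : Plane := !₂[Real.cos t, Real.sin t]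

/-- The integral `∫ ψ · σ[u, p] ν dl` over the boundary of the `i`-th disk. The boundary is
parametrized by the angle `t`, with outward unit normal `ν = (cos t, sin t)` and `dl = R dt`; the
stress is taken from the side of the fluid. -/
def boundaryForce (R δ μ : ℝ) (u : Plane → Plane) (p : Plane → ℝ) (i : Fin 2)
    (ψ : Plane → Plane) : ℝ :=
  ∫ t in (0 : ℝ)..(2 * Real.pi),
    ((ψ (center R δ i + R • unitVec t)).ofLp ⬝ᵥ
      (stress (closure (exteriorDomain R δ)) μ u p (center R δ i + R • unitVec t)).mulVec
        (unitVec t).ofLp) * R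

/-- The decay class at infinity: `w = O(1/|x|)`, `∇w = O(1/|x|²)` and `q = O(1/|x|²)`. -/
structure DecaysAtInfinity (w : Plane → Plane) (q : Plane → ℝ) : Prop where
  velocity : w =O[Bornology.cobounded Plane] fun x => ‖x‖⁻¹
  gradient : (fun x => fderiv ℝ w x) =O[Bornology.cobounded Plane] fun x => (‖x‖ ^ 2)⁻¹
  pressure : q =O[Bornology.cobounded Plane] fun x => (‖x‖ ^ 2)⁻¹

/-- `(u, p)` is a classical solution, regular up to the boundary, of the Stokes problem with
viscosity `μ` around the two disks in the background flow `(U, 0)`, with boundary values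
`u = ∑ⱼ c i j ψⱼ` on the boundary of the `i`-th disk, and the constants `c i j` are such that each
disk is in equilibrium (no net force and no net torque). -/
structure IsEquilibriumFlow (R δ μ : ℝ) (U : Plane → Plane) (c : Fin 2 → Fin 3 → ℝ)
    (u : Plane → Plane) (p : Plane → ℝ) : Prop where
  contDiffOn_velocity : ContDiffOn ℝ 2 u (exteriorDomain R δ)
  contDiffOn_velocity_closure : ContDiffOn ℝ 1 u (closure (exteriorDomain R δ))
  contDiffOn_pressure : ContDiffOn ℝ 1 p (exteriorDomain R δ)
  continuousOn_pressure_closure : ContinuousOn p (closure (exteriorDomain R δ))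
  momentum : ∀ x ∈ exteriorDomain R δ, μ • (Δ u) x = (∇ p) x
  incompressible : ∀ x ∈ exteriorDomain R δ,
    ∑ i : Fin 2, fderiv ℝ u x (EuclideanSpace.single i 1) i = 0
  boundary : ∀ i : Fin 2, ∀ x ∈ Metric.sphere (center R δ i) R,
    u x = ∑ j : Fin 3, c i j • rigidMotion j x
  decay : DecaysAtInfinity (fun x => u x - U x) p
  equilibrium : ∀ (i : Fin 2) (j : Fin 3), boundaryForce R δ μ u p i (rigidMotion j) = 0

end StokesTwoDisks

end

open scoped Laplacian Gradient

noncomputable section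

namespace StokesTwoDisks

open Set Filter Topology MeasureTheory

/-! ### Geometry of the fluid domain. -/

section Geometry

variable {R δ : ℝ}

/-! Put `w = u - U_sh`. The shear flow is itself a Stokes flow with zero pressure and exerts neither
force nor torque on the disks, so `w` is a decaying force-free flow whose boundary values are rigid
motions minus the shear. `IsPerturbation` records this with a factor `s` before the shear: `s = 1`
for `w`, and `s = 0` for purely rigid boundary values. No asymptotic analysis of the narrow gap is
needed, because the vertical velocity can be computed exactly: `c 1 1 = √(R δ + δ² / 4)`. Three
facts carry the proof.

Relative velocity (`IsPerturbation.relative_velocity`). If `H` is harmonic, the stream function `x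
H` gives a Stokes flow with pressure `2 μ ∂_y H`. Take for `H` the bipolar coordinate with foci
`(±a, 0)`, where `a² = R δ + δ² / 4`. Both boundary circles are level sets of `H`, and the resulting
flow is a rigid motion on each of them, with an explicit traction. In the reciprocal theorem between
this flow and `w` the term with the stress of `w` vanishes by equilibrium. What remains reduces to
the integrals of `1 / x` over the two circles and reads `c 1 1 - c 0 1 = 2 a`.

Symmetry and uniqueness (`IsPerturbation.vertical_velocity`). The reflected flow `-w(-x)` solves the
same kind of problem, and its difference from `w` has `s = 0`. The energy inequality makes the
gradient and the angular velocities of such a flow vanish; decay along a ray then kills its vertical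
velocity on the right disk. Hence `c 1 1 + c 0 1 = 0`, and so `c 1 1 = a`.

Angular velocity (`IsPerturbation.sum_angular_velocity_sq_le`). Let `v` be a compactly supported
divergence-free extension of the shear from the disks. Then `w + s v` is rigid on the circles, so
the flux of the stress applied to it vanishes. Adding the field with divergence `det ∇w` turns the
symmetric gradient into the full one and contributes the boundary term `π R² (c i 2 ² - s²)`. For `s
= 1` this bounds the angular velocities by the dissipation of `v`, which can be chosen independently
of `δ`. For `s = 0` it is the uniqueness statement used above.

All boundary integrals come from one divergence theorem, `setIntegral_le_neg_sum_circleFlux`. It is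
proved by integrating by parts against radial cutoffs, since the fields are only continuous up to
the boundary and their divergence need not be known to be integrable. -/

lemma norm_unitVec (t : ℝ) : ‖unitVec t‖ = 1 := by
  simp [unitVec, EuclideanSpace.norm_eq]

lemma continuous_unitVec : Continuous unitVec := by
  unfold unitVec
  fun_prop

lemma norm_circle_sub (c : Plane) {r : ℝ} (hr : 0 ≤ r) (t : ℝ) : ‖c + r • unitVec t - c‖ = r := by
  rw [add_sub_cancel_left, norm_smul, norm_unitVec, mul_one, Real.norm_of_nonneg hr]

lemma dist_center (hR : 0 < R) (hδ : 0 < δ) {i j : Fin 2} (hij : i ≠ j) :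
    dist (center R δ i) (center R δ j) = 2 * R + δ := by
  have h : ∀ s : ℝ, 0 ≤ s → dist (!₂[s, 0] : Plane) !₂[-s, 0] = 2 * s := by
    intro s hs
    rw [EuclideanSpace.dist_eq]
    simp only [Fin.sum_univ_two, Real.dist_eq]
    simp only [Matrix.cons_val_zero, Matrix.cons_val_one, sq_abs]
    rw [show (s - -s) ^ 2 + ((0 : ℝ) - 0) ^ 2 = (2 * s) ^ 2 by ring]
    exact Real.sqrt_sq (by linarith)
  have key := h (R + δ / 2) (by linarith)
  rw [show -(R + δ / 2) = -R - δ / 2 by ring, show 2 * (R + δ / 2) = 2 * R + δ by ring] at key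
  fin_cases i <;> fin_cases j <;> first | exact absurd rfl hij | skip
  · rw [dist_comm]; exact key
  · exact key

lemma norm_center (hR : 0 < R) (hδ : 0 < δ) (i : Fin 2) : ‖center R δ i‖ = R + δ / 2 := by
  fin_cases i
  · simp only [center, EuclideanSpace.norm_eq, Fin.sum_univ_two]
    simp only [Fin.zero_eta, Matrix.cons_val_zero, Matrix.cons_val_one, PiLp.toLp_apply,
      norm_zero, Real.norm_eq_abs, sq_abs]
    rw [show (-R - δ / 2) ^ 2 + (0 : ℝ) ^ 2 = (R + δ / 2) ^ 2 by ring]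
    exact Real.sqrt_sq (by linarith)
  · simp only [center, EuclideanSpace.norm_eq, Fin.sum_univ_two]
    simp only [Fin.mk_one, Matrix.cons_val_zero, Matrix.cons_val_one, PiLp.toLp_apply,
      norm_zero, Real.norm_eq_abs, sq_abs]
    rw [show (R + δ / 2) ^ 2 + (0 : ℝ) ^ 2 = (R + δ / 2) ^ 2 by ring]
    exact Real.sqrt_sq (by linarith)

lemma mem_exteriorDomain (hR : 0 < R) {x : Plane} :
    x ∈ exteriorDomain R δ ↔ ∀ i, R < dist x (center R δ i) := by
  unfold exteriorDomain disk
  rw [closure_union, closure_ball _ hR.ne', closure_ball _ hR.ne']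
  simp [Fin.forall_fin_two]

lemma isOpen_exteriorDomain : IsOpen (exteriorDomain R δ) := isClosed_closure.isOpen_compl

lemma le_dist_of_mem_closure (hR : 0 < R) {x : Plane} (hx : x ∈ closure (exteriorDomain R δ))
    (i : Fin 2) : R ≤ dist x (center R δ i) := by
  have hcl : IsClosed {y : Plane | R ≤ dist y (center R δ i)} :=
    isClosed_le continuous_const (by fun_prop)
  exact closure_minimal (fun y hy => ((mem_exteriorDomain hR).1 hy i).le) hcl hx

lemma lt_dist_other (hR : 0 < R) (hδ : 0 < δ) {x : Plane} {i j : Fin 2} (hij : j ≠ i)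
    (h : dist x (center R δ i) < R + δ) : R < dist x (center R δ j) := by
  have h1 := dist_center hR hδ hij
  have h2 := dist_triangle_left (center R δ j) (center R δ i) x
  linarith

lemma mem_exteriorDomain_of_near (hR : 0 < R) (hδ : 0 < δ) {x : Plane} {i : Fin 2}
    (h1 : R < dist x (center R δ i)) (h2 : dist x (center R δ i) < R + δ) :
    x ∈ exteriorDomain R δ := by
  rw [mem_exteriorDomain hR]
  intro j
  by_cases hij : j = i
  · rwa [hij]
  · exact lt_dist_other hR hδ hij h2

/-- At each boundary point there is an open disk in the fluid that touches the boundary there. -/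
lemma exists_exterior_ball (hR : 0 < R) (hδ : 0 < δ) {x : Plane} {i : Fin 2}
    (hx : dist x (center R δ i) = R) :
    ∃ y : Plane, ∃ r, 0 < r ∧ Metric.ball y r ⊆ exteriorDomain R δ ∧ dist x y = r := by
  set c := center R δ i
  have hxc : ‖x - c‖ = R := by rw [← dist_eq_norm, hx]
  have hpos : 0 < δ / (2 * R) := by positivity
  have hmul : δ / (2 * R) * R = δ / 2 := by field_simp
  refine ⟨x + (δ / (2 * R)) • (x - c), δ / 2, by positivity, ?_, ?_⟩
  · intro y hy
    rw [Metric.mem_ball] at hy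
    have h1 : dist (x + (δ / (2 * R)) • (x - c)) c = R + δ / 2 := by
      rw [dist_eq_norm, show x + (δ / (2 * R)) • (x - c) - c = (1 + δ / (2 * R)) • (x - c) by
        rw [add_smul, one_smul]; abel, norm_smul, hxc, Real.norm_of_nonneg (by positivity)]
      linarith
    have h2 := dist_triangle_left (x + (δ / (2 * R)) • (x - c)) c y
    have h3 := dist_triangle y (x + (δ / (2 * R)) • (x - c)) c
    exact mem_exteriorDomain_of_near hR hδ (i := i) (by linarith) (by linarith)
  · rw [dist_eq_norm, sub_add_cancel_left, norm_neg, norm_smul, hxc,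
      Real.norm_of_nonneg hpos.le, hmul]

lemma mem_closure_ball_of_dist {x y : Plane} {r : ℝ} (hr : 0 < r) (h : dist x y = r) :
    x ∈ closure (Metric.ball y r) := by
  rw [closure_ball _ hr.ne']
  exact h.le

lemma mem_closure_exteriorDomain (hR : 0 < R) (hδ : 0 < δ) {x : Plane} :
    x ∈ closure (exteriorDomain R δ) ↔ ∀ i, R ≤ dist x (center R δ i) := by
  refine ⟨le_dist_of_mem_closure hR, fun h => ?_⟩
  by_cases hx : x ∈ exteriorDomain R δ
  · exact subset_closure hx
  rw [mem_exteriorDomain hR] at hx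
  push Not at hx
  obtain ⟨i, hi⟩ := hx
  obtain ⟨y, r, hr, hsub, hd⟩ := exists_exterior_ball hR hδ (le_antisymm hi (h i))
  exact closure_mono hsub (mem_closure_ball_of_dist hr hd)

/-- The stress on the boundary is defined through `fderivWithin`, which is meaningful there only
with unique differentiability. The touching disk inside the fluid, being convex with interior,
supplies it. -/
lemma uniqueDiffOn_closure (hR : 0 < R) (hδ : 0 < δ) :
    UniqueDiffOn ℝ (closure (exteriorDomain R δ)) := by
  intro x hx
  by_cases hx' : x ∈ exteriorDomain R δ
  · exact (isOpen_exteriorDomain.uniqueDiffWithinAt hx').mono subset_closure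
  rw [mem_exteriorDomain hR] at hx'
  push Not at hx'
  obtain ⟨i, hi⟩ := hx'
  obtain ⟨y, r, hr, hsub, hd⟩ :=
    exists_exterior_ball hR hδ (le_antisymm hi (le_dist_of_mem_closure hR hx i))
  refine (uniqueDiffWithinAt_convex (convex_ball y r) ?_ (mem_closure_ball_of_dist hr hd)).mono
    (hsub.trans subset_closure)
  rw [Metric.isOpen_ball.interior_eq]
  exact ⟨y, Metric.mem_ball_self hr⟩

lemma circle_mem_closure (hR : 0 < R) (hδ : 0 < δ) (i : Fin 2) {r : ℝ} (h1 : R ≤ r)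
    (h2 : r < R + δ) (t : ℝ) : center R δ i + r • unitVec t ∈ closure (exteriorDomain R δ) := by
  rw [mem_closure_exteriorDomain hR hδ]
  have hd : dist (center R δ i + r • unitVec t) (center R δ i) = r := by
    rw [dist_eq_norm, norm_circle_sub _ (hR.le.trans h1)]
  intro j
  by_cases hij : j = i
  · rw [hij, hd]; exact h1
  · exact (lt_dist_other hR hδ hij (hd.trans_lt h2)).le

lemma circle_mem_sphere (hR : 0 < R) (i : Fin 2) (t : ℝ) :
    center R δ i + R • unitVec t ∈ Metric.sphere (center R δ i) R := by
  rw [Metric.mem_sphere, dist_eq_norm, norm_circle_sub _ hR.le]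

lemma closure_mem_nhds {x : Plane} (hx : x ∈ exteriorDomain R δ) :
    closure (exteriorDomain R δ) ∈ 𝓝 x :=
  mem_of_superset (isOpen_exteriorDomain.mem_nhds hx) subset_closure

end Geometry

/-! ### Polar coordinates, radial cutoffs and fluxes through circles. -/

section Polar

lemma integral_eq_polar (c : Plane) (f : Plane → ℝ) :
    ∫ x, f x = ∫ p in polarCoord.target, p.1 * f (c + p.1 • unitVec p.2) := by
  have hmp : MeasurePreserving (fun q : ℝ × ℝ => (!₂[q.1, q.2] : Plane)) := by
    have h := (PiLp.volume_preserving_toLp (Fin 2)).comp (volume_preserving_finTwoArrow ℝ).symm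
    exact h
  have hemb : MeasurableEmbedding (fun q : ℝ × ℝ => (!₂[q.1, q.2] : Plane)) := by
    have h := (MeasurableEquiv.toLp 2 (Fin 2 → ℝ)).measurableEmbedding.comp
      (MeasurableEquiv.finTwoArrow (α := ℝ)).symm.measurableEmbedding
    exact h
  rw [← integral_add_left_eq_self f c, ← hmp.integral_comp hemb, ← integral_comp_polarCoord_symm]
  refine setIntegral_congr_fun (by exact polarCoord.open_target.measurableSet) fun p _ => ?_
  have : (!₂[(polarCoord.symm p).1, (polarCoord.symm p).2] : Plane) = p.1 • unitVec p.2 := by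
    ext i
    fin_cases i <;> simp [unitVec, polarCoord]
  simp only [this, smul_eq_mul]

lemma unitVec_periodic : Function.Periodic unitVec (2 * Real.pi) := by
  intro t
  simp [unitVec]

/-- The flux of `F` through the circle of radius `r` around `c`. -/
def circleFlux (c : Plane) (F : Plane → Plane) (r : ℝ) : ℝ :=
  ∫ t in (0 : ℝ)..(2 * Real.pi),
    (F (c + r • unitVec t) 0 * Real.cos t + F (c + r • unitVec t) 1 * Real.sin t) * r

/-- Reconciles the angular range `(0, 2π)` of the boundary integrals with the range `(-π, π)` of
`polarCoord`; periodicity makes the choice immaterial. -/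
lemma circleFlux_eq_pi (c : Plane) (F : Plane → Plane) (r : ℝ) :
    circleFlux c F r = ∫ t in Ioo (-Real.pi) Real.pi,
      (F (c + r • unitVec t) 0 * Real.cos t + F (c + r • unitVec t) 1 * Real.sin t) * r := by
  rw [← integral_Ioc_eq_integral_Ioo,
    ← intervalIntegral.integral_of_le (by linarith [Real.pi_pos])]
  have hper : Function.Periodic (fun t => (F (c + r • unitVec t) 0 * Real.cos t
      + F (c + r • unitVec t) 1 * Real.sin t) * r) (2 * Real.pi) := by
    intro t
    simp [unitVec_periodic t]
  have h := hper.intervalIntegral_add_eq 0 (-Real.pi)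
  rw [zero_add, show -Real.pi + 2 * Real.pi = Real.pi by ring] at h
  exact h

/-- The radial profile of the cutoff functions. -/
def radialCutoff (α β r : ℝ) : ℝ := Real.smoothTransition ((r ^ 2 - α ^ 2) / (β ^ 2 - α ^ 2))

/-- A smooth function that vanishes in the disk of radius `α` around `c` and equals `1` outside
the disk of radius `β`. -/
def cutoff (c : Plane) (α β : ℝ) (x : Plane) : ℝ := radialCutoff α β ‖x - c‖

variable {α β : ℝ}

lemma radialCutoff_of_le (hα : 0 ≤ α) (hαβ : α < β) {r : ℝ} (hr : 0 ≤ r) (h : r ≤ α) :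
    radialCutoff α β r = 0 := by
  refine Real.smoothTransition.zero_of_nonpos (div_nonpos_of_nonpos_of_nonneg ?_ ?_) <;> nlinarith

lemma radialCutoff_of_ge (hα : 0 ≤ α) (hαβ : α < β) {r : ℝ} (h : β ≤ r) :
    radialCutoff α β r = 1 := by
  refine Real.smoothTransition.one_of_one_le ((one_le_div ?_).2 ?_) <;> nlinarith

lemma radialCutoff_nonneg (r : ℝ) : 0 ≤ radialCutoff α β r := Real.smoothTransition.nonneg _

lemma radialCutoff_le_one (r : ℝ) : radialCutoff α β r ≤ 1 := Real.smoothTransition.le_one _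

lemma contDiff_radialCutoff : ContDiff ℝ 1 (radialCutoff α β) := by
  unfold radialCutoff
  exact (Real.smoothTransition.contDiff (n := 1)).comp (by fun_prop)

lemma deriv_radialCutoff_nonneg (hα : 0 ≤ α) (hαβ : α < β) {r : ℝ} (hr : 0 ≤ r) :
    0 ≤ deriv (radialCutoff α β) r := by
  have h1 : HasDerivAt (fun r : ℝ => (r ^ 2 - α ^ 2) / (β ^ 2 - α ^ 2))
      ((2 * r) / (β ^ 2 - α ^ 2)) r := by
    simpa using ((hasDerivAt_pow 2 r).sub_const (α ^ 2)).div_const (β ^ 2 - α ^ 2)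
  have h2 := ((Real.smoothTransition.contDiff (n := 1)).differentiable (by norm_num)
    ((r ^ 2 - α ^ 2) / (β ^ 2 - α ^ 2))).hasDerivAt
  have h3 : deriv (radialCutoff α β) r = _ := (h2.comp r h1).deriv
  rw [h3]
  refine mul_nonneg (Real.smoothTransition.monotone.deriv_nonneg) (div_nonneg (by linarith) ?_)
  nlinarith

lemma contDiff_cutoff (c : Plane) : ContDiff ℝ 1 (cutoff c α β) := by
  unfold cutoff radialCutoff
  refine (Real.smoothTransition.contDiff (n := 1)).comp ?_
  have : ContDiff ℝ 1 fun x : Plane => ‖x - c‖ ^ 2 := (contDiff_id.sub contDiff_const).norm_sq ℝ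
  fun_prop

/-- Radial derivative of the cutoff. -/
lemma fderiv_cutoff_circle (c : Plane) {r : ℝ} (hr : 0 < r) (t : ℝ) (v : Plane) :
    fderiv ℝ (cutoff c α β) (c + r • unitVec t) v
      = deriv (radialCutoff α β) r * (v 0 * Real.cos t + v 1 * Real.sin t) := by
  set x := c + r • unitVec t with hx
  have hxc : x - c = r • unitVec t := by rw [hx, add_sub_cancel_left]
  have hne : x - c ≠ 0 := by
    rw [hxc, ← norm_ne_zero_iff, norm_smul, norm_unitVec, mul_one]
    exact norm_ne_zero_iff.2 hr.ne'
  have hn : ‖x - c‖ = r := norm_circle_sub c hr.le t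
  have h1 : HasFDerivAt (fun y : Plane => ‖y - c‖ ^ 2) (2 • innerSL ℝ (x - c)) x := by
    have h := ((hasFDerivAt_id (𝕜 := ℝ) x).sub_const c).norm_sq
    simpa using h
  have h2 : HasFDerivAt (cutoff c α β)
      (deriv Real.smoothTransition ((‖x - c‖ ^ 2 - α ^ 2) / (β ^ 2 - α ^ 2)) •
        ((β ^ 2 - α ^ 2)⁻¹ • (2 • innerSL ℝ (x - c)))) x := by
    have h3 := ((Real.smoothTransition.contDiff (n := 1)).differentiable (by norm_num)
      ((‖x - c‖ ^ 2 - α ^ 2) / (β ^ 2 - α ^ 2))).hasDerivAt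
    have h4 : HasFDerivAt (fun y : Plane => (‖y - c‖ ^ 2 - α ^ 2) / (β ^ 2 - α ^ 2))
        ((β ^ 2 - α ^ 2)⁻¹ • (2 • innerSL ℝ (x - c))) x := by
      simp only [div_eq_inv_mul]
      exact (h1.sub_const _).const_mul _
    exact HasDerivAt.comp_hasFDerivAt (f := fun y : Plane => (‖y - c‖ ^ 2 - α ^ 2) /
      (β ^ 2 - α ^ 2)) x h3 h4
  have h5 : HasDerivAt (fun r : ℝ => (r ^ 2 - α ^ 2) / (β ^ 2 - α ^ 2))
      ((2 * r) / (β ^ 2 - α ^ 2)) r := by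
    simpa using ((hasDerivAt_pow 2 r).sub_const (α ^ 2)).div_const (β ^ 2 - α ^ 2)
  have h6 := ((Real.smoothTransition.contDiff (n := 1)).differentiable (by norm_num)
    ((r ^ 2 - α ^ 2) / (β ^ 2 - α ^ 2))).hasDerivAt
  have h7 : deriv (radialCutoff α β) r = _ := (h6.comp r h5).deriv
  have h8 : inner ℝ (x - c) v = r * (v 0 * Real.cos t + v 1 * Real.sin t) := by
    rw [hxc, real_inner_smul_left]
    simp [unitVec, PiLp.inner_apply, Fin.sum_univ_two]
  rw [h2.fderiv, h7, hn]
  simp only [_root_.smul_apply, innerSL_apply_apply, h8, smul_eq_mul, nsmul_eq_mul]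
  push_cast
  ring

lemma fderiv_cutoff_eq_zero_of_lt (hα : 0 ≤ α) (hαβ : α < β) {c x : Plane} (h : ‖x - c‖ < α) :
    fderiv ℝ (cutoff c α β) x = 0 := by
  have : cutoff c α β =ᶠ[𝓝 x] fun _ => 0 := by
    have hopen : IsOpen {y : Plane | ‖y - c‖ < α} := isOpen_lt (by fun_prop) (by fun_prop)
    filter_upwards [hopen.mem_nhds h] with y hy
    exact radialCutoff_of_le hα hαβ (norm_nonneg _) (le_of_lt hy)
  rw [this.fderiv_eq]
  simp

lemma fderiv_cutoff_eq_zero_of_gt (hα : 0 ≤ α) (hαβ : α < β) {c x : Plane} (h : β < ‖x - c‖) :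
    fderiv ℝ (cutoff c α β) x = 0 := by
  have : cutoff c α β =ᶠ[𝓝 x] fun _ => 1 := by
    have hopen : IsOpen {y : Plane | β < ‖y - c‖} := isOpen_lt (by fun_prop) (by fun_prop)
    filter_upwards [hopen.mem_nhds h] with y hy
    exact radialCutoff_of_ge hα hαβ (le_of_lt hy)
  rw [this.fderiv_eq]
  simp

lemma continuousOn_annulus_polar (c : Plane) (hα : 0 < α) {F : Plane → Plane}
    (hF : ContinuousOn F {x | α ≤ ‖x - c‖ ∧ ‖x - c‖ ≤ β}) :
    ContinuousOn (fun p : ℝ × ℝ => F (c + p.1 • unitVec p.2)) (Icc α β ×ˢ univ) := by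
  refine hF.comp (f := fun p : ℝ × ℝ => c + p.1 • unitVec p.2) ?_ ?_
  · have := continuous_unitVec
    exact Continuous.continuousOn (by fun_prop)
  · rintro ⟨r, t⟩ ⟨⟨h1, h2⟩, -⟩
    simp only [mem_ofPred_eq]
    rw [norm_circle_sub c (hα.le.trans h1)]
    exact ⟨h1, h2⟩

/-- The integral of `∇χ · F` for a radial cutoff `χ` is an average of fluxes of `F`. -/
lemma integral_fderiv_cutoff (c : Plane) (hα : 0 < α) (hαβ : α < β) {F : Plane → Plane}
    (hF : ContinuousOn F {x | α ≤ ‖x - c‖ ∧ ‖x - c‖ ≤ β}) :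
    ∫ x, fderiv ℝ (cutoff c α β) x (F x)
      = ∫ r in α..β, deriv (radialCutoff α β) r * circleFlux c F r := by
  rw [integral_eq_polar c]
  set g : ℝ × ℝ → ℝ := fun p => deriv (radialCutoff α β) p.1 *
    ((F (c + p.1 • unitVec p.2) 0 * Real.cos p.2 + F (c + p.1 • unitVec p.2) 1 * Real.sin p.2)
      * p.1) with hg
  have hcont : ContinuousOn g (Icc α β ×ˢ univ) := by
    have h1 := continuousOn_annulus_polar c hα hF
    have h2 : Continuous (deriv (radialCutoff α β)) :=
      contDiff_radialCutoff.continuous_deriv le_rfl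
    have h3 : ∀ i : Fin 2, ContinuousOn (fun p : ℝ × ℝ => F (c + p.1 • unitVec p.2) i)
        (Icc α β ×ˢ univ) := fun i =>
      (EuclideanSpace.proj (𝕜 := ℝ) i).continuous.comp_continuousOn h1
    have h4 : Continuous fun p : ℝ × ℝ => deriv (radialCutoff α β) p.1 := h2.comp continuous_fst
    exact h4.continuousOn.mul ((((h3 0).mul (by fun_prop)).add ((h3 1).mul (by fun_prop))).mul
      (by fun_prop))
  have hsub : Icc α β ×ˢ Ioo (-Real.pi) Real.pi ⊆ polarCoord.target := by
    rintro ⟨r, t⟩ ⟨⟨h1, -⟩, h2⟩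
    exact ⟨hα.trans_le h1, h2⟩
  have hstep : ∫ p in polarCoord.target, p.1 * fderiv ℝ (cutoff c α β) (c + p.1 • unitVec p.2)
      (F (c + p.1 • unitVec p.2)) = ∫ p in Icc α β ×ˢ Ioo (-Real.pi) Real.pi, g p := by
    -- The gradient of the cutoff vanishes off the closed annulus, so the integral is over a compact
    -- rectangle of radii and angles, up to the endpoints of the angle, and Fubini applies.
    rw [setIntegral_eq_of_subset_of_forall_sdiff_eq_zero
      polarCoord.open_target.measurableSet hsub (f := fun p : ℝ × ℝ => p.1 *
        fderiv ℝ (cutoff c α β) (c + p.1 • unitVec p.2) (F (c + p.1 • unitVec p.2)))]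
    · refine setIntegral_congr_fun (measurableSet_Icc.prod measurableSet_Ioo) ?_
      rintro ⟨r, t⟩ ⟨⟨h1, -⟩, -⟩
      simp only [hg]
      rw [fderiv_cutoff_circle c (hα.trans_le h1)]
      ring
    · rintro ⟨r, t⟩ ⟨⟨h1, h2⟩, h3⟩
      have h1' : 0 < r := h1
      have hn := norm_circle_sub c h1'.le t
      by_cases h4 : r < α
      · simp [fderiv_cutoff_eq_zero_of_lt hα.le hαβ (hn.trans_lt h4)]
      · by_cases h5 : β < r
        · simp [fderiv_cutoff_eq_zero_of_gt hα.le hαβ (h5.trans_eq hn.symm)]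
        · exact absurd ⟨⟨not_lt.1 h4, not_lt.1 h5⟩, h2⟩ h3
  have hint : IntegrableOn g (Icc α β ×ˢ Ioo (-Real.pi) Real.pi) := by
    refine IntegrableOn.mono_set (t := Icc α β ×ˢ Icc (-Real.pi) Real.pi) ?_
      (prod_mono le_rfl Ioo_subset_Icc_self)
    exact (hcont.mono (prod_mono le_rfl (subset_univ _))).integrableOn_compact
      (isCompact_Icc.prod isCompact_Icc)
  rw [hstep, Measure.volume_eq_prod, setIntegral_prod _ hint, integral_Icc_eq_integral_Ioc,
    ← intervalIntegral.integral_of_le hαβ.le]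
  refine intervalIntegral.integral_congr fun r _ => ?_
  simp only [hg, circleFlux_eq_pi]
  rw [integral_const_mul]

lemma continuousOn_circleFlux (c : Plane) (hα : 0 < α) (hαβ : α < β) {F : Plane → Plane}
    (hF : ContinuousOn F {x | α ≤ ‖x - c‖ ∧ ‖x - c‖ ≤ β}) :
    ContinuousOn (circleFlux c F) (Icc α β) := by
  have h1 := continuousOn_annulus_polar c hα hF
  -- Clamping the radius to `[α, β]` makes the integrand continuous everywhere, as continuity of
  -- parametric integrals requires; nothing changes on the annulus.
  have h3 : ∀ i : Fin 2, Continuous (fun p : ℝ × ℝ =>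
      F (c + (projIcc α β hαβ.le p.1 : ℝ) • unitVec p.2) i) := by
    intro i
    have h4 := (EuclideanSpace.proj (𝕜 := ℝ) i).continuous.comp_continuousOn h1
    refine h4.comp_continuous (f := fun p : ℝ × ℝ => ((projIcc α β hαβ.le p.1 : ℝ), p.2)) ?_ ?_
    · fun_prop
    · exact fun p => ⟨(projIcc α β hαβ.le p.1).2, mem_univ _⟩
  have h5 : Continuous fun r : ℝ => ∫ t in (0 : ℝ)..(2 * Real.pi),
      (F (c + (projIcc α β hαβ.le r : ℝ) • unitVec t) 0 * Real.cos t
        + F (c + (projIcc α β hαβ.le r : ℝ) • unitVec t) 1 * Real.sin t)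
        * (projIcc α β hαβ.le r : ℝ) := by
    refine intervalIntegral.continuous_parametric_intervalIntegral_of_continuous' ?_ _ _
    exact (((h3 0).mul (by fun_prop)).add ((h3 1).mul (by fun_prop))).mul (by fun_prop)
  refine h5.continuousOn.congr fun r hr => ?_
  simp only [circleFlux, projIcc_of_mem hαβ.le hr]

/-- The weight `deriv (radialCutoff α β)` is nonnegative with total mass one, so a weighted average
of fluxes stays as close to `φ` as the fluxes do. -/
lemma abs_integral_fderiv_cutoff_sub_le (c : Plane) (hα : 0 < α) (hαβ : α < β)
    {F : Plane → Plane} (hF : ContinuousOn F {x | α ≤ ‖x - c‖ ∧ ‖x - c‖ ≤ β}) {φ η : ℝ}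
    (h : ∀ r ∈ Icc α β, |circleFlux c F r - φ| ≤ η) :
    |(∫ x, fderiv ℝ (cutoff c α β) x (F x)) - φ| ≤ η := by
  have hd : Continuous (deriv (radialCutoff α β)) := contDiff_radialCutoff.continuous_deriv le_rfl
  have hone : ∫ r in α..β, deriv (radialCutoff α β) r = 1 := by
    rw [intervalIntegral.integral_deriv_eq_sub
      (fun r _ => contDiff_radialCutoff.differentiable (by norm_num) r)
      (hd.intervalIntegrable _ _), radialCutoff_of_ge hα.le hαβ le_rfl,
      radialCutoff_of_le hα.le hαβ hα.le le_rfl, sub_zero]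
  have hfl := continuousOn_circleFlux c hα hαβ hF
  rw [← uIcc_of_le hαβ.le] at hfl
  have hi1 : IntervalIntegrable (fun r => deriv (radialCutoff α β) r * circleFlux c F r)
      volume α β := (hd.continuousOn.mul hfl).intervalIntegrable
  have heq : (∫ x, fderiv ℝ (cutoff c α β) x (F x)) - φ
      = ∫ r in α..β, deriv (radialCutoff α β) r * (circleFlux c F r - φ) := by
    have hi2 : IntervalIntegrable (fun r => deriv (radialCutoff α β) r * φ) volume α β :=
      Continuous.intervalIntegrable (by fun_prop) _ _
    simp only [mul_sub]
    rw [intervalIntegral.integral_sub hi1 hi2,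
      intervalIntegral.integral_mul_const, hone, integral_fderiv_cutoff c hα hαβ hF, one_mul]
  rw [heq, ← Real.norm_eq_abs]
  calc ‖∫ r in α..β, deriv (radialCutoff α β) r * (circleFlux c F r - φ)‖
      ≤ ∫ r in α..β, deriv (radialCutoff α β) r * η := by
        refine intervalIntegral.norm_integral_le_of_norm_le hαβ.le ?_
          (Continuous.intervalIntegrable (by fun_prop) _ _)
        refine Eventually.of_forall fun r hr => ?_
        have h0 := deriv_radialCutoff_nonneg hα.le hαβ (hα.le.trans hr.1.le)
        rw [norm_mul, Real.norm_of_nonneg h0, Real.norm_eq_abs]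
        exact mul_le_mul_of_nonneg_left (h r (Ioc_subset_Icc_self hr)) h0
    _ = η := by rw [intervalIntegral.integral_mul_const, hone, one_mul]

end Polar

/-! ### The divergence theorem outside two disks. -/

section Divergence

/-- The divergence of a vector field on the plane. -/
def divergence (F : Plane → Plane) (x : Plane) : ℝ :=
  fderiv ℝ F x (EuclideanSpace.single 0 1) 0 + fderiv ℝ F x (EuclideanSpace.single 1 1) 1

lemma plane_eq_sum (v : Plane) :
    v = v 0 • EuclideanSpace.single 0 1 + v 1 • EuclideanSpace.single 1 1 := by
  ext i
  fin_cases i <;> simp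

lemma apply_eq_sum (L : Plane →L[ℝ] ℝ) (v : Plane) :
    L v = v 0 * L (EuclideanSpace.single 0 1) + v 1 * L (EuclideanSpace.single 1 1) := by
  conv_lhs => rw [plane_eq_sum v]
  simp

lemma abs_apply_le_norm (v : Plane) (i : Fin 2) : |v i| ≤ ‖v‖ := by
  rw [← Real.norm_eq_abs]
  exact PiLp.norm_apply_le v i

lemma fderiv_component {F : Plane → Plane} {x : Plane} (h : DifferentiableAt ℝ F x) (v : Plane)
    (i : Fin 2) : fderiv ℝ (fun y => F y i) x v = fderiv ℝ F x v i := by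
  have := ((EuclideanSpace.proj (𝕜 := ℝ) i).hasFDerivAt.comp x h.hasFDerivAt).fderiv
  exact congrArg (fun L : Plane →L[ℝ] ℝ => L v) this

lemma integrable_mul_of_tsupport {χ g : Plane → ℝ} {U : Set Plane} (hχ : Continuous χ)
    (hs : HasCompactSupport χ) (hU : tsupport χ ⊆ U) (hg : ContinuousOn g U) :
    Integrable (fun x => χ x * g x) := by
  have h : IntegrableOn (fun x => χ x * g x) (tsupport χ) :=
    (hχ.continuousOn.mul (hg.mono hU)).integrableOn_compact hs
  refine (integrableOn_iff_integrable_of_support_subset ?_).1 h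
  intro x hx
  exact subset_tsupport χ (left_ne_zero_of_mul hx)

/-- Integration by parts against a compactly supported function. -/
lemma integral_mul_divergence {χ : Plane → ℝ} {F : Plane → Plane} {U : Set Plane} (hUo : IsOpen U)
    (hχ : ContDiff ℝ 1 χ) (hs : HasCompactSupport χ) (hU : tsupport χ ⊆ U)
    (hF : ContDiffOn ℝ 1 F U) :
    Integrable (fun x => χ x * divergence F x) ∧
      ∫ x, χ x * divergence F x = - ∫ x, fderiv ℝ χ x (F x) := by
  have hFd : ∀ x ∈ U, DifferentiableAt ℝ F x := fun x hx =>
    (hF.differentiableOn (by norm_num)).differentiableAt (hUo.mem_nhds hx)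
  have hFc : ContinuousOn (fun x => fderiv ℝ F x) U := hF.continuousOn_fderiv_of_isOpen hUo le_rfl
  have key : ∀ i : Fin 2,
      Integrable (fun x => χ x * fderiv ℝ F x (EuclideanSpace.single i 1) i) ∧
      Integrable (fun x => fderiv ℝ χ x (EuclideanSpace.single i 1) * F x i) ∧
      ∫ x, χ x * fderiv ℝ F x (EuclideanSpace.single i 1) i
        = - ∫ x, fderiv ℝ χ x (EuclideanSpace.single i 1) * F x i := by
    intro i
    have hFi : ContinuousOn (fun x => F x i) U :=
      (EuclideanSpace.proj (𝕜 := ℝ) i).continuous.comp_continuousOn hF.continuousOn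
    have hi1 : Integrable (fun x => χ x * fderiv ℝ F x (EuclideanSpace.single i 1) i) := by
      refine integrable_mul_of_tsupport hχ.continuous hs hU ?_
      exact (EuclideanSpace.proj (𝕜 := ℝ) i).continuous.comp_continuousOn
        (hFc.clm_apply continuousOn_const)
    have hi2 : Integrable (fun x => fderiv ℝ χ x (EuclideanSpace.single i 1) * F x i) := by
      refine integrable_mul_of_tsupport
        ((hχ.continuous_fderiv (by norm_num)).clm_apply continuous_const)
        (hs.fderiv_apply ℝ _) ((tsupport_fderiv_apply_subset ℝ _).trans hU) hFi
    refine ⟨hi1, hi2, ?_⟩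
    -- Off `U` the field may fail to be differentiable, but there the factor `χ` vanishes, so
    -- components and derivatives may be exchanged globally.
    have heq : (fun x => χ x * fderiv ℝ F x (EuclideanSpace.single i 1) i)
        = fun x => χ x * fderiv ℝ (fun y => F y i) x (EuclideanSpace.single i 1) := by
      funext x
      by_cases hx : x ∈ U
      · rw [fderiv_component (hFd x hx)]
      · rw [image_eq_zero_of_notMem_tsupport fun h => hx (hU h)]
        simp
    rw [heq] at hi1 ⊢
    refine integral_mul_fderiv_eq_neg_fderiv_mul_of_integrable hi2 hi1
      (integrable_mul_of_tsupport hχ.continuous hs hU hFi)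
      (fun x _ => hχ.differentiable (by norm_num) x) fun x hx => ?_
    exact (EuclideanSpace.proj (𝕜 := ℝ) i).differentiableAt.comp x (hFd x (hU hx))
  obtain ⟨h1, h2, h3⟩ := key 0
  obtain ⟨k1, k2, k3⟩ := key 1
  simp only [divergence, mul_add]
  refine ⟨h1.add k1, ?_⟩
  rw [integral_add h1 k1, h3, k3, ← neg_add, ← integral_add h2 k2]
  congr 2
  funext x
  rw [apply_eq_sum (fderiv ℝ χ x) (F x)]
  ring

variable {R δ : ℝ}

lemma mem_exteriorDomain_of_large (hR : 0 < R) (hδ : 0 < δ) {x : Plane}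
    (hx : 2 * R + δ < ‖x‖) : x ∈ exteriorDomain R δ := by
  rw [mem_exteriorDomain hR]
  intro i
  have h1 := norm_center hR hδ i
  have h2 := norm_sub_norm_le x (center R δ i)
  rw [dist_eq_norm]
  linarith

/-- A cutoff function that vanishes near the two disks and near infinity. -/
def fluidCutoff (R δ ε N : ℝ) (x : Plane) : ℝ :=
  cutoff (center R δ 0) (R + ε) (R + 2 * ε) x + cutoff (center R δ 1) (R + ε) (R + 2 * ε) x - 1
    - cutoff 0 N (2 * N) x

lemma contDiff_fluidCutoff (ε N : ℝ) : ContDiff ℝ 1 (fluidCutoff R δ ε N) :=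
  (((contDiff_cutoff _).add (contDiff_cutoff _)).sub contDiff_const).sub (contDiff_cutoff _)

lemma cutoff_of_ge {c x : Plane} {α β : ℝ} (hα : 0 ≤ α) (hαβ : α < β) (h : β ≤ ‖x - c‖) :
    cutoff c α β x = 1 := radialCutoff_of_ge hα hαβ h

lemma cutoff_of_le {c x : Plane} {α β : ℝ} (hα : 0 ≤ α) (hαβ : α < β) (h : ‖x - c‖ ≤ α) :
    cutoff c α β x = 0 := radialCutoff_of_le hα hαβ (norm_nonneg _) h

lemma cutoff_nonneg {c x : Plane} {α β : ℝ} : 0 ≤ cutoff c α β x := radialCutoff_nonneg _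

lemma cutoff_le_one {c x : Plane} {α β : ℝ} : cutoff c α β x ≤ 1 := radialCutoff_le_one _

variable {ε N : ℝ}

/-- At each point at most one of the three cutoffs is active. -/
lemma fluidCutoff_cases (hR : 0 < R) (hε : 0 < ε) (hεδ : 4 * ε ≤ δ)
    (hN : 2 * (R + δ) ≤ N) (x : Plane) :
    (∃ i, fluidCutoff R δ ε N x = cutoff (center R δ i) (R + ε) (R + 2 * ε) x ∧
      ‖x‖ ≤ N ∧ (∀ j, j ≠ i → R + 2 * ε ≤ ‖x - center R δ j‖)) ∨
    (fluidCutoff R δ ε N x = 1 - cutoff 0 N (2 * N) x ∧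
      ∀ i, R + 2 * ε ≤ ‖x - center R δ i‖) := by
  have hδ : 0 < δ := by linarith
  have hRε : 0 ≤ R + ε := by linarith
  have hlt : R + ε < R + 2 * ε := by linarith
  by_cases h : ∀ i, R + 2 * ε ≤ ‖x - center R δ i‖
  · right
    refine ⟨?_, h⟩
    simp only [fluidCutoff, cutoff_of_ge hRε hlt (h 0), cutoff_of_ge hRε hlt (h 1)]
    ring
  · push Not at h
    obtain ⟨i, hi⟩ := h
    left
    have h1 := norm_center hR hδ i
    have h2 := norm_sub_norm_le x (center R δ i)
    have hxN : ‖x‖ ≤ N := by linarith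
    have h0 : cutoff 0 N (2 * N) x = 0 :=
      cutoff_of_le (by linarith) (by linarith) (by simpa using hxN)
    have hj : ∀ j, j ≠ i → R + 2 * ε ≤ ‖x - center R δ j‖ := by
      intro j hij
      have h3 := dist_center hR hδ hij
      have h4 := dist_triangle_left (center R δ j) (center R δ i) x
      rw [dist_eq_norm x, dist_eq_norm x] at h4
      linarith
    refine ⟨i, ?_, hxN, hj⟩
    fin_cases i
    · have := cutoff_of_ge hRε hlt (hj 1 (by decide))
      simp only [fluidCutoff, h0, this, Fin.zero_eta]
      ring
    · have := cutoff_of_ge hRε hlt (hj 0 (by decide))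
      simp only [fluidCutoff, h0, this, Fin.mk_one]
      ring

lemma fluidCutoff_mem_Icc (hR : 0 < R) (hε : 0 < ε) (hεδ : 4 * ε ≤ δ)
    (hN : 2 * (R + δ) ≤ N) (x : Plane) : fluidCutoff R δ ε N x ∈ Icc (0 : ℝ) 1 := by
  rcases fluidCutoff_cases hR hε hεδ hN x with ⟨i, h, -⟩ | ⟨h, -⟩ <;> rw [h]
  · exact ⟨cutoff_nonneg, cutoff_le_one⟩
  · exact ⟨by linarith [cutoff_le_one (c := 0) (x := x) (α := N) (β := 2 * N)],
      by linarith [cutoff_nonneg (c := 0) (x := x) (α := N) (β := 2 * N)]⟩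

lemma fluidCutoff_ne_zero (hR : 0 < R) (hε : 0 < ε) (hεδ : 4 * ε ≤ δ)
    (hN : 2 * (R + δ) ≤ N) {x : Plane} (hx : fluidCutoff R δ ε N x ≠ 0) :
    ‖x‖ ≤ 2 * N ∧ ∀ i, R + ε ≤ ‖x - center R δ i‖ := by
  have hδ : 0 < δ := by linarith
  rcases fluidCutoff_cases hR hε hεδ hN x with ⟨i, h, h1, h2⟩ | ⟨h, h1⟩ <;> rw [h] at hx
  · refine ⟨by linarith [norm_nonneg x], fun j => ?_⟩
    by_cases hij : j = i
    · by_contra! hlt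
      rw [hij] at hlt
      exact hx (cutoff_of_le (by linarith) (by linarith) hlt.le)
    · linarith [h2 j hij]
  · refine ⟨?_, fun j => by linarith [h1 j]⟩
    by_contra! hlt
    refine hx ?_
    rw [cutoff_of_ge (by linarith) (by linarith) (by simpa using hlt.le), sub_self]

lemma tsupport_fluidCutoff (hR : 0 < R) (hε : 0 < ε) (hεδ : 4 * ε ≤ δ) (hN : 2 * (R + δ) ≤ N) :
    HasCompactSupport (fluidCutoff R δ ε N) ∧
      tsupport (fluidCutoff R δ ε N) ⊆ exteriorDomain R δ := by
  constructor
  · refine HasCompactSupport.intro (isCompact_closedBall (0 : Plane) (2 * N)) fun x hx => ?_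
    by_contra h
    exact hx (by simpa using (fluidCutoff_ne_zero hR hε hεδ hN h).1)
  · have hcl : IsClosed {x : Plane | ∀ i, R + ε ≤ ‖x - center R δ i‖} := by
      simp only [ofPred_forall]
      exact isClosed_iInter fun i => isClosed_le (by fun_prop) (by fun_prop)
    refine (closure_minimal (fun x hx => (fluidCutoff_ne_zero hR hε hεδ hN hx).2) hcl).trans
      fun x hx => ?_
    rw [mem_exteriorDomain hR]
    intro i
    rw [dist_eq_norm]
    linarith [hx i]

lemma annulus_subset (hR : 0 < R) (hδ : 0 < δ) (i : Fin 2) {α β : ℝ} (hα : R ≤ α)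
    (hβ : β < R + δ) :
    {x | α ≤ ‖x - center R δ i‖ ∧ ‖x - center R δ i‖ ≤ β} ⊆ closure (exteriorDomain R δ) := by
  rintro x ⟨h1, h2⟩
  rw [mem_closure_exteriorDomain hR hδ]
  intro j
  by_cases hij : j = i
  · rw [hij, dist_eq_norm]; linarith
  · exact (lt_dist_other hR hδ hij (by rw [dist_eq_norm]; linarith)).le

lemma fderiv_fluidCutoff (ε N : ℝ) (x v : Plane) :
    fderiv ℝ (fluidCutoff R δ ε N) x v
      = fderiv ℝ (cutoff (center R δ 0) (R + ε) (R + 2 * ε)) x v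
        + fderiv ℝ (cutoff (center R δ 1) (R + ε) (R + 2 * ε)) x v
        - fderiv ℝ (cutoff 0 N (2 * N)) x v := by
  have hd : ∀ (c : Plane) (α β : ℝ), HasFDerivAt (cutoff c α β) (fderiv ℝ (cutoff c α β) x) x :=
    fun c α β => ((contDiff_cutoff c).differentiable (by norm_num) x).hasFDerivAt
  have h := ((((hd (center R δ 0) (R + ε) (R + 2 * ε)).add
    (hd (center R δ 1) (R + ε) (R + 2 * ε))).sub_const 1).sub (hd 0 N (2 * N))).fderiv
  exact congrArg (fun L : Plane →L[ℝ] ℝ => L v) h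

lemma integrable_fderiv_cutoff {c : Plane} {α β : ℝ} (hα : 0 ≤ α) (hαβ : α < β)
    {F : Plane → Plane} (hF : ContinuousOn F {x | α ≤ ‖x - c‖ ∧ ‖x - c‖ ≤ β}) :
    Integrable (fun x => fderiv ℝ (cutoff c α β) x (F x)) := by
  have hcomp : IsCompact {x : Plane | α ≤ ‖x - c‖ ∧ ‖x - c‖ ≤ β} := by
    refine (isCompact_closedBall c β).of_isClosed_subset ?_ fun x hx => ?_
    · have hc : Continuous fun x : Plane => ‖x - c‖ := by fun_prop
      exact (isClosed_le continuous_const hc).inter (isClosed_le hc continuous_const)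
    · rw [Metric.mem_closedBall, dist_eq_norm]; exact hx.2
  have h : IntegrableOn (fun x => fderiv ℝ (cutoff c α β) x (F x))
      {x | α ≤ ‖x - c‖ ∧ ‖x - c‖ ≤ β} :=
    ContinuousOn.integrableOn_compact hcomp
      (((contDiff_cutoff c).continuous_fderiv (by norm_num)).continuousOn.clm_apply hF)
  refine (integrableOn_iff_integrable_of_support_subset fun x hx => ?_).1 h
  constructor
  · by_contra! hlt
    exact hx (by simp [fderiv_cutoff_eq_zero_of_lt hα hαβ hlt])
  · by_contra! hlt
    exact hx (by simp [fderiv_cutoff_eq_zero_of_gt hα hαβ hlt])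

lemma abs_circleFlux_le {F : Plane → Plane} {c : Plane} {r B : ℝ} (hr : 0 ≤ r)
    (h : ∀ t, ‖F (c + r • unitVec t)‖ ≤ B) : |circleFlux c F r| ≤ 2 * B * r * (2 * Real.pi) := by
  rw [← Real.norm_eq_abs, circleFlux]
  refine (intervalIntegral.norm_integral_le_of_norm_le_const (C := 2 * B * r)
    fun t _ => ?_).trans_eq ?_
  · rw [norm_mul, Real.norm_of_nonneg hr]
    refine mul_le_mul_of_nonneg_right ?_ hr
    rw [Real.norm_eq_abs]
    refine (abs_add_le _ _).trans ?_
    rw [abs_mul, abs_mul]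
    have h0 := (abs_apply_le_norm (F (c + r • unitVec t)) 0).trans (h t)
    have h1 := (abs_apply_le_norm (F (c + r • unitVec t)) 1).trans (h t)
    have h2 := Real.abs_cos_le_one t
    have h3 := Real.abs_sin_le_one t
    nlinarith [abs_nonneg (F (c + r • unitVec t) 0), abs_nonneg (F (c + r • unitVec t) 1)]
  · rw [sub_zero, abs_of_pos Real.two_pi_pos]

/-- One-sided divergence theorem in the exterior of the two disks. -/
theorem setIntegral_le_neg_sum_circleFlux (hR : 0 < R) (hδ : 0 < δ) {F : Plane → Plane}
    (hF : ContDiffOn ℝ 1 F (exteriorDomain R δ))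
    (hFc : ContinuousOn F (closure (exteriorDomain R δ)))
    (hFinf : F =O[Bornology.cobounded Plane] fun x => (‖x‖ ^ 2)⁻¹) {k : Plane → ℝ}
    (hk : IntegrableOn k (exteriorDomain R δ))
    (hle : ∀ x ∈ exteriorDomain R δ, k x ≤ divergence F x) :
    ∫ x in exteriorDomain R δ, k x ≤ -∑ i, circleFlux (center R δ i) F R := by
  set D := exteriorDomain R δ with hD
  have hDm : MeasurableSet D := isOpen_exteriorDomain.measurableSet
  -- With `ε ≤ δ / 4` the disks of radius `R + 2 ε` have no common interior point, so at most one
  -- cutoff is active at each point.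
  set ε : ℕ → ℝ := fun n => δ / 4 * (1 / ((n : ℝ) + 1)) with hεdef
  set N : ℕ → ℝ := fun n => 2 * (R + δ) + n with hNdef
  have hinv : ∀ n : ℕ, 0 < 1 / ((n : ℝ) + 1) ∧ 1 / ((n : ℝ) + 1) ≤ 1 := fun n =>
    ⟨Nat.one_div_pos_of_nat, by rw [div_le_one (by positivity)]; linarith [n.cast_nonneg (α := ℝ)]⟩
  have hε : ∀ n, 0 < ε n := fun n => mul_pos (by linarith) (hinv n).1
  have hεδ : ∀ n, 4 * ε n ≤ δ := fun n => by
    have := mul_le_mul_of_nonneg_left (hinv n).2 hδ.le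
    simp only [hεdef]; linarith
  have hε0 : Tendsto ε atTop (𝓝 0) := by
    have h := (tendsto_one_div_add_atTop_nhds_zero_nat (𝕜 := ℝ)).const_mul (δ / 4)
    rwa [mul_zero] at h
  have hN : ∀ n, 2 * (R + δ) ≤ N n := fun n => by
    simp only [hNdef]; linarith [n.cast_nonneg (α := ℝ)]
  have hNtop : Tendsto N atTop atTop :=
    tendsto_atTop_add_const_left _ _ tendsto_natCast_atTop_atTop
  have hann : ∀ i n, ContinuousOn F
      {x | R + ε n ≤ ‖x - center R δ i‖ ∧ ‖x - center R δ i‖ ≤ R + 2 * ε n} := fun i n =>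
    hFc.mono (annulus_subset hR hδ i (by linarith [hε n]) (by linarith [hε n, hεδ n]))
  have hann0 : ∀ n, ContinuousOn F {x | N n ≤ ‖x - 0‖ ∧ ‖x - 0‖ ≤ 2 * N n} := fun n =>
    hF.continuousOn.mono fun x hx => mem_exteriorDomain_of_large hR hδ (by
      have := hx.1
      rw [sub_zero] at this
      linarith [hN n])
  -- The averaging annuli shrink to the boundary circle, where the flux is continuous in the radius
  -- from the outside.
  have hflux : ∀ i, Tendsto (fun n => ∫ x, fderiv ℝ (cutoff (center R δ i) (R + ε n)
      (R + 2 * ε n)) x (F x)) atTop (𝓝 (circleFlux (center R δ i) F R)) := by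
    intro i
    have hcont := continuousOn_circleFlux (center R δ i) hR (show R < R + δ / 2 by linarith)
      (hFc.mono (annulus_subset hR hδ i le_rfl (by linarith)))
    have hcw := hcont R ⟨le_rfl, by linarith⟩
    rw [Metric.tendsto_atTop]
    intro η hη
    obtain ⟨ρ, hρ, h⟩ := Metric.continuousWithinAt_iff.1 hcw (η / 2) (by linarith)
    obtain ⟨n₀, hn₀⟩ := Metric.tendsto_atTop.1 hε0 (ρ / 2) (by linarith)
    refine ⟨n₀, fun n hn => ?_⟩
    have h1 := hn₀ n hn
    rw [Real.dist_eq, sub_zero, abs_of_pos (hε n)] at h1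
    rw [Real.dist_eq]
    refine lt_of_le_of_lt (abs_integral_fderiv_cutoff_sub_le _ (by linarith [hε n])
      (by linarith [hε n]) (hann i n) (η := η / 2) fun r hr => ?_) (by linarith)
    refine (h (x := r) ⟨by linarith [hr.1, hε n], by linarith [hr.2, hεδ n]⟩ ?_).le
    rw [Real.dist_eq, abs_of_nonneg (by linarith [hr.1, hε n])]
    linarith [hr.2]
  -- A field of size `B / r²` has flux at most `4 π B / r` through the circle of radius `r`, the
  -- factor 2 coming from bounding the two components separately.
  have hinfty : Tendsto (fun n => ∫ x, fderiv ℝ (cutoff 0 (N n) (2 * N n)) x (F x)) atTop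
      (𝓝 0) := by
    obtain ⟨B, hB0, hB⟩ := hFinf.exists_pos
    rw [Asymptotics.isBigOWith_iff] at hB
    obtain ⟨ρ, hρ⟩ := (Metric.hasBasis_cobounded_compl_closedBall (0 : Plane)).eventually_iff.1 hB
    have hlim : Tendsto (fun n => 4 * Real.pi * B * (N n)⁻¹) atTop (𝓝 0) := by
      simpa using (tendsto_inv_atTop_zero.comp hNtop).const_mul (4 * Real.pi * B)
    refine squeeze_zero_norm' ?_ hlim
    filter_upwards [hNtop.eventually_gt_atTop ρ] with n hn
    have hNpos : 0 < N n := by linarith [hN n]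
    rw [Real.norm_eq_abs]
    have h := abs_integral_fderiv_cutoff_sub_le 0 hNpos (by linarith : N n < 2 * N n) (hann0 n)
      (φ := 0) (η := 4 * Real.pi * B * (N n)⁻¹) fun r hr => ?_
    · rwa [sub_zero] at h
    · have hrpos : 0 < r := hNpos.trans_le hr.1
      rw [sub_zero]
      refine (abs_circleFlux_le (B := B * (r ^ 2)⁻¹) hrpos.le fun t => ?_).trans ?_
      · have hnorm : ‖(0 : Plane) + r • unitVec t‖ = r := by
          simpa using norm_circle_sub 0 hrpos.le t
        have h := hρ.2 (x := 0 + r • unitVec t) (by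
          rw [mem_compl_iff, Metric.mem_closedBall, dist_zero_right, hnorm, not_le]
          exact hn.trans_le hr.1)
        rwa [hnorm, norm_inv, norm_pow, Real.norm_of_nonneg hrpos.le] at h
      · rw [show 2 * (B * (r ^ 2)⁻¹) * r * (2 * Real.pi) = 4 * Real.pi * B * r⁻¹ by
          field_simp; ring]
        have := Real.pi_pos
        gcongr
        exact hr.1
  -- Only the minorant `k` is passed to the limit, so integrability is needed for `k` and never for
  -- the divergence.
  have hk' : Tendsto (fun n => ∫ x in D, fluidCutoff R δ (ε n) (N n) x * k x) atTop
      (𝓝 (∫ x in D, k x)) := by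
    refine tendsto_integral_of_dominated_convergence (fun x => ‖k x‖) (fun n => ?_) hk.norm
      (fun n => ?_) ?_
    · exact (contDiff_fluidCutoff _ _).continuous.aestronglyMeasurable.mul hk.aestronglyMeasurable
    · refine Eventually.of_forall fun x => ?_
      have h := fluidCutoff_mem_Icc hR (hε n) (hεδ n) (hN n) x
      rw [norm_mul, Real.norm_of_nonneg h.1]
      exact mul_le_of_le_one_left (norm_nonneg _) h.2
    · rw [ae_restrict_iff' hDm]
      refine Eventually.of_forall fun x hx => ?_
      have hxD := (mem_exteriorDomain hR).1 hx
      have h1 : ∀ᶠ n in atTop, fluidCutoff R δ (ε n) (N n) x = 1 := by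
        have hev : ∀ i, ∀ᶠ n in atTop, R + 2 * ε n ≤ ‖x - center R δ i‖ := by
          intro i
          have hlim : Tendsto (fun n => R + 2 * ε n) atTop (𝓝 R) := by
            simpa using (hε0.const_mul 2).const_add R
          have := hxD i
          rw [dist_eq_norm] at this
          exact (hlim.eventually_lt_const this).mono fun n hn => hn.le
        filter_upwards [hev 0, hev 1, hNtop.eventually_ge_atTop ‖x‖] with n h0 h1 h2
        have hp := hε n
        have hq := hN n
        simp only [fluidCutoff]
        rw [cutoff_of_ge (by linarith) (by linarith) h0,
          cutoff_of_ge (by linarith) (by linarith) h1,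
          cutoff_of_le (by linarith) (by linarith) (by simpa using h2)]
        norm_num
      refine (tendsto_const_nhds (x := k x)).congr' ?_
      filter_upwards [h1] with n hn
      rw [hn, one_mul]
  have hlim := (((hflux 0).add (hflux 1)).sub hinfty).neg
  refine (le_of_tendsto_of_tendsto' hk' hlim fun n => ?_).trans_eq ?_
  · obtain ⟨hs, hsub⟩ := tsupport_fluidCutoff hR (hε n) (hεδ n) (hN n)
    obtain ⟨hint, heq⟩ := integral_mul_divergence isOpen_exteriorDomain
      (contDiff_fluidCutoff (ε n) (N n)) hs hsub hF
    have hsplit : ∫ x, fderiv ℝ (fluidCutoff R δ (ε n) (N n)) x (F x)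
        = (∫ x, fderiv ℝ (cutoff (center R δ 0) (R + ε n) (R + 2 * ε n)) x (F x))
        + (∫ x, fderiv ℝ (cutoff (center R δ 1) (R + ε n) (R + 2 * ε n)) x (F x))
        - ∫ x, fderiv ℝ (cutoff 0 (N n) (2 * N n)) x (F x) := by
      have hp := hε n
      have hq := hN n
      have i0 := integrable_fderiv_cutoff (by linarith) (by linarith) (hann 0 n)
      have i1 := integrable_fderiv_cutoff (by linarith) (by linarith) (hann 1 n)
      have i2 := integrable_fderiv_cutoff (by linarith) (by linarith) (hann0 n)
      simp only [fderiv_fluidCutoff]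
      rw [← integral_add i0 i1]
      exact integral_sub (i0.add i1) i2
    rw [← hsplit, ← heq]
    calc ∫ x in D, fluidCutoff R δ (ε n) (N n) x * k x
        ≤ ∫ x in D, fluidCutoff R δ (ε n) (N n) x * divergence F x := by
          refine setIntegral_mono_on ?_ hint.integrableOn hDm fun x hx =>
            mul_le_mul_of_nonneg_left (hle x hx)
              (fluidCutoff_mem_Icc hR (hε n) (hεδ n) (hN n) x).1
          refine hk.norm.mono' ((contDiff_fluidCutoff _ _).continuous.aestronglyMeasurable.mul
            hk.aestronglyMeasurable) (Eventually.of_forall fun x => ?_)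
          have h := fluidCutoff_mem_Icc hR (hε n) (hεδ n) (hN n) x
          rw [norm_mul, Real.norm_of_nonneg h.1]
          exact mul_le_of_le_one_left (norm_nonneg _) h.2
      _ = ∫ x, fluidCutoff R δ (ε n) (N n) x * divergence F x := by
          refine setIntegral_eq_integral_of_forall_compl_eq_zero fun x hx => ?_
          rw [image_eq_zero_of_notMem_tsupport fun h => hx (hsub h), zero_mul]
  · rw [Fin.sum_univ_two, sub_zero]

end Divergence

/-! ### Calculus of partial derivatives. -/

section Partial

/-- The partial derivative `∂ⱼ f`. -/
def pd (j : Fin 2) (f : Plane → ℝ) (x : Plane) : ℝ := fderiv ℝ f x (EuclideanSpace.single j 1)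

variable {f g : Plane → ℝ} {x : Plane} {j : Fin 2}

lemma HasFDerivAt.pd_eq {L : Plane →L[ℝ] ℝ} (h : HasFDerivAt f L x) (j : Fin 2) :
    pd j f x = L (EuclideanSpace.single j 1) := by rw [pd, h.fderiv]

lemma pd_congr (h : f =ᶠ[𝓝 x] g) : pd j f x = pd j g x := by rw [pd, h.fderiv_eq, pd]

lemma pd_add (hf : DifferentiableAt ℝ f x) (hg : DifferentiableAt ℝ g x) :
    pd j (fun y => f y + g y) x = pd j f x + pd j g x := by
  simp [pd, fderiv_fun_add hf hg]

lemma pd_sub (hf : DifferentiableAt ℝ f x) (hg : DifferentiableAt ℝ g x) :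
    pd j (fun y => f y - g y) x = pd j f x - pd j g x := by
  simp [pd, fderiv_fun_sub hf hg]

lemma pd_neg : pd j (fun y => -f y) x = -pd j f x := by
  simp [pd, fderiv_fun_neg]

lemma pd_mul (hf : DifferentiableAt ℝ f x) (hg : DifferentiableAt ℝ g x) :
    pd j (fun y => f y * g y) x = pd j f x * g x + f x * pd j g x := by
  simp [pd, fderiv_fun_mul hf hg]
  ring

lemma pd_const (a : ℝ) : pd j (fun _ => a) x = 0 := by
  simp [pd]

lemma pd_const_mul (a : ℝ) (hf : DifferentiableAt ℝ f x) :
    pd j (fun y => a * f y) x = a * pd j f x := by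
  simp [pd, fderiv_const_mul hf]

lemma contDiffAt_pd {n : ℕ∞} (hf : ContDiffAt ℝ (n + 1) f x) : ContDiffAt ℝ n (pd j f) x :=
  (hf.fderiv_right le_rfl).clm_apply contDiffAt_const

lemma contDiffAt_pd_one (hf : ContDiffAt ℝ 2 f x) : ContDiffAt ℝ 1 (pd j f) x :=
  contDiffAt_pd (n := 1) (by norm_num; exact hf)

lemma pd_comm (hf : ContDiffAt ℝ 2 f x) (i j : Fin 2) : pd i (pd j f) x = pd j (pd i f) x := by
  have hd : DifferentiableAt ℝ (fderiv ℝ f) x :=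
    (hf.fderiv_right (m := 1) (by norm_num)).differentiableAt (by norm_num)
  have key : ∀ i j : Fin 2, pd i (pd j f) x
      = fderiv ℝ (fderiv ℝ f) x (EuclideanSpace.single i 1) (EuclideanSpace.single j 1) := by
    intro i j
    change fderiv ℝ (fun y => fderiv ℝ f y (EuclideanSpace.single j 1)) x _ = _
    rw [fderiv_clm_apply hd (differentiableAt_const _)]
    simp
  rw [key, key]
  exact (hf.isSymmSndFDerivAt (by simp)).eq _ _

lemma contDiffAt_coord {n : WithTop ℕ∞} {F : Plane → Plane} (h : ContDiffAt ℝ n F x) (i : Fin 2) :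
    ContDiffAt ℝ n (fun y => F y i) x :=
  contDiffAt_euclidean.1 h i

lemma divergence_eq {F : Plane → Plane} (h : DifferentiableAt ℝ F x) :
    divergence F x = pd 0 (fun y => F y 0) x + pd 1 (fun y => F y 1) x := by
  simp only [divergence, pd, fderiv_component h]

end Partial

/-! ### Stokes flows and the field of stresses. -/

section Flow

variable {R δ μ : ℝ} {u w z : Plane → Plane} {p q : Plane → ℝ} {x : Plane}

lemma stress_apply (K : Set Plane) (i j : Fin 2) :
    stress K μ u p x i j = -(p x * (1 : Matrix (Fin 2) (Fin 2) ℝ) i j)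
      + μ * (fderivWithin ℝ u K x (EuclideanSpace.single j 1) i
        + fderivWithin ℝ u K x (EuclideanSpace.single i 1) j) := by
  simp only [stress, strain, jacobianWithin, Matrix.add_apply, Matrix.neg_apply, Matrix.smul_apply,
    Matrix.transpose_apply, Matrix.of_apply, smul_eq_mul]
  ring

lemma stress_symm (K : Set Plane) (i j : Fin 2) :
    stress K μ u p x i j = stress K μ u p x j i := by
  rw [stress_apply, stress_apply, ← Matrix.transpose_apply 1, Matrix.transpose_one, add_comm
    (fderivWithin ℝ u K x (EuclideanSpace.single j 1) i)]

/-- The vector field `σ[u, p] z`. -/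
def stressField (K : Set Plane) (μ : ℝ) (u : Plane → Plane) (p : Plane → ℝ) (z : Plane → Plane)
    (x : Plane) : Plane := WithLp.toLp 2 ((stress K μ u p x).mulVec (z x).ofLp)

lemma stressField_apply (K : Set Plane) (i : Fin 2) :
    stressField K μ u p z x i
      = stress K μ u p x i 0 * z x 0 + stress K μ u p x i 1 * z x 1 := by
  change (stress K μ u p x).mulVec (z x).ofLp i = _
  rw [Matrix.mulVec, dotProduct, Fin.sum_univ_two]

/-- Symmetry of the stress moves it from `z` to the normal: `σz · ν = z · σν`. This links the
divergence theorem with the equilibrium conditions. -/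
lemma circleFlux_stressField (i : Fin 2) :
    circleFlux (center R δ i) (stressField (closure (exteriorDomain R δ)) μ u p z) R
      = boundaryForce R δ μ u p i z := by
  unfold circleFlux boundaryForce
  refine intervalIntegral.integral_congr fun t _ => ?_
  simp only [stressField_apply, dotProduct, Matrix.mulVec, Fin.sum_univ_two, unitVec]
  rw [stress_symm _ 1 0]
  simp only [Matrix.cons_val_zero, Matrix.cons_val_one]
  ring

/-- `(w, q)` is a classical solution of the Stokes system in the exterior of the two disks,
regular up to the boundary, written in coordinates. -/
structure IsStokesFlow (R δ μ : ℝ) (w : Plane → Plane) (q : Plane → ℝ) : Prop where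
  contDiffOn_velocity : ContDiffOn ℝ 2 w (exteriorDomain R δ)
  contDiffOn_velocity_closure : ContDiffOn ℝ 1 w (closure (exteriorDomain R δ))
  contDiffOn_pressure : ContDiffOn ℝ 1 q (exteriorDomain R δ)
  continuousOn_pressure_closure : ContinuousOn q (closure (exteriorDomain R δ))
  momentum : ∀ x ∈ exteriorDomain R δ, ∀ i : Fin 2,
    μ * (pd 0 (pd 0 fun y => w y i) x + pd 1 (pd 1 fun y => w y i) x) = pd i q x
  incompressible : ∀ x ∈ exteriorDomain R δ,
    pd 0 (fun y => w y 0) x + pd 1 (fun y => w y 1) x = 0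

lemma stress_apply_of_mem (hx : x ∈ exteriorDomain R δ) (hw : DifferentiableAt ℝ w x)
    (i j : Fin 2) : stress (closure (exteriorDomain R δ)) μ w q x i j
      = -(q x * (1 : Matrix (Fin 2) (Fin 2) ℝ) i j)
        + μ * (pd j (fun y => w y i) x + pd i (fun y => w y j) x) := by
  rw [stress_apply, fderivWithin_of_mem_nhds (closure_mem_nhds hx)]
  simp only [pd, fderiv_component hw]

namespace IsStokesFlow

lemma contDiffAt (h : IsStokesFlow R δ μ w q) (hx : x ∈ exteriorDomain R δ) :
    ContDiffAt ℝ 2 w x :=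
  h.contDiffOn_velocity.contDiffAt (isOpen_exteriorDomain.mem_nhds hx)

lemma contDiffAt_pressure (h : IsStokesFlow R δ μ w q) (hx : x ∈ exteriorDomain R δ) :
    ContDiffAt ℝ 1 q x :=
  h.contDiffOn_pressure.contDiffAt (isOpen_exteriorDomain.mem_nhds hx)

lemma differentiableAt (h : IsStokesFlow R δ μ w q) (hx : x ∈ exteriorDomain R δ) :
    DifferentiableAt ℝ w x := (h.contDiffAt hx).differentiableAt (by norm_num)

lemma stressField_eventuallyEq (h : IsStokesFlow R δ μ w q) (hx : x ∈ exteriorDomain R δ)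
    (z : Plane → Plane) (i : Fin 2) :
    (fun y => stressField (closure (exteriorDomain R δ)) μ w q z y i) =ᶠ[𝓝 x] fun y =>
      -(q y * z y i) + μ * ((pd 0 (fun y => w y i) y + pd i (fun y => w y 0) y) * z y 0
        + (pd 1 (fun y => w y i) y + pd i (fun y => w y 1) y) * z y 1) := by
  filter_upwards [isOpen_exteriorDomain.mem_nhds hx] with y hy
  rw [stressField_apply, stress_apply_of_mem hy (h.differentiableAt hy),
    stress_apply_of_mem hy (h.differentiableAt hy)]
  rcases Fin.exists_fin_two.1 ⟨i, rfl⟩ with rfl | rfl <;> simp <;> ring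

lemma contDiffOn_stressField (h : IsStokesFlow R δ μ w q)
    (hz : ContDiffOn ℝ 1 z (exteriorDomain R δ)) :
    ContDiffOn ℝ 1 (stressField (closure (exteriorDomain R δ)) μ w q z) (exteriorDomain R δ) := by
  intro x hx
  refine ContDiffAt.contDiffWithinAt (contDiffAt_euclidean.2 fun i => ?_)
  refine ContDiffAt.congr_of_eventuallyEq ?_ (h.stressField_eventuallyEq hx z i)
  have hq := h.contDiffAt_pressure hx
  have hw : ∀ i j : Fin 2, ContDiffAt ℝ 1 (pd j fun y => w y i) x := fun i j =>
    contDiffAt_pd_one (contDiffAt_coord (h.contDiffAt hx) i)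
  have hz' : ∀ j : Fin 2, ContDiffAt ℝ 1 (fun y => z y j) x := fun j =>
    contDiffAt_coord (hz.contDiffAt (isOpen_exteriorDomain.mem_nhds hx)) j
  exact (hq.mul (hz' i)).neg.add (contDiffAt_const.mul
    ((((hw i 0).add (hw 0 i)).mul (hz' 0)).add (((hw i 1).add (hw 1 i)).mul (hz' 1))))

/-- This is `div (σ z) = 2 μ e(w) : e(z)`, with `e` the symmetric gradient. The momentum equation
and the differentiated incompressibility of `w` remove the terms with second derivatives, and the
pressure term drops because `z` is divergence-free at the point. The result is symmetric in `w` and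
`z`, which is the source of reciprocity. -/
lemma divergence_stressField (h : IsStokesFlow R δ μ w q)
    (hz : ContDiffOn ℝ 1 z (exteriorDomain R δ)) (hx : x ∈ exteriorDomain R δ)
    (hdiv : pd 0 (fun y => z y 0) x + pd 1 (fun y => z y 1) x = 0) :
    divergence (stressField (closure (exteriorDomain R δ)) μ w q z) x
      = μ * (2 * pd 0 (fun y => w y 0) x * pd 0 (fun y => z y 0) x
        + (pd 1 (fun y => w y 0) x + pd 0 (fun y => w y 1) x)
          * (pd 1 (fun y => z y 0) x + pd 0 (fun y => z y 1) x)
        + 2 * pd 1 (fun y => w y 1) x * pd 1 (fun y => z y 1) x) := by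
  have hnhds := isOpen_exteriorDomain.mem_nhds hx
  have hq : DifferentiableAt ℝ q x := (h.contDiffAt_pressure hx).differentiableAt (by norm_num)
  have hw2 : ∀ i : Fin 2, ContDiffAt ℝ 2 (fun y => w y i) x := fun i =>
    contDiffAt_coord (h.contDiffAt hx) i
  have hw : ∀ i j : Fin 2, DifferentiableAt ℝ (pd j fun y => w y i) x := fun i j =>
    (contDiffAt_pd_one (hw2 i)).differentiableAt (by norm_num)
  have hz' : ∀ j : Fin 2, DifferentiableAt ℝ (fun y => z y j) x := fun j =>
    (contDiffAt_coord (hz.contDiffAt hnhds) j).differentiableAt (by norm_num)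
  have hF := ((h.contDiffOn_stressField hz).contDiffAt hnhds).differentiableAt (by norm_num)
  have hpd : ∀ i : Fin 2,
      pd i (fun y => stressField (closure (exteriorDomain R δ)) μ w q z y i) x
      = -(pd i q x * z x i + q x * pd i (fun y => z y i) x)
        + μ * (((pd i (pd 0 fun y => w y i) x + pd i (pd i fun y => w y 0) x) * z x 0
          + (pd 0 (fun y => w y i) x + pd i (fun y => w y 0) x) * pd i (fun y => z y 0) x)
          + ((pd i (pd 1 fun y => w y i) x + pd i (pd i fun y => w y 1) x) * z x 1
          + (pd 1 (fun y => w y i) x + pd i (fun y => w y 1) x) * pd i (fun y => z y 1) x)) := by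
    intro i
    have ha : ∀ j : Fin 2, DifferentiableAt ℝ
        (fun y => pd j (fun y => w y i) y + pd i (fun y => w y j) y) x := fun j =>
      (hw i j).add (hw j i)
    have hm : ∀ j : Fin 2, DifferentiableAt ℝ
        (fun y => (pd j (fun y => w y i) y + pd i (fun y => w y j) y) * z y j) x := fun j =>
      (ha j).mul (hz' j)
    have hs : DifferentiableAt ℝ
        (fun y => (pd 0 (fun y => w y i) y + pd i (fun y => w y 0) y) * z y 0
          + (pd 1 (fun y => w y i) y + pd i (fun y => w y 1) y) * z y 1) x := (hm 0).add (hm 1)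
    have hqz : DifferentiableAt ℝ (fun y => q y * z y i) x := hq.mul (hz' i)
    rw [pd_congr (h.stressField_eventuallyEq hx z i),
      pd_add hqz.fun_neg (hs.const_mul μ),
      pd_neg, pd_mul hq (hz' i), pd_const_mul μ hs,
      pd_add (hm 0) (hm 1), pd_mul (ha 0) (hz' 0),
      pd_mul (ha 1) (hz' 1), pd_add (hw i 0) (hw 0 i), pd_add (hw i 1) (hw 1 i)]
  have hgrad : ∀ j : Fin 2, pd j (pd 0 fun y => w y 0) x + pd j (pd 1 fun y => w y 1) x = 0 := by
    intro j
    rw [← pd_add (hw 0 0) (hw 1 1)]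
    have : (fun y => pd 0 (fun y => w y 0) y + pd 1 (fun y => w y 1) y) =ᶠ[𝓝 x] fun _ => 0 := by
      filter_upwards [hnhds] with y hy using h.incompressible y hy
    rw [pd_congr this, pd_const]
  rw [divergence_eq hF, hpd, hpd]
  have m0 := h.momentum x hx 0
  have m1 := h.momentum x hx 1
  have g0 := hgrad 0
  have g1 := hgrad 1
  have s0 := pd_comm (hw2 0) 0 1
  have s1 := pd_comm (hw2 1) 0 1
  linear_combination (z x 0) * m0 + (z x 1) * m1 - q x * hdiv + μ * z x 0 * g0
    + μ * z x 1 * g1 + μ * z x 1 * s0 - μ * z x 0 * s1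

lemma continuousOn_fderivWithin (h : IsStokesFlow R δ μ w q) (hR : 0 < R) (hδ : 0 < δ) :
    ContinuousOn (fun x => fderivWithin ℝ w (closure (exteriorDomain R δ)) x)
      (closure (exteriorDomain R δ)) :=
  h.contDiffOn_velocity_closure.continuousOn_fderivWithin (uniqueDiffOn_closure hR hδ) le_rfl

lemma continuousOn_jacobian (h : IsStokesFlow R δ μ w q) (hR : 0 < R) (hδ : 0 < δ) (i j : Fin 2) :
    ContinuousOn (fun x => fderivWithin ℝ w (closure (exteriorDomain R δ)) x
      (EuclideanSpace.single j 1) i) (closure (exteriorDomain R δ)) :=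
  (EuclideanSpace.proj (𝕜 := ℝ) i).continuous.comp_continuousOn
    ((h.continuousOn_fderivWithin hR hδ).clm_apply continuousOn_const)

lemma continuousOn_stress (h : IsStokesFlow R δ μ w q) (hR : 0 < R) (hδ : 0 < δ) (i j : Fin 2) :
    ContinuousOn (fun x => stress (closure (exteriorDomain R δ)) μ w q x i j)
      (closure (exteriorDomain R δ)) := by
  simp only [stress_apply]
  exact (h.continuousOn_pressure_closure.mul continuousOn_const).neg.add (continuousOn_const.mul
    ((h.continuousOn_jacobian hR hδ i j).add (h.continuousOn_jacobian hR hδ j i)))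

lemma continuousOn_stressField (h : IsStokesFlow R δ μ w q) (hR : 0 < R) (hδ : 0 < δ)
    (hz : ContinuousOn z (closure (exteriorDomain R δ))) :
    ContinuousOn (stressField (closure (exteriorDomain R δ)) μ w q z)
      (closure (exteriorDomain R δ)) := by
  have hz' : ∀ j : Fin 2, ContinuousOn (fun x => z x j) (closure (exteriorDomain R δ)) := fun j =>
    (EuclideanSpace.proj (𝕜 := ℝ) j).continuous.comp_continuousOn hz
  refine (PiLp.continuous_toLp 2 _).comp_continuousOn (continuousOn_pi.2 fun i => ?_)
  have := ((h.continuousOn_stress hR hδ i 0).mul (hz' 0)).add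
    ((h.continuousOn_stress hR hδ i 1).mul (hz' 1))
  refine this.congr fun x _ => ?_
  simp [Matrix.mulVec, dotProduct, Fin.sum_univ_two]

end IsStokesFlow

lemma continuous_circle_comp (hR : 0 < R) (hδ : 0 < δ) {E : Type*} [TopologicalSpace E]
    {f : Plane → E} (hf : ContinuousOn f (closure (exteriorDomain R δ))) (i : Fin 2) :
    Continuous fun t => f (center R δ i + R • unitVec t) := by
  refine hf.comp_continuous ?_ fun t => circle_mem_closure hR hδ i le_rfl (by linarith) t
  have := continuous_unitVec
  fun_prop

lemma abs_stress_le (hμ : 0 < μ) (hx : x ∈ exteriorDomain R δ) (i j : Fin 2) :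
    |stress (closure (exteriorDomain R δ)) μ w q x i j| ≤ |q x| + 2 * μ * ‖fderiv ℝ w x‖ := by
  rw [stress_apply, fderivWithin_of_mem_nhds (closure_mem_nhds hx)]
  have hb : ∀ i j : Fin 2, |fderiv ℝ w x (EuclideanSpace.single j 1) i| ≤ ‖fderiv ℝ w x‖ := by
    intro i j
    refine (abs_apply_le_norm _ i).trans ?_
    simpa using (fderiv ℝ w x).le_opNorm (EuclideanSpace.single j 1)
  refine (abs_add_le _ _).trans (add_le_add ?_ ?_)
  · rw [abs_neg, abs_mul]
    refine mul_le_of_le_one_right (abs_nonneg _) ?_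
    rw [Matrix.one_apply]
    split_ifs <;> simp
  · rw [abs_mul, abs_of_pos hμ]
    have := (abs_add_le _ _).trans (add_le_add (hb i j) (hb j i))
    nlinarith

lemma norm_stressField_le (hμ : 0 < μ) (hx : x ∈ exteriorDomain R δ) :
    ‖stressField (closure (exteriorDomain R δ)) μ w q z x‖
      ≤ 4 * (|q x| + 2 * μ * ‖fderiv ℝ w x‖) * ‖z x‖ := by
  set B := |q x| + 2 * μ * ‖fderiv ℝ w x‖
  have hB : 0 ≤ B := by positivity
  have hi : ∀ i : Fin 2, |stressField (closure (exteriorDomain R δ)) μ w q z x i|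
      ≤ 2 * B * ‖z x‖ := by
    intro i
    rw [stressField_apply]
    refine (abs_add_le _ _).trans ?_
    rw [abs_mul, abs_mul]
    have h0 := mul_le_mul (abs_stress_le (w := w) (q := q) hμ hx i 0) (abs_apply_le_norm (z x) 0)
      (abs_nonneg _) hB
    have h1 := mul_le_mul (abs_stress_le (w := w) (q := q) hμ hx i 1) (abs_apply_le_norm (z x) 1)
      (abs_nonneg _) hB
    linarith
  have h2 : ∀ v : Plane, ‖v‖ ≤ |v 0| + |v 1| := by
    intro v
    rw [EuclideanSpace.norm_eq]
    refine Real.sqrt_le_iff.2 ⟨by positivity, ?_⟩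
    simp only [Fin.sum_univ_two, Real.norm_eq_abs]
    nlinarith [abs_nonneg (v 0), abs_nonneg (v 1)]
  linarith [h2 (stressField (closure (exteriorDomain R δ)) μ w q z x), hi 0, hi 1]

lemma eventually_mem_exteriorDomain (hR : 0 < R) (hδ : 0 < δ) :
    ∀ᶠ x in Bornology.cobounded Plane, x ∈ exteriorDomain R δ := by
  refine (Metric.hasBasis_cobounded_compl_closedBall (0 : Plane)).eventually_iff.2
    ⟨2 * R + δ, trivial, fun x hx => mem_exteriorDomain_of_large hR hδ ?_⟩
  simpa using hx

/-- Keeps the rates of the stress and of the test field separate: reciprocity pairs `1/|x|` with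
`1/|x|`, and also `1/|x|²` with a bounded field; both products suffice for the divergence theorem.
-/
lemma stressField_isBigO (hR : 0 < R) (hδ : 0 < δ) (hμ : 0 < μ) {a b : Plane → ℝ}
    (hw : (fun x => fderiv ℝ w x) =O[Bornology.cobounded Plane] a)
    (hq : q =O[Bornology.cobounded Plane] a) (hz : z =O[Bornology.cobounded Plane] b) :
    stressField (closure (exteriorDomain R δ)) μ w q z
      =O[Bornology.cobounded Plane] fun x => a x * b x := by
  have h1 : (fun x => 4 * (|q x| + 2 * μ * ‖fderiv ℝ w x‖)) =O[Bornology.cobounded Plane] a :=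
    ((hq.abs_left).add (hw.norm_left.const_mul_left (2 * μ))).const_mul_left 4
  refine Asymptotics.IsBigO.trans ?_ (h1.mul hz.norm_left)
  refine Asymptotics.IsBigO.of_bound 1 ?_
  filter_upwards [eventually_mem_exteriorDomain hR hδ] with x hx
  rw [one_mul]
  exact (norm_stressField_le hμ hx).trans (le_abs_self _)

end Flow

/-! ### Subtraction of the shear flow, and reflection through the origin. -/

section Perturbation

variable {R δ μ : ℝ} {u w z : Plane → Plane} {p q : Plane → ℝ} {x : Plane} {c : Fin 2 → Fin 3 → ℝ}

lemma laplacian_apply (hu : ContDiffAt ℝ 2 u x) (i : Fin 2) :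
    (Δ u) x i = pd 0 (pd 0 fun y => u y i) x + pd 1 (pd 1 fun y => u y i) x := by
  have h1 := hu.laplacian_CLM_comp_left (l := EuclideanSpace.proj (𝕜 := ℝ) i)
  have hui : ContDiffAt ℝ 2 (fun y => u y i) x := contDiffAt_coord hu i
  have hd : DifferentiableAt ℝ (fderiv ℝ fun y => u y i) x :=
    (hui.fderiv_right (m := 1) (by norm_num)).differentiableAt (by norm_num)
  have key : ∀ j : Fin 2, pd j (pd j fun y => u y i) x
      = fderiv ℝ (fderiv ℝ fun y => u y i) x (EuclideanSpace.single j 1)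
        (EuclideanSpace.single j 1) := by
    intro j
    change fderiv ℝ (fun y => fderiv ℝ (fun y => u y i) y (EuclideanSpace.single j 1)) x _ = _
    rw [fderiv_clm_apply hd (differentiableAt_const _)]
    simp
  rw [key, key]
  refine h1.symm.trans ?_
  rw [InnerProductSpace.laplacian_eq_iteratedFDeriv_orthonormalBasis _
    (EuclideanSpace.basisFun (Fin 2) ℝ)]
  simp only [iteratedFDeriv_two_apply, Fin.sum_univ_two, EuclideanSpace.basisFun_apply]
  rfl

lemma gradient_apply (i : Fin 2) : (∇ p) x i = pd i p x := by
  have h := inner_gradient_left (𝕜 := ℝ) (f := p) (x := x) (y := EuclideanSpace.single i 1)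
  rw [pd, ← h, EuclideanSpace.inner_single_right]
  simp

lemma IsEquilibriumFlow.isStokesFlow {U : Plane → Plane}
    (h : IsEquilibriumFlow R δ μ U c u p) : IsStokesFlow R δ μ u p where
  contDiffOn_velocity := h.contDiffOn_velocity
  contDiffOn_velocity_closure := h.contDiffOn_velocity_closure
  contDiffOn_pressure := h.contDiffOn_pressure
  continuousOn_pressure_closure := h.continuousOn_pressure_closure
  momentum x hx i := by
    have hu := h.contDiffOn_velocity.contDiffAt (isOpen_exteriorDomain.mem_nhds hx)
    rw [← laplacian_apply hu, ← gradient_apply, ← h.momentum x hx]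
    simp
  incompressible x hx := by
    have hu := (h.contDiffOn_velocity.contDiffAt (isOpen_exteriorDomain.mem_nhds hx)
      ).differentiableAt (by norm_num)
    rw [← h.incompressible x hx, Fin.sum_univ_two]
    simp only [pd, fderiv_component hu]

lemma IsStokesFlow.sub (hw : IsStokesFlow R δ μ w q) (hu : IsStokesFlow R δ μ u p) :
    IsStokesFlow R δ μ (fun x => w x - u x) (fun x => q x - p x) where
  contDiffOn_velocity := hw.contDiffOn_velocity.sub hu.contDiffOn_velocity
  contDiffOn_velocity_closure := hw.contDiffOn_velocity_closure.sub hu.contDiffOn_velocity_closure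
  contDiffOn_pressure := hw.contDiffOn_pressure.sub hu.contDiffOn_pressure
  continuousOn_pressure_closure :=
    hw.continuousOn_pressure_closure.sub hu.continuousOn_pressure_closure
  momentum x hx i := by
    have hd : ∀ {v : Plane → Plane} {r : Plane → ℝ}, IsStokesFlow R δ μ v r →
        ∀ y ∈ exteriorDomain R δ, ContDiffAt ℝ 2 (fun y => v y i) y := fun hv y hy =>
      contDiffAt_coord (hv.contDiffAt hy) i
    have h2 : ∀ j : Fin 2, pd j (pd j fun y => (w y - u y) i) x
        = pd j (pd j fun y => w y i) x - pd j (pd j fun y => u y i) x := by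
      intro j
      rw [← pd_sub ((contDiffAt_pd_one (hd hw x hx)).differentiableAt (by norm_num))
        ((contDiffAt_pd_one (hd hu x hx)).differentiableAt (by norm_num))]
      refine pd_congr ?_
      filter_upwards [isOpen_exteriorDomain.mem_nhds hx] with y hy
      exact pd_sub ((hd hw y hy).differentiableAt (by norm_num))
        ((hd hu y hy).differentiableAt (by norm_num))
    rw [h2, h2, pd_sub ((hw.contDiffAt_pressure hx).differentiableAt (by norm_num))
      ((hu.contDiffAt_pressure hx).differentiableAt (by norm_num)), ← hw.momentum x hx,
      ← hu.momentum x hx]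
    ring
  incompressible x hx := by
    have hd : ∀ {v : Plane → Plane} {r : Plane → ℝ}, IsStokesFlow R δ μ v r →
        ∀ i, DifferentiableAt ℝ (fun y => v y i) x := fun hv i =>
      (contDiffAt_coord (hv.contDiffAt hx) i).differentiableAt (by norm_num)
    have h : ∀ j : Fin 2, pd j (fun y => (w y - u y) j) x
        = pd j (fun y => w y j) x - pd j (fun y => u y j) x := fun j =>
      pd_sub (hd hw j) (hd hu j)
    rw [h, h]
    linear_combination hw.incompressible x hx - hu.incompressible x hx

lemma IsStokesFlow.stress_sub (hw : IsStokesFlow R δ μ w q) (hu : IsStokesFlow R δ μ u p)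
    (hR : 0 < R) (hδ : 0 < δ) (hx : x ∈ closure (exteriorDomain R δ)) :
    stress (closure (exteriorDomain R δ)) μ (fun x => w x - u x) (fun x => q x - p x) x
      = stress (closure (exteriorDomain R δ)) μ w q x
        - stress (closure (exteriorDomain R δ)) μ u p x := by
  have hd := fderivWithin_fun_sub (uniqueDiffOn_closure hR hδ x hx)
    (hw.contDiffOn_velocity_closure.differentiableOn (by norm_num) x hx)
    (hu.contDiffOn_velocity_closure.differentiableOn (by norm_num) x hx)
  ext i j
  rw [Matrix.sub_apply, stress_apply, stress_apply, stress_apply, hd]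
  simp only [_root_.sub_apply, PiLp.sub_apply]
  ring

lemma continuous_rigidMotion (j : Fin 3) : Continuous (rigidMotion j) := by
  fin_cases j <;> simp only [rigidMotion] <;> simp <;> fun_prop

lemma IsStokesFlow.boundaryForce_integrand_continuous (h : IsStokesFlow R δ μ w q) (hR : 0 < R)
    (hδ : 0 < δ) (i : Fin 2) (j : Fin 3) :
    Continuous fun t => ((rigidMotion j (center R δ i + R • unitVec t)).ofLp ⬝ᵥ
      (stress (closure (exteriorDomain R δ)) μ w q (center R δ i + R • unitVec t)).mulVec
        (unitVec t).ofLp) * R := by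
  have hs : ∀ k l, Continuous fun t => stress (closure (exteriorDomain R δ)) μ w q
      (center R δ i + R • unitVec t) k l := fun k l =>
    continuous_circle_comp hR hδ (h.continuousOn_stress hR hδ k l) i
  have hu := continuous_unitVec
  have hr' : ∀ k, Continuous fun t => rigidMotion j (center R δ i + R • unitVec t) k := fun k =>
    (EuclideanSpace.proj (𝕜 := ℝ) k).continuous.comp ((continuous_rigidMotion j).comp
      (by fun_prop))
  have hu' : ∀ k, Continuous fun t => unitVec t k := fun k =>
    (EuclideanSpace.proj (𝕜 := ℝ) k).continuous.comp hu
  simp only [dotProduct, Matrix.mulVec, Fin.sum_univ_two]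
  exact (((hr' 0).mul (((hs 0 0).mul (hu' 0)).add ((hs 0 1).mul (hu' 1)))).add
    ((hr' 1).mul (((hs 1 0).mul (hu' 0)).add ((hs 1 1).mul (hu' 1))))).mul continuous_const

/-- The boundary force is additive in the test vector. -/
lemma IsStokesFlow.boundaryForce_sum (h : IsStokesFlow R δ μ w q) (hR : 0 < R) (hδ : 0 < δ)
    (i : Fin 2) {c : Fin 3 → ℝ}
    (hz : ∀ x ∈ Metric.sphere (center R δ i) R, z x = ∑ j, c j • rigidMotion j x) :
    boundaryForce R δ μ w q i z = ∑ j, c j * boundaryForce R δ μ w q i (rigidMotion j) := by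
  unfold boundaryForce
  simp only [← intervalIntegral.integral_const_mul]
  rw [← intervalIntegral.integral_finsetSum]
  · refine intervalIntegral.integral_congr fun t _ => ?_
    simp only [hz _ (circle_mem_sphere hR i t), WithLp.ofLp_sum, WithLp.ofLp_smul,
      sum_dotProduct, smul_dotProduct, smul_eq_mul, Finset.sum_mul, mul_assoc]
  · intro j _
    exact Continuous.intervalIntegrable
      (continuous_const.mul (h.boundaryForce_integrand_continuous hR hδ i j)) _ _

lemma IsStokesFlow.boundaryForce_sub (hw : IsStokesFlow R δ μ w q) (hu : IsStokesFlow R δ μ u p)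
    (hR : 0 < R) (hδ : 0 < δ) (i : Fin 2) (j : Fin 3) :
    boundaryForce R δ μ (fun x => w x - u x) (fun x => q x - p x) i (rigidMotion j)
      = boundaryForce R δ μ w q i (rigidMotion j) - boundaryForce R δ μ u p i (rigidMotion j) := by
  unfold boundaryForce
  rw [← intervalIntegral.integral_sub
    ((hw.boundaryForce_integrand_continuous hR hδ i j).intervalIntegrable _ _)
    ((hu.boundaryForce_integrand_continuous hR hδ i j).intervalIntegrable _ _)]
  refine intervalIntegral.integral_congr fun t _ => ?_
  simp only [hw.stress_sub hu hR hδ (circle_mem_closure hR hδ i le_rfl (by linarith) t),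
    Matrix.sub_mulVec, dotProduct_sub, sub_mul]

/-- A decaying Stokes flow which differs on the boundary of the disks from a rigid motion by a
multiple of the shear flow, and which exerts no net force and no net torque on the disks. -/
structure IsPerturbation (R δ μ s : ℝ) (c : Fin 2 → Fin 3 → ℝ) (w : Plane → Plane)
    (q : Plane → ℝ) : Prop extends IsStokesFlow R δ μ w q where
  boundary : ∀ i : Fin 2, ∀ x ∈ Metric.sphere (center R δ i) R,
    w x = ∑ j : Fin 3, c i j • rigidMotion j x - s • shearFlow x
  decay : DecaysAtInfinity w q
  equilibrium : ∀ (i : Fin 2) (j : Fin 3), boundaryForce R δ μ w q i (rigidMotion j) = 0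

/-- The shear flow as a continuous linear map. -/
def shearCLM : Plane →L[ℝ] Plane :=
  LinearMap.toContinuousLinearMap
    { toFun := shearFlow
      map_add' := fun x y => by ext i; fin_cases i <;> simp [shearFlow]
      map_smul' := fun a x => by ext i; fin_cases i <;> simp [shearFlow] }

lemma hasFDerivAt_shearFlow (x : Plane) : HasFDerivAt shearFlow shearCLM x :=
  shearCLM.hasFDerivAt

lemma contDiff_shearFlow {n : WithTop ℕ∞} : ContDiff ℝ n shearFlow := shearCLM.contDiff

lemma pd_shearFlow (i j : Fin 2) (x : Plane) :
    pd j (fun y => shearFlow y i) x = shearFlow (EuclideanSpace.single j 1) i := by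
  rw [pd, fderiv_component (hasFDerivAt_shearFlow x).differentiableAt,
    (hasFDerivAt_shearFlow x).fderiv]
  rfl

lemma isStokesFlow_shearFlow : IsStokesFlow R δ μ shearFlow fun _ => 0 where
  contDiffOn_velocity := contDiff_shearFlow.contDiffOn
  contDiffOn_velocity_closure := contDiff_shearFlow.contDiffOn
  contDiffOn_pressure := contDiffOn_const
  continuousOn_pressure_closure := continuousOn_const
  momentum x _ i := by
    have : ∀ j : Fin 2, (pd j fun y => shearFlow y i)
        = fun _ => shearFlow (EuclideanSpace.single j 1) i := fun j =>
      funext fun y => pd_shearFlow i j y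
    rw [this, this, pd_const, pd_const, pd_const]
    simp
  incompressible x _ := by
    rw [pd_shearFlow, pd_shearFlow]
    simp [shearFlow]

lemma intervalIntegral_eq_zero_of_hasDerivAt {f G : ℝ → ℝ} (hG : ∀ t, HasDerivAt G (f t) t)
    (hf : Continuous f) (h : G (2 * Real.pi) = G 0) : ∫ t in (0 : ℝ)..(2 * Real.pi), f t = 0 := by
  rw [intervalIntegral.integral_eq_sub_of_hasDerivAt (fun t _ => hG t)
    (hf.intervalIntegrable _ _), h, sub_self]

/-- The stress of the shear flow is constant and symmetric, so its force and torque on a closed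
curve vanish. On the circles the integrands are trigonometric polynomials with explicit periodic
primitives. -/
lemma boundaryForce_shearFlow (hR : 0 < R) (hδ : 0 < δ) (i : Fin 2) (j : Fin 3) :
    boundaryForce R δ μ shearFlow (fun _ => 0) i (rigidMotion j) = 0 := by
  have hs : ∀ t k l, stress (closure (exteriorDomain R δ)) μ shearFlow (fun _ => 0)
      (center R δ i + R • unitVec t) k l = μ * (shearFlow (EuclideanSpace.single l 1) k
        + shearFlow (EuclideanSpace.single k 1) l) := by
    intro t k l
    rw [stress_apply, fderivWithin_eq_fderiv (uniqueDiffOn_closure hR hδ _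
      (circle_mem_closure hR hδ i le_rfl (by linarith) t))
      (hasFDerivAt_shearFlow _).differentiableAt, (hasFDerivAt_shearFlow _).fderiv]
    simp [shearCLM]
  unfold boundaryForce
  simp only [dotProduct, Matrix.mulVec, Fin.sum_univ_two, hs]
  have hb : center R δ i 1 = 0 := by
    rcases Fin.exists_fin_two.1 ⟨i, rfl⟩ with rfl | rfl <;> simp [center]
  have hj : j = 0 ∨ j = 1 ∨ j = 2 := by fin_cases j <;> simp
  rcases hj with rfl | rfl | rfl
  · refine intervalIntegral_eq_zero_of_hasDerivAt (G := fun t => -(2 * μ * R) * Real.cos t)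
      (fun t => ((Real.hasDerivAt_cos t).const_mul (-(2 * μ * R))).congr_deriv ?_) ?_ (by simp)
    · simp [rigidMotion, shearFlow, unitVec]; ring
    · simp [rigidMotion, shearFlow, unitVec]; fun_prop
  · refine intervalIntegral_eq_zero_of_hasDerivAt (G := fun t => (2 * μ * R) * Real.sin t)
      (fun t => ((Real.hasDerivAt_sin t).const_mul (2 * μ * R)).congr_deriv ?_) ?_ (by simp)
    · simp [rigidMotion, shearFlow, unitVec]; ring
    · simp [rigidMotion, shearFlow, unitVec]; fun_prop
  · refine intervalIntegral_eq_zero_of_hasDerivAt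
      (G := fun t => -(2 * μ * R) * (R * (Real.sin t * Real.cos t) + center R δ i 0 * Real.sin t))
      (fun t => (((((Real.hasDerivAt_sin t).fun_mul (Real.hasDerivAt_cos t)).const_mul R).fun_add
        ((Real.hasDerivAt_sin t).const_mul (center R δ i 0))).const_mul
          (-(2 * μ * R))).congr_deriv ?_) ?_ (by simp)
    · simp [rigidMotion, shearFlow, unitVec, hb]; ring
    · simp [rigidMotion, shearFlow, unitVec, hb]; fun_prop

lemma IsEquilibriumFlow.isPerturbation (hR : 0 < R) (hδ : 0 < δ)
    (h : IsEquilibriumFlow R δ μ shearFlow c u p) :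
    IsPerturbation R δ μ 1 c (fun x => u x - shearFlow x) p := by
  have hp : (fun x => p x - 0) = p := by simp
  have hs := h.isStokesFlow.sub (isStokesFlow_shearFlow (R := R) (δ := δ) (μ := μ))
  have hf := h.isStokesFlow.boundaryForce_sub
    (isStokesFlow_shearFlow (R := R) (δ := δ) (μ := μ)) hR hδ
  rw [hp] at hs hf
  refine ⟨hs, fun i x hx => ?_, h.decay, fun i j => ?_⟩
  · simp only [h.boundary i x hx, one_smul]
  · rw [hf, h.equilibrium, boundaryForce_shearFlow hR hδ, sub_zero]

lemma center_rev (i : Fin 2) : center R δ i.rev = -center R δ i := by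
  have h : -(R + δ / 2) = -R - δ / 2 := by ring
  rcases Fin.exists_fin_two.1 ⟨i, rfl⟩ with rfl | rfl <;> ext k <;>
    rcases Fin.exists_fin_two.1 ⟨k, rfl⟩ with rfl | rfl <;> simp [center] <;> linarith

lemma neg_mem_exteriorDomain (hR : 0 < R) : -x ∈ exteriorDomain R δ ↔ x ∈ exteriorDomain R δ := by
  have key : ∀ y : Plane, y ∈ exteriorDomain R δ → -y ∈ exteriorDomain R δ := by
    intro y hy
    rw [mem_exteriorDomain hR] at hy ⊢
    intro i
    have := hy i.rev
    rwa [center_rev, ← dist_neg_neg, neg_neg] at this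
  exact ⟨fun h => by simpa using key _ h, key x⟩

lemma neg_preimage_closure (hR : 0 < R) (hδ : 0 < δ) :
    (ContinuousLinearEquiv.neg ℝ : Plane ≃L[ℝ] Plane) ⁻¹' closure (exteriorDomain R δ)
      = closure (exteriorDomain R δ) := by
  ext x
  simp only [mem_preimage, ContinuousLinearEquiv.neg_apply]
  have key : ∀ y : Plane, y ∈ closure (exteriorDomain R δ) →
      -y ∈ closure (exteriorDomain R δ) := by
    intro y hy
    rw [mem_closure_exteriorDomain hR hδ] at hy ⊢
    intro i
    have := hy i.rev
    rwa [center_rev, ← dist_neg_neg, neg_neg] at this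
  exact ⟨fun h => by simpa using key _ h, key x⟩

lemma pd_comp_neg (f : Plane → ℝ) (j : Fin 2) (x : Plane) :
    pd j (fun y => f (-y)) x = -pd j f (-x) := by
  have h := (ContinuousLinearEquiv.neg ℝ : Plane ≃L[ℝ] Plane).comp_right_fderiv (f := f) (x := x)
  have h2 := congrArg (fun L : Plane →L[ℝ] ℝ => L (EuclideanSpace.single j 1)) h
  refine h2.trans ?_
  simp [pd]

/-- The reflection of a Stokes flow through the origin. -/
lemma IsStokesFlow.reflect (h : IsStokesFlow R δ μ w q) (hR : 0 < R) (hδ : 0 < δ) :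
    IsStokesFlow R δ μ (fun x => -w (-x)) (fun x => q (-x)) where
  contDiffOn_velocity := (h.contDiffOn_velocity.comp contDiff_neg.contDiffOn
    fun x hx => (neg_mem_exteriorDomain hR).2 hx).neg
  contDiffOn_velocity_closure := (h.contDiffOn_velocity_closure.comp contDiff_neg.contDiffOn
    fun x hx => (Set.ext_iff.1 (neg_preimage_closure hR hδ) x).2 hx).neg
  contDiffOn_pressure := h.contDiffOn_pressure.comp contDiff_neg.contDiffOn
    fun x hx => (neg_mem_exteriorDomain hR).2 hx
  continuousOn_pressure_closure := h.continuousOn_pressure_closure.comp continuous_neg.continuousOn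
    fun x hx => (Set.ext_iff.1 (neg_preimage_closure hR hδ) x).2 hx
  momentum x hx i := by
    have h1 : ∀ j : Fin 2, (pd j fun y => (-w (-y)) i) = fun y => pd j (fun y => w y i) (-y) := by
      intro j
      funext y
      refine (pd_comp_neg (fun y => -w y i) j y).trans ?_
      rw [pd_neg, neg_neg]
    rw [h1, h1, pd_comp_neg, pd_comp_neg, pd_comp_neg, ← h.momentum (-x)
      ((neg_mem_exteriorDomain hR).2 hx)]
    ring
  incompressible x hx := by
    have h1 : ∀ i j : Fin 2, pd j (fun y => (-w (-y)) i) x = pd j (fun y => w y i) (-x) := by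
      intro i j
      refine (pd_comp_neg (fun y => -w y i) j x).trans ?_
      rw [pd_neg, neg_neg]
    rw [h1, h1]
    exact h.incompressible _ ((neg_mem_exteriorDomain hR).2 hx)

/-- The sign in front of `w` and the sign from the chain rule cancel, so the gradient, hence the
stress, is just transported to `-x`. -/
lemma stress_reflect (hR : 0 < R) (hδ : 0 < δ) (hx : x ∈ closure (exteriorDomain R δ)) :
    stress (closure (exteriorDomain R δ)) μ (fun x => -w (-x)) (fun x => q (-x)) x
      = stress (closure (exteriorDomain R δ)) μ w q (-x) := by
  have hu := uniqueDiffOn_closure hR hδ x hx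
  have h := (ContinuousLinearEquiv.neg ℝ : Plane ≃L[ℝ] Plane).comp_right_fderivWithin
    (f := fun y => -w y) (s := closure (exteriorDomain R δ)) (x := x)
    (by rw [neg_preimage_closure hR hδ]; exact hu)
  rw [neg_preimage_closure hR hδ] at h
  have h2 : ∀ v, fderivWithin ℝ (fun x => -w (-x)) (closure (exteriorDomain R δ)) x v
      = fderivWithin ℝ w (closure (exteriorDomain R δ)) (-x) v := by
    intro v
    refine (congrArg (fun L : Plane →L[ℝ] Plane => L v) h).trans ?_
    have hn : -x ∈ closure (exteriorDomain R δ) :=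
      (Set.ext_iff.1 (neg_preimage_closure hR hδ) x).2 hx
    simp [fderivWithin_fun_neg (uniqueDiffOn_closure hR hδ _ hn)]
  ext i j
  rw [stress_apply, stress_apply, h2, h2]

lemma rigidMotion_neg (j : Fin 3) :
    ∃ s : ℝ, ∀ x : Plane, rigidMotion j (-x) = s • rigidMotion j x := by
  fin_cases j
  · exact ⟨1, fun x => by simp [rigidMotion]⟩
  · exact ⟨1, fun x => by simp [rigidMotion]⟩
  · exact ⟨-1, fun x => by ext k; fin_cases k <;> simp [rigidMotion]⟩

lemma boundaryForce_reflect_eq_zero (hR : 0 < R) (hδ : 0 < δ)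
    (h : ∀ (i : Fin 2) (j : Fin 3), boundaryForce R δ μ w q i (rigidMotion j) = 0)
    (i : Fin 2) (j : Fin 3) :
    boundaryForce R δ μ (fun x => -w (-x)) (fun x => q (-x)) i (rigidMotion j) = 0 := by
  obtain ⟨s, hs⟩ := rigidMotion_neg j
  set g : ℝ → ℝ := fun t => ((rigidMotion j (center R δ i.rev + R • unitVec t)).ofLp ⬝ᵥ
      (stress (closure (exteriorDomain R δ)) μ w q (center R δ i.rev + R • unitVec t)).mulVec
        (unitVec t).ofLp) * R with hg
  have hper : Function.Periodic g (2 * Real.pi) := by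
    intro t
    simp only [hg, unitVec_periodic t]
  have hzero : ∫ t in (0 : ℝ)..(2 * Real.pi), g t = 0 := h i.rev j
  have hpi : ∀ t, unitVec (t + Real.pi) = -unitVec t := by
    intro t
    ext k
    fin_cases k <;> simp [unitVec]
  -- Reflection carries the circle of disk `i` to that of `i.rev` and shifts the angle by `π`, which
  -- does not affect an integral over a full period.
  have hshift : ∫ t in (0 : ℝ)..(2 * Real.pi), g (t + Real.pi) = 0 := by
    rw [intervalIntegral.integral_comp_add_right, zero_add, add_comm (2 * Real.pi) Real.pi,
      hper.intervalIntegral_add_eq Real.pi 0, zero_add, hzero]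
  unfold boundaryForce
  have hshift' : ∫ t in (0 : ℝ)..(2 * Real.pi), -s * g (t + Real.pi) = 0 := by
    rw [intervalIntegral.integral_const_mul, hshift, mul_zero]
  refine (intervalIntegral.integral_congr fun t _ => ?_).trans hshift'
  have hx : center R δ i.rev + R • unitVec (t + Real.pi) = -(center R δ i + R • unitVec t) := by
    rw [center_rev, hpi, smul_neg, neg_add]
  simp only [hg, hx]
  rw [stress_reflect hR hδ (circle_mem_closure hR hδ i le_rfl (by linarith) t), hs, hpi,
    WithLp.ofLp_smul, WithLp.ofLp_neg, Matrix.mulVec_neg, smul_dotProduct, dotProduct_neg]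
  -- The value of the sign `s` is not recorded, but reflecting twice forces `s² = 1` wherever the
  -- rigid motion does not vanish.
  have hss : s * s = 1 ∨ rigidMotion j (center R δ i + R • unitVec t) = 0 := by
    by_cases h0 : rigidMotion j (center R δ i + R • unitVec t) = 0
    · exact Or.inr h0
    · left
      have h1 := hs (-(center R δ i + R • unitVec t))
      rw [neg_neg, hs, smul_smul] at h1
      have h2 : (1 - s * s) • rigidMotion j (center R δ i + R • unitVec t) = 0 := by
        rw [sub_smul, one_smul, ← h1, sub_self]
      rcases smul_eq_zero.1 h2 with h3 | h3
      · linarith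
      · exact absurd h3 h0
  rcases hss with h1 | h1
  · simp only [smul_eq_mul]
    linear_combination (-((rigidMotion j (center R δ i + R • unitVec t)).ofLp ⬝ᵥ
      (stress (closure (exteriorDomain R δ)) μ w q (-(center R δ i + R • unitVec t))).mulVec
        (unitVec t).ofLp) * R) * h1
  · simp [h1]

lemma tendsto_neg_cobounded :
    Tendsto (fun x : Plane => -x) (Bornology.cobounded Plane) (Bornology.cobounded Plane) := by
  rw [← tendsto_norm_atTop_iff_cobounded]
  simpa using tendsto_norm_cobounded_atTop

/-- The sum of a perturbation of the shear flow and its reflection has rigid boundary values. -/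
lemma IsPerturbation.symmetrize (hR : 0 < R) (hδ : 0 < δ) {s : ℝ}
    (h : IsPerturbation R δ μ s c w q) :
    IsPerturbation R δ μ 0
      (fun i => ![c i 0 + c i.rev 0, c i 1 + c i.rev 1, c i 2 - c i.rev 2])
      (fun x => w x - -w (-x)) (fun x => q x - q (-x)) := by
  have href := h.toIsStokesFlow.reflect hR hδ
  refine ⟨h.toIsStokesFlow.sub href, fun i x hx => ?_, ⟨?_, ?_, ?_⟩, fun i j => ?_⟩
  -- Translations are even, while the rotation and the shear are odd. Hence translations add,
  -- angular velocities subtract, and the shear cancels.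
  · have hx' : -x ∈ Metric.sphere (center R δ i.rev) R := by
      rw [Metric.mem_sphere] at hx ⊢
      rw [center_rev, dist_neg_neg, hx]
    rw [h.boundary i x hx, h.boundary i.rev (-x) hx']
    ext k
    fin_cases k <;> simp [Fin.sum_univ_three, rigidMotion, shearFlow] <;> ring
  · refine h.decay.velocity.sub ?_
    have := (h.decay.velocity.comp_tendsto tendsto_neg_cobounded).neg_left
    simpa [Function.comp_def] using this
  · have hd := h.decay.gradient.comp_tendsto tendsto_neg_cobounded
    simp only [Function.comp_def, norm_neg] at hd
    have h3 := h.decay.gradient.norm_left.add hd.norm_left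
    refine Asymptotics.IsBigO.trans (Asymptotics.IsBigO.of_bound 1 ?_) h3
    filter_upwards [eventually_mem_exteriorDomain hR hδ] with x hx
    have hr : HasFDerivAt (fun y => -w (-y)) (fderiv ℝ w (-x)) x := by
      have h4 := (h.differentiableAt ((neg_mem_exteriorDomain hR).2 hx)).hasFDerivAt.comp x
        (hasFDerivAt_id (𝕜 := ℝ) x).fun_neg
      refine h4.fun_neg.congr_fderiv ?_
      ext1 v
      simp
    rw [((h.differentiableAt hx).hasFDerivAt.fun_sub hr).fderiv, one_mul]
    exact (norm_sub_le _ _).trans (le_abs_self _)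
  · refine h.decay.pressure.sub ?_
    have := h.decay.pressure.comp_tendsto tendsto_neg_cobounded
    simpa [Function.comp_def] using this
  · rw [h.toIsStokesFlow.boundaryForce_sub href hR hδ, h.equilibrium,
      boundaryForce_reflect_eq_zero hR hδ h.equilibrium, sub_zero]

end Perturbation

/-! ### The reciprocal theorem. -/

section Reciprocity

variable {R δ μ : ℝ} {v w z : Plane → Plane} {q r : Plane → ℝ} {x : Plane}
  {b c : Fin 2 → Fin 3 → ℝ}

lemma divergence_neg {F : Plane → Plane} : divergence (fun y => -F y) x = -divergence F x := by
  simp only [divergence, fderiv_fun_neg, _root_.neg_apply, PiLp.neg_apply]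
  ring

lemma divergence_add {F G : Plane → Plane} (hF : DifferentiableAt ℝ F x)
    (hG : DifferentiableAt ℝ G x) :
    divergence (fun y => F y + G y) x = divergence F x + divergence G x := by
  simp only [divergence, fderiv_fun_add hF hG, _root_.add_apply, PiLp.add_apply]
  ring

lemma circleFlux_neg (c : Plane) (F : Plane → Plane) (ρ : ℝ) :
    circleFlux c (fun x => -F x) ρ = -circleFlux c F ρ := by
  unfold circleFlux
  rw [← intervalIntegral.integral_neg]
  refine intervalIntegral.integral_congr fun t _ => ?_
  simp only [PiLp.neg_apply]
  ring

lemma continuous_circleFlux_integrand (hR : 0 < R) (hδ : 0 < δ) {F : Plane → Plane}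
    (hF : ContinuousOn F (closure (exteriorDomain R δ))) (i : Fin 2) :
    Continuous fun t => (F (center R δ i + R • unitVec t) 0 * Real.cos t
      + F (center R δ i + R • unitVec t) 1 * Real.sin t) * R := by
  have h : ∀ k : Fin 2, Continuous fun t => F (center R δ i + R • unitVec t) k := fun k =>
    (EuclideanSpace.proj (𝕜 := ℝ) k).continuous.comp (continuous_circle_comp hR hδ hF i)
  exact (((h 0).mul Real.continuous_cos).add ((h 1).mul Real.continuous_sin)).mul
    continuous_const

lemma circleFlux_add (hR : 0 < R) (hδ : 0 < δ) {F G : Plane → Plane}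
    (hF : ContinuousOn F (closure (exteriorDomain R δ)))
    (hG : ContinuousOn G (closure (exteriorDomain R δ))) (i : Fin 2) :
    circleFlux (center R δ i) (fun x => F x + G x) R
      = circleFlux (center R δ i) F R + circleFlux (center R δ i) G R := by
  unfold circleFlux
  rw [← intervalIntegral.integral_add
    ((continuous_circleFlux_integrand hR hδ hF i).intervalIntegrable _ _)
    ((continuous_circleFlux_integrand hR hδ hG i).intervalIntegrable _ _)]
  refine intervalIntegral.integral_congr fun t _ => ?_
  simp only [PiLp.add_apply]
  ring

/-- Total flux of a divergence-free field. -/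
lemma sum_circleFlux_eq_zero (hR : 0 < R) (hδ : 0 < δ) {F : Plane → Plane}
    (hF : ContDiffOn ℝ 1 F (exteriorDomain R δ))
    (hFc : ContinuousOn F (closure (exteriorDomain R δ)))
    (hFinf : F =O[Bornology.cobounded Plane] fun x => (‖x‖ ^ 2)⁻¹)
    (hdiv : ∀ x ∈ exteriorDomain R δ, divergence F x = 0) :
    ∑ i, circleFlux (center R δ i) F R = 0 := by
  have h1 := setIntegral_le_neg_sum_circleFlux hR hδ hF hFc hFinf (k := fun _ => 0)
    integrableOn_zero fun x hx => (hdiv x hx).ge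
  -- The divergence theorem is one-sided, so it is applied to both `F` and `-F`.
  have h2 := setIntegral_le_neg_sum_circleFlux hR hδ hF.neg hFc.fun_neg hFinf.neg_left
    (k := fun _ => 0) integrableOn_zero fun x hx => ?_
  · simp only [integral_zero, circleFlux_neg, Finset.sum_neg_distrib, neg_neg] at h1 h2
    linarith
  · rw [divergence_neg, hdiv x hx, neg_zero]

/-- The reciprocal theorem. -/
lemma sum_boundaryForce_eq_zero (hR : 0 < R) (hδ : 0 < δ) (hμ : 0 < μ) {s : ℝ}
    (hw : IsPerturbation R δ μ s c w q) (hv : IsStokesFlow R δ μ v r)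
    (hvb : ∀ i : Fin 2, ∀ x ∈ Metric.sphere (center R δ i) R,
      v x = ∑ j : Fin 3, b i j • rigidMotion j x)
    (hv0 : v =O[Bornology.cobounded Plane] fun _ => (1 : ℝ))
    (hv1 : (fun x => fderiv ℝ v x) =O[Bornology.cobounded Plane] fun x => ‖x‖⁻¹)
    (hr : r =O[Bornology.cobounded Plane] fun x => ‖x‖⁻¹) :
    ∑ i, boundaryForce R δ μ v r i w = 0 := by
  have hw1 : ContDiffOn ℝ 1 w (exteriorDomain R δ) := hw.contDiffOn_velocity.of_le (by norm_num)
  have hv1' : ContDiffOn ℝ 1 v (exteriorDomain R δ) := hv.contDiffOn_velocity.of_le (by norm_num)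
  have hwK := hw.contDiffOn_velocity_closure.continuousOn
  have hvK := hv.contDiffOn_velocity_closure.continuousOn
  have c1 := hv.continuousOn_stressField hR hδ hwK
  have c2 := (hw.toIsStokesFlow.continuousOn_stressField hR hδ hvK).fun_neg
  have d1 := hv.contDiffOn_stressField hw1
  have d2 := (hw.toIsStokesFlow.contDiffOn_stressField hv1').neg
  have o1 : stressField (closure (exteriorDomain R δ)) μ v r w
      =O[Bornology.cobounded Plane] fun x => (‖x‖ ^ 2)⁻¹ := by
    refine (stressField_isBigO hR hδ hμ hv1 hr hw.decay.velocity).congr_right fun x => ?_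
    rw [← mul_inv, sq]
  have o2 : stressField (closure (exteriorDomain R δ)) μ w q v
      =O[Bornology.cobounded Plane] fun x => (‖x‖ ^ 2)⁻¹ := by
    simpa using stressField_isBigO hR hδ hμ hw.decay.gradient hw.decay.pressure hv0
  -- The field `σ[v, r] w - σ[w, q] v` is divergence-free because both terms have divergence `2 μ
  -- e(v) : e(w)`. The second has no flux: `v` is rigid on the circles and `w` is in equilibrium.
  have key := sum_circleFlux_eq_zero hR hδ (d1.add d2) (c1.fun_add c2)
    (o1.add o2.neg_left) fun x hx => ?_
  · simp only [circleFlux_add hR hδ c1 c2, circleFlux_neg, Finset.sum_add_distrib,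
      circleFlux_stressField, Finset.sum_neg_distrib] at key
    have hz : ∑ i, boundaryForce R δ μ w q i v = 0 := by
      refine Finset.sum_eq_zero fun i _ => ?_
      rw [hw.toIsStokesFlow.boundaryForce_sum hR hδ i (hvb i)]
      exact Finset.sum_eq_zero fun j _ => by rw [hw.equilibrium, mul_zero]
    linarith
  · have hnhds := isOpen_exteriorDomain.mem_nhds hx
    have e1 := (d1.contDiffAt hnhds).differentiableAt (by norm_num)
    have e2 := (d2.contDiffAt hnhds).differentiableAt (by norm_num)
    rw [divergence_add e1 e2, divergence_neg, hv.divergence_stressField hw1 hx (hw.incompressible x hx),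
      hw.toIsStokesFlow.divergence_stressField hv1' hx (hv.incompressible x hx)]
    ring

end Reciprocity

/-! ### Stokes flows generated by harmonic functions. -/

section HarmonicFlow

variable {R δ μ : ℝ} {H f : Plane → ℝ} {x : Plane}

/-- The velocity field with stream function `x H`. -/
def harmonicVelocity (H : Plane → ℝ) (x : Plane) : Plane :=
  !₂[x 0 * pd 1 H x, -H x - x 0 * pd 0 H x]

lemma contDiff_coord {n : WithTop ℕ∞} (i : Fin 2) : ContDiff ℝ n fun x : Plane => x i :=
  (EuclideanSpace.proj (𝕜 := ℝ) i).contDiff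

lemma pd_coord (i j : Fin 2) (x : Plane) :
    pd j (fun y => y i) x = (EuclideanSpace.single j (1 : ℝ) : Plane) i :=
  HasFDerivAt.pd_eq (EuclideanSpace.proj (𝕜 := ℝ) i).hasFDerivAt j

lemma pd_coord_mul (hf : DifferentiableAt ℝ f x) (j : Fin 2) :
    pd j (fun y => y 0 * f y) x
      = (EuclideanSpace.single j (1 : ℝ) : Plane) 0 * f x + x 0 * pd j f x := by
  rw [pd_mul ((contDiff_coord (n := 1) 0).differentiable (by norm_num) x) hf, pd_coord]

lemma pd_pd_coord_mul (hf : ContDiffAt ℝ 2 f x) (j : Fin 2) :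
    pd j (pd j fun y => y 0 * f y) x
      = 2 * (EuclideanSpace.single j (1 : ℝ) : Plane) 0 * pd j f x + x 0 * pd j (pd j f) x := by
  have hd := hf.differentiableAt (by norm_num)
  have hd1 := (contDiffAt_pd_one (j := j) hf).differentiableAt (by norm_num)
  have h : (pd j fun y => y 0 * f y) =ᶠ[𝓝 x] fun y =>
      (EuclideanSpace.single j (1 : ℝ) : Plane) 0 * f y + y 0 * pd j f y := by
    filter_upwards [hf.eventually (by norm_num)] with y hy
    exact pd_coord_mul (hy.differentiableAt (by norm_num)) j
  have hm : DifferentiableAt ℝ (fun y : Plane => y 0 * pd j f y) x :=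
    ((contDiff_coord (n := 1) 0).differentiable (by norm_num) x).fun_mul hd1
  rw [pd_congr h, pd_add (hd.const_mul _) hm, pd_const_mul _ hd, pd_coord_mul hd1]
  ring

lemma contDiffAt_pd_two (hH : ContDiffAt ℝ 3 H x) (j : Fin 2) : ContDiffAt ℝ 2 (pd j H) x :=
  contDiffAt_pd (n := 2) (by norm_num; exact hH)

lemma contDiffAt_harmonicVelocity (hH : ContDiffAt ℝ 3 H x) :
    ContDiffAt ℝ 2 (harmonicVelocity H) x := by
  have h0 := contDiffAt_pd_two hH 0
  have h1 := contDiffAt_pd_two hH 1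
  have hH2 : ContDiffAt ℝ 2 H x := hH.of_le (by norm_num)
  have hx : ContDiffAt ℝ 2 (fun x : Plane => x 0) x := (contDiff_coord 0).contDiffAt
  refine contDiffAt_euclidean.2 fun i => ?_
  rcases Fin.exists_fin_two.1 ⟨i, rfl⟩ with rfl | rfl
  · exact hx.mul h1
  · exact hH2.neg.sub (hx.mul h0)

lemma pd_harmonicVelocity_zero (hH : ContDiffAt ℝ 3 H x) (j : Fin 2) :
    pd j (fun y => harmonicVelocity H y 0) x
      = (EuclideanSpace.single j (1 : ℝ) : Plane) 0 * pd 1 H x + x 0 * pd j (pd 1 H) x :=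
  pd_coord_mul ((contDiffAt_pd_two hH 1).differentiableAt (by norm_num)) j

lemma pd_harmonicVelocity_one (hH : ContDiffAt ℝ 3 H x) (j : Fin 2) :
    pd j (fun y => harmonicVelocity H y 1) x
      = -pd j H x - ((EuclideanSpace.single j (1 : ℝ) : Plane) 0 * pd 0 H x
        + x 0 * pd j (pd 0 H) x) := by
  have hd := (contDiffAt_pd_two hH 0).differentiableAt (by norm_num)
  have hm : DifferentiableAt ℝ (fun y : Plane => y 0 * pd 0 H y) x :=
    ((contDiff_coord (n := 1) 0).differentiable (by norm_num) x).fun_mul hd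
  rw [← pd_coord_mul hd, ← pd_neg, ← pd_sub (hH.differentiableAt (by norm_num)).fun_neg hm]
  rfl

/-- A harmonic function generates a Stokes flow. -/
lemma isStokesFlow_harmonicVelocity
    (hH : ∀ x ∈ closure (exteriorDomain R δ), ContDiffAt ℝ 3 H x)
    (hharm : ∀ x ∈ closure (exteriorDomain R δ), pd 1 (pd 1 H) =ᶠ[𝓝 x] fun y => -pd 0 (pd 0 H) y) :
    IsStokesFlow R δ μ (harmonicVelocity H) (fun x => 2 * μ * pd 1 H x) where
  contDiffOn_velocity x hx := (contDiffAt_harmonicVelocity (hH x (subset_closure hx))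
    ).contDiffWithinAt
  contDiffOn_velocity_closure x hx := ((contDiffAt_harmonicVelocity (hH x hx)).of_le
    (by norm_num)).contDiffWithinAt
  contDiffOn_pressure x hx := (contDiffAt_const.mul ((contDiffAt_pd_two (hH x (subset_closure hx))
    1).of_le (by norm_num))).contDiffWithinAt
  continuousOn_pressure_closure x hx :=
    (continuousAt_const.mul (contDiffAt_pd_two (hH x hx) 1).continuousAt).continuousWithinAt
  momentum x hx := by
    have hx' := subset_closure hx
    have h3 := hH x hx'
    have h2 : ContDiffAt ℝ 2 H x := h3.of_le (by norm_num)
    have hp0 := contDiffAt_pd_two h3 0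
    have hp1 := contDiffAt_pd_two h3 1
    -- Harmonicity is assumed on a neighbourhood of each point so that it can be differentiated
    -- here.
    have hlap : ∀ j, pd j (pd 1 (pd 1 H)) x = -pd j (pd 0 (pd 0 H)) x := by
      intro j
      rw [pd_congr (hharm x hx'), pd_neg]
    have hcomm : ∀ i j k, pd i (pd j (pd k H)) x = pd i (pd k (pd j H)) x := by
      intro i j k
      refine pd_congr ?_
      filter_upwards [h2.eventually (by norm_num)] with y hy
      exact pd_comm hy j k
    have hswap : ∀ i j k, pd i (pd j (pd k H)) x = pd j (pd i (pd k H)) x := fun i j k =>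
      pd_comm (contDiffAt_pd_two h3 k) i j
    rw [Fin.forall_fin_two]
    constructor
    · have e : ∀ j, pd j (pd j fun y => harmonicVelocity H y 0) x = _ := fun j =>
        pd_pd_coord_mul hp1 j
      rw [e, e, pd_const_mul _ (hp1.differentiableAt (by norm_num))]
      have k1 : pd 0 (pd 0 (pd 1 H)) x = -pd 1 (pd 1 (pd 1 H)) x := by
        rw [hlap 1, neg_neg, hcomm, hswap]
      simp [k1]
      ring
    · have e : ∀ j, pd j (pd j fun y => harmonicVelocity H y 1) x
          = -pd j (pd j H) x - (2 * (EuclideanSpace.single j (1 : ℝ) : Plane) 0 * pd j (pd 0 H) x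
            + x 0 * pd j (pd j (pd 0 H)) x) := by
        intro j
        have hm : ContDiffAt ℝ 2 (fun y : Plane => y 0 * pd 0 H y) x :=
          (contDiff_coord 0).contDiffAt.mul hp0
        have hd := ((contDiffAt_pd_one (j := j) h2).differentiableAt (by norm_num)).fun_neg
        have hd' := (contDiffAt_pd_one (j := j) hm).differentiableAt (by norm_num)
        rw [← pd_pd_coord_mul hp0 j, ← pd_neg, ← pd_sub hd hd']
        refine pd_congr ?_
        filter_upwards [h2.eventually (by norm_num), hm.eventually (by norm_num)] with y hy hy'
        rw [← pd_neg, ← pd_sub (hy.differentiableAt (by norm_num)).fun_neg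
          (hy'.differentiableAt (by norm_num))]
        rfl
      have k1 : pd 1 (pd 1 (pd 0 H)) x = -pd 0 (pd 0 (pd 0 H)) x := by
        rw [← hlap 0, hcomm, hswap]
      rw [e, e, pd_const_mul _ (hp1.differentiableAt (by norm_num)), (hharm x hx').self_of_nhds, k1]
      simp
      ring
  incompressible x hx := by
    have h3 := hH x (subset_closure hx)
    rw [pd_harmonicVelocity_zero h3, pd_harmonicVelocity_one h3,
      pd_comm (h3.of_le (by norm_num)) 1 0]
    simp

/-- Harmonicity eliminates `∂₁∂₁H`, so the tractions below require only `∂₀∂₀H` and `∂₀∂₁H` among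
the second derivatives. -/
lemma stress_harmonicVelocity (hR : 0 < R) (hδ : 0 < δ)
    (hx : x ∈ closure (exteriorDomain R δ)) (hH : ContDiffAt ℝ 3 H x)
    (hharm : pd 1 (pd 1 H) x = -pd 0 (pd 0 H) x) :
    stress (closure (exteriorDomain R δ)) μ (harmonicVelocity H) (fun x => 2 * μ * pd 1 H x) x
      = !![2 * μ * (x 0 * pd 0 (pd 1 H) x), -(2 * μ * (pd 0 H x + x 0 * pd 0 (pd 0 H) x));
          -(2 * μ * (pd 0 H x + x 0 * pd 0 (pd 0 H) x)),
          -(2 * μ * (2 * pd 1 H x + x 0 * pd 0 (pd 1 H) x))] := by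
  have hd := (contDiffAt_harmonicVelocity hH).differentiableAt (by norm_num)
  have hs := pd_comm (hH.of_le (by norm_num)) 1 0
  have e : ∀ i j : Fin 2, fderivWithin ℝ (harmonicVelocity H) (closure (exteriorDomain R δ)) x
      (EuclideanSpace.single j 1) i = pd j (fun y => harmonicVelocity H y i) x := by
    intro i j
    rw [fderivWithin_eq_fderiv (uniqueDiffOn_closure hR hδ x hx) hd, pd, fderiv_component hd]
  ext i j
  rw [stress_apply, e, e]
  rcases Fin.exists_fin_two.1 ⟨i, rfl⟩ with rfl | rfl <;>
    rcases Fin.exists_fin_two.1 ⟨j, rfl⟩ with rfl | rfl <;>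
    simp only [pd_harmonicVelocity_zero hH, pd_harmonicVelocity_one hH, hharm, hs] <;> simp <;> ring

end HarmonicFlow

/-! ### The bipolar coordinate and its values on the boundary circles. -/

section Bipolar

variable {R δ μ a s : ℝ} {f g : Plane → ℝ} {x : Plane} {j : Fin 2}

lemma pd_div (hf : DifferentiableAt ℝ f x) (hg : DifferentiableAt ℝ g x) (h : g x ≠ 0) :
    pd j (fun y => f y / g y) x = (pd j f x * g x - f x * pd j g x) / g x ^ 2 := by
  have hgi : HasFDerivAt (fun y => (g y)⁻¹) (-(g x ^ 2)⁻¹ • fderiv ℝ g x) x :=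
    (hasDerivAt_inv h).comp_hasFDerivAt x hg.hasFDerivAt
  simp only [div_eq_mul_inv]
  rw [pd_mul hf hgi.differentiableAt, HasFDerivAt.pd_eq hgi]
  simp only [_root_.smul_apply, smul_eq_mul, pd]
  field_simp
  ring

lemma pd_log (hf : DifferentiableAt ℝ f x) (h : f x ≠ 0) :
    pd j (fun y => Real.log (f y)) x = pd j f x / f x := by
  rw [HasFDerivAt.pd_eq (hf.hasFDerivAt.log h)]
  simp only [_root_.smul_apply, smul_eq_mul, pd]
  field_simp

/-- The squared distance to the point `(s, 0)`. -/
def sqDist (s : ℝ) (x : Plane) : ℝ := (x 0 - s) ^ 2 + x 1 ^ 2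

/-- The logarithm of the distance to the point `(s, 0)`. -/
def logDist (s : ℝ) (x : Plane) : ℝ := 1 / 2 * Real.log (sqDist s x)

lemma contDiff_sqDist {n : WithTop ℕ∞} : ContDiff ℝ n (sqDist s) :=
  (((contDiff_coord 0).sub contDiff_const).pow 2).add ((contDiff_coord 1).pow 2)

lemma differentiableAt_coord (i : Fin 2) : DifferentiableAt ℝ (fun y : Plane => y i) x :=
  (contDiff_coord (n := 1) i).differentiable (by norm_num) x

lemma differentiableAt_sqDist : DifferentiableAt ℝ (sqDist s) x :=
  (contDiff_sqDist (n := 1)).differentiable (by norm_num) x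

lemma pd_coord_sub (j : Fin 2) :
    pd j (fun y => y 0 - s) x = (EuclideanSpace.single j (1 : ℝ) : Plane) 0 := by
  rw [pd_sub (differentiableAt_coord 0) (differentiableAt_const _), pd_coord, pd_const, sub_zero]

lemma pd_sqDist : pd j (sqDist s) x = 2 * (x 0 - s) * (EuclideanSpace.single j (1 : ℝ) : Plane) 0
    + 2 * x 1 * (EuclideanSpace.single j (1 : ℝ) : Plane) 1 := by
  have h0 : DifferentiableAt ℝ (fun y : Plane => y 0 - s) x :=
    (differentiableAt_coord 0).sub_const s
  have h1 : DifferentiableAt ℝ (fun y : Plane => y 1) x := differentiableAt_coord 1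
  have e : sqDist s = fun y => (y 0 - s) * (y 0 - s) + y 1 * y 1 := by
    funext y
    simp only [sqDist]
    ring
  rw [e, pd_add (h0.fun_mul h0) (h1.fun_mul h1), pd_mul h0 h0, pd_mul h1 h1, pd_coord_sub,
    pd_coord]
  ring

lemma eventually_sqDist_ne_zero (h : sqDist s x ≠ 0) : ∀ᶠ y in 𝓝 x, sqDist s y ≠ 0 :=
  (contDiff_sqDist (n := 0)).continuous.continuousAt.eventually_ne h

lemma contDiffAt_logDist {n : WithTop ℕ∞} (h : sqDist s x ≠ 0) : ContDiffAt ℝ n (logDist s) x :=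
  contDiffAt_const.mul (contDiff_sqDist.contDiffAt.log h)

lemma pd_logDist (h : sqDist s x ≠ 0) : pd j (logDist s) x
    = ((x 0 - s) * (EuclideanSpace.single j (1 : ℝ) : Plane) 0
      + x 1 * (EuclideanSpace.single j (1 : ℝ) : Plane) 1) / sqDist s x := by
  have hl : DifferentiableAt ℝ (fun y => Real.log (sqDist s y)) x :=
    differentiableAt_sqDist.log h
  unfold logDist
  rw [pd_const_mul _ hl, pd_log differentiableAt_sqDist h, pd_sqDist]
  ring

lemma pd_zero_logDist (h : sqDist s x ≠ 0) : pd 0 (logDist s) x = (x 0 - s) / sqDist s x := by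
  simp [pd_logDist h]

lemma pd_one_logDist (h : sqDist s x ≠ 0) : pd 1 (logDist s) x = x 1 / sqDist s x := by
  simp [pd_logDist h]

lemma pd_zero_zero_logDist (h : sqDist s x ≠ 0) :
    pd 0 (pd 0 (logDist s)) x = 1 / sqDist s x - 2 * (x 0 - s) ^ 2 / sqDist s x ^ 2 := by
  have e : pd 0 (logDist s) =ᶠ[𝓝 x] fun y => (y 0 - s) / sqDist s y :=
    (eventually_sqDist_ne_zero h).mono fun y hy => pd_zero_logDist hy
  rw [pd_congr e, pd_div ((differentiableAt_coord 0).sub_const s) differentiableAt_sqDist h,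
    pd_coord_sub, pd_sqDist]
  simp
  field_simp

lemma pd_one_one_logDist (h : sqDist s x ≠ 0) :
    pd 1 (pd 1 (logDist s)) x = -pd 0 (pd 0 (logDist s)) x := by
  have e : pd 1 (logDist s) =ᶠ[𝓝 x] fun y => y 1 / sqDist s y :=
    (eventually_sqDist_ne_zero h).mono fun y hy => pd_one_logDist hy
  rw [pd_congr e, pd_div (differentiableAt_coord 1) differentiableAt_sqDist h,
    pd_zero_zero_logDist h, pd_coord, pd_sqDist]
  simp
  field_simp
  simp only [sqDist]
  ring

lemma pd_zero_one_logDist (h : sqDist s x ≠ 0) :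
    pd 0 (pd 1 (logDist s)) x = -(2 * (x 0 - s) * x 1) / sqDist s x ^ 2 := by
  have e : pd 1 (logDist s) =ᶠ[𝓝 x] fun y => y 1 / sqDist s y :=
    (eventually_sqDist_ne_zero h).mono fun y hy => pd_one_logDist hy
  rw [pd_congr e, pd_div (differentiableAt_coord 1) differentiableAt_sqDist h, pd_coord, pd_sqDist]
  simp
  field_simp

/-- The bipolar coordinate with foci `(±a, 0)`. -/
def bipolar (a : ℝ) (x : Plane) : ℝ := logDist (-a) x - logDist a x

lemma contDiffAt_bipolar {n : WithTop ℕ∞} (h1 : sqDist (-a) x ≠ 0) (h2 : sqDist a x ≠ 0) :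
    ContDiffAt ℝ n (bipolar a) x := (contDiffAt_logDist h1).sub (contDiffAt_logDist h2)

lemma pd_bipolar (h1 : sqDist (-a) x ≠ 0) (h2 : sqDist a x ≠ 0) (j : Fin 2) :
    pd j (bipolar a) x = pd j (logDist (-a)) x - pd j (logDist a) x :=
  pd_sub ((contDiffAt_logDist (n := 1) h1).differentiableAt (by norm_num))
    ((contDiffAt_logDist (n := 1) h2).differentiableAt (by norm_num))

lemma pd_pd_bipolar (h1 : sqDist (-a) x ≠ 0) (h2 : sqDist a x ≠ 0) (i j : Fin 2) :
    pd i (pd j (bipolar a)) x = pd i (pd j (logDist (-a))) x - pd i (pd j (logDist a)) x := by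
  have hd : ∀ {s}, sqDist s x ≠ 0 → DifferentiableAt ℝ (pd j (logDist s)) x := fun h =>
    (contDiffAt_pd_one (contDiffAt_logDist h)).differentiableAt (by norm_num)
  rw [← pd_sub (hd h1) (hd h2)]
  refine pd_congr ?_
  filter_upwards [eventually_sqDist_ne_zero h1, eventually_sqDist_ne_zero h2] with y hy1 hy2
  exact pd_bipolar hy1 hy2 j

lemma pd_one_one_bipolar (h1 : sqDist (-a) x ≠ 0) (h2 : sqDist a x ≠ 0) :
    pd 1 (pd 1 (bipolar a)) x = -pd 0 (pd 0 (bipolar a)) x := by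
  rw [pd_pd_bipolar h1 h2, pd_pd_bipolar h1 h2, pd_one_one_logDist h1, pd_one_one_logDist h2]
  ring

lemma dist_sq_eq (x y : Plane) : dist x y ^ 2 = (x 0 - y 0) ^ 2 + (x 1 - y 1) ^ 2 := by
  rw [EuclideanSpace.dist_eq, Real.sq_sqrt (by positivity), Fin.sum_univ_two, Real.dist_eq,
    Real.dist_eq, sq_abs, sq_abs]

lemma norm_sq_eq (x : Plane) : ‖x‖ ^ 2 = x 0 ^ 2 + x 1 ^ 2 := by
  simpa using dist_sq_eq x 0

/-- The common data of the circle `(x - D)² + y² = R²` and the foci `(±a, 0)`. -/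
structure IsFocalCircle (R a D : ℝ) (x : Plane) : Prop where
  radius_pos : 0 < R
  sq_eq : D ^ 2 = R ^ 2 + a ^ 2
  mem : (x 0 - D) ^ 2 + x 1 ^ 2 = R ^ 2
  foci_ne : a ≠ 0

namespace IsFocalCircle

variable {D : ℝ} (h : IsFocalCircle R a D x)
include h

lemma sub_ne : D - a ≠ 0 := by
  intro h0
  have h1 := h.radius_pos
  have h2 := h.sq_eq
  rw [show D = a by linarith] at h2
  nlinarith

lemma add_ne : D + a ≠ 0 := by
  intro h0
  have h1 := h.radius_pos
  have h2 := h.sq_eq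
  rw [show D = -a by linarith] at h2
  nlinarith

lemma coord_ne : x 0 ≠ 0 := by
  intro h0
  have h1 := h.sq_eq
  have h2 := h.mem
  rw [h0] at h2
  have h3 : 0 < a ^ 2 := by have := h.foci_ne; positivity
  nlinarith [sq_nonneg (x 1)]

/-- Since `D² = R² + a²`, the circle equation becomes `x² + y² + a² = 2 D x`. Both squared focal
distances are therefore multiples of `x`, with constant ratio: the circle is an Apollonius circle of
the foci. -/
lemma sqDist_pos : sqDist a x = 2 * x 0 * (D - a) := by
  have h1 := h.sq_eq
  have h2 := h.mem
  simp only [sqDist]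
  linear_combination h2 - h1

lemma sqDist_neg : sqDist (-a) x = 2 * x 0 * (D + a) := by
  have h1 := h.sq_eq
  have h2 := h.mem
  simp only [sqDist]
  linear_combination h2 - h1

lemma sqDist_pos_ne : sqDist a x ≠ 0 := by
  rw [h.sqDist_pos]
  exact mul_ne_zero (mul_ne_zero two_ne_zero h.coord_ne) h.sub_ne

lemma sqDist_neg_ne : sqDist (-a) x ≠ 0 := by
  rw [h.sqDist_neg]
  exact mul_ne_zero (mul_ne_zero two_ne_zero h.coord_ne) h.add_ne

lemma bipolar_eq : bipolar a x = 1 / 2 * (Real.log (D + a) - Real.log (D - a)) := by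
  have hx := mul_ne_zero two_ne_zero h.coord_ne
  simp only [bipolar, logDist]
  -- On the left circle `x` and `D ± a` are negative. Since `Real.log` takes absolute values,
  -- nonvanishing of the factors is enough and one formula serves both circles.
  rw [h.sqDist_pos, h.sqDist_neg, Real.log_mul hx h.add_ne, Real.log_mul hx h.sub_ne]
  ring

lemma pd_zero : pd 0 (bipolar a) x = a * (D - x 0) / (x 0 * R ^ 2) := by
  rw [pd_bipolar h.sqDist_neg_ne h.sqDist_pos_ne, pd_zero_logDist h.sqDist_neg_ne,
    pd_zero_logDist h.sqDist_pos_ne, h.sqDist_pos, h.sqDist_neg,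
    show R ^ 2 = (D - a) * (D + a) by linarith [h.sq_eq]]
  have h1 := h.coord_ne
  have h2 := h.sub_ne
  have h3 := h.add_ne
  field_simp
  ring

lemma pd_one : pd 1 (bipolar a) x = -(a * x 1) / (x 0 * R ^ 2) := by
  rw [pd_bipolar h.sqDist_neg_ne h.sqDist_pos_ne, pd_one_logDist h.sqDist_neg_ne,
    pd_one_logDist h.sqDist_pos_ne, h.sqDist_pos, h.sqDist_neg,
    show R ^ 2 = (D - a) * (D + a) by linarith [h.sq_eq]]
  have h1 := h.coord_ne
  have h2 := h.sub_ne
  have h3 := h.add_ne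
  field_simp
  ring

/-- On the circle the flow generated by the bipolar coordinate is a rigid motion. -/
lemma harmonicVelocity_eq : harmonicVelocity (bipolar a) x
    = !₂[-a / R ^ 2 * x 1, -(1 / 2 * (Real.log (D + a) - Real.log (D - a))) - a * D / R ^ 2
      - -a / R ^ 2 * x 0] := by
  have h1 := h.coord_ne
  have h2 := h.radius_pos.ne'
  ext i
  rcases Fin.exists_fin_two.1 ⟨i, rfl⟩ with rfl | rfl
  · simp only [harmonicVelocity, h.pd_one, PiLp.toLp_apply, Matrix.cons_val_zero]
    field_simp
  · simp only [harmonicVelocity, h.pd_zero, h.bipolar_eq, PiLp.toLp_apply, Matrix.cons_val_one]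
    field_simp
    ring_nf

/-- Horizontal traction up to the factor `2 μ`, taken against the unnormalised normal `(x - D, y)`,
which has length `R`. -/
lemma traction_zero :
    x 0 * pd 0 (pd 1 (bipolar a)) x * (x 0 - D)
      - (pd 0 (bipolar a) x + x 0 * pd 0 (pd 0 (bipolar a)) x) * x 1 = a * x 1 / R ^ 2 := by
  rw [h.pd_zero, pd_pd_bipolar h.sqDist_neg_ne h.sqDist_pos_ne,
    pd_pd_bipolar h.sqDist_neg_ne h.sqDist_pos_ne, pd_zero_one_logDist h.sqDist_neg_ne,
    pd_zero_one_logDist h.sqDist_pos_ne, pd_zero_zero_logDist h.sqDist_neg_ne,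
    pd_zero_zero_logDist h.sqDist_pos_ne, h.sqDist_pos, h.sqDist_neg,
    show R ^ 2 = (D - a) * (D + a) by linarith [h.sq_eq]]
  have h1 := h.coord_ne
  have h2 := h.sub_ne
  have h3 := h.add_ne
  field_simp
  ring

/-- Vertical counterpart of `traction_zero`. The term `a / x` is the only one that is not
polynomial, and it produces the angular integral that determines the relative velocity. -/
lemma traction_one :
    -(pd 0 (bipolar a) x + x 0 * pd 0 (pd 0 (bipolar a)) x) * (x 0 - D)
      - (2 * pd 1 (bipolar a) x + x 0 * pd 0 (pd 1 (bipolar a)) x) * x 1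
      = a / x 0 - a * (x 0 - D) / R ^ 2 := by
  have hR : R ^ 2 = (D - a) * (D + a) := by linarith [h.sq_eq]
  have hy : x 1 ^ 2 = (D - a) * (D + a) - (x 0 - D) ^ 2 := by linarith [h.mem]
  rw [h.pd_zero, h.pd_one, pd_pd_bipolar h.sqDist_neg_ne h.sqDist_pos_ne,
    pd_pd_bipolar h.sqDist_neg_ne h.sqDist_pos_ne, pd_zero_one_logDist h.sqDist_neg_ne,
    pd_zero_one_logDist h.sqDist_pos_ne, pd_zero_zero_logDist h.sqDist_neg_ne,
    pd_zero_zero_logDist h.sqDist_pos_ne, h.sqDist_pos, h.sqDist_neg, hR]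
  have h1 := h.coord_ne
  have h2 := h.sub_ne
  have h3 := h.add_ne
  field_simp
  rw [hy]
  ring

end IsFocalCircle

end Bipolar

/-! ### The integral of `1 / (D + R cos t)`. -/

section AngularIntegral

/-- The arctangent is the argument of `1 + k e^{it}`. For `|k| < 1` this number stays in the right
half-plane, so the primitive of the Poisson kernel is smooth over the whole period, unlike one
obtained from `tan (t / 2)`. -/
lemma hasDerivAt_poissonPrimitive {k : ℝ} (hk : |k| < 1) (t : ℝ) :
    HasDerivAt (fun t => t - 2 * Real.arctan (k * Real.sin t / (1 + k * Real.cos t)))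
      ((1 - k ^ 2) / (1 + 2 * k * Real.cos t + k ^ 2)) t := by
  have habs : |k * Real.cos t| < 1 := by
    rw [abs_mul]
    exact (mul_le_of_le_one_right (abs_nonneg _) (Real.abs_cos_le_one t)).trans_lt hk
  have hpos : 0 < 1 + k * Real.cos t := by linarith [(abs_lt.1 habs).1]
  have h1 : HasDerivAt (fun t => k * Real.sin t / (1 + k * Real.cos t))
      ((k * Real.cos t * (1 + k * Real.cos t) - k * Real.sin t * (k * -Real.sin t))
        / (1 + k * Real.cos t) ^ 2) t :=
    ((Real.hasDerivAt_sin t).const_mul k).fun_div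
      (((Real.hasDerivAt_cos t).const_mul k).const_add 1) hpos.ne'
  have hcs := Real.sin_sq_add_cos_sq t
  have hden : 1 + 2 * k * Real.cos t + k ^ 2
      = (1 + k * Real.cos t) ^ 2 + (k * Real.sin t) ^ 2 := by
    linear_combination (-k ^ 2) * hcs
  have hden_pos : 0 < (1 + k * Real.cos t) ^ 2 + (k * Real.sin t) ^ 2 := by positivity
  refine ((hasDerivAt_id t).fun_sub (h1.arctan.const_mul 2)).congr_deriv ?_
  rw [hden]
  field_simp
  linear_combination (-k ^ 2) * hcs

lemma integral_inv_add_cos {R D a : ℝ} (hR : 0 < R) (h : D ^ 2 = R ^ 2 + a ^ 2) (ha : a ≠ 0)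
    (hDa : 0 < D * a) :
    ∫ t in (0 : ℝ)..(2 * Real.pi), 1 / (D + R * Real.cos t) = 2 * Real.pi / a := by
  -- This `k` is a root of `R (1 + k²) = 2 D k`, which turns `D + R cos t` into a multiple of the
  -- Poisson denominator. The condition `0 < D * a` makes it the root inside the unit interval.
  set k := (D - a) / R with hk
  have hk1 : |k| < 1 := by
    rw [hk, abs_div, abs_of_pos hR, div_lt_one hR]
    refine abs_lt_of_sq_lt_sq ?_ hR.le
    nlinarith [sq_nonneg a, pow_pos hR 2, sq_abs a, mul_pos hR hR, mul_self_pos.2 ha]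
  have hDR : R < |D| := by
    refine lt_of_pow_lt_pow_left₀ 2 (abs_nonneg D) ?_
    rw [sq_abs, h]
    have : 0 < a ^ 2 := by positivity
    linarith
  have hne : ∀ t, D + R * Real.cos t ≠ 0 := by
    intro t h0
    have h1 : D = -(R * Real.cos t) := by linarith
    rw [h1, abs_neg, abs_mul, abs_of_pos hR] at hDR
    nlinarith [Real.abs_cos_le_one t]
  have hk0 : k ≠ 0 := by
    rw [hk]
    refine div_ne_zero (fun h0 => ?_) hR.ne'
    have : D = a := by linarith
    rw [this] at h
    nlinarith
  have hder : ∀ t, HasDerivAt (fun t => 1 / a * (t - 2 * Real.arctan (k * Real.sin t /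
      (1 + k * Real.cos t)))) (1 / (D + R * Real.cos t)) t := by
    intro t
    refine ((hasDerivAt_poissonPrimitive hk1 t).const_mul (1 / a)).congr_deriv ?_
    have e1 : 1 + 2 * k * Real.cos t + k ^ 2 = 2 * k / R * (D + R * Real.cos t) := by
      rw [hk]
      field_simp
      linear_combination -h
    have e2 : 1 - k ^ 2 = 2 * k / R * a := by
      rw [hk]
      field_simp
      linear_combination -h
    rw [e1, e2]
    have := hne t
    field_simp
  have hcont : Continuous fun t => 1 / (D + R * Real.cos t) :=
    continuous_const.div (by fun_prop) hne
  rw [intervalIntegral.integral_eq_sub_of_hasDerivAt (fun t _ => hder t)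
    (hcont.intervalIntegrable _ _)]
  simp
  ring

end AngularIntegral

/-! ### The bipolar flow as a test flow, and the relative velocity. -/

section BipolarFlow

variable {R δ μ a s : ℝ} {x : Plane} {c : Fin 2 → Fin 3 → ℝ} {w : Plane → Plane} {q : Plane → ℝ}

lemma sqDist_bounds (hs : |s| ≤ a) (hx : 2 * a ≤ ‖x‖) :
    ‖x‖ ^ 2 / 4 ≤ sqDist s x ∧ sqDist s x ≤ 4 * ‖x‖ ^ 2 := by
  have h1 := norm_sq_eq x
  have h2 := abs_apply_le_norm x 0
  have h3 : |s * x 0| ≤ ‖x‖ / 2 * ‖x‖ := by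
    rw [abs_mul]
    exact mul_le_mul (by linarith) h2 (abs_nonneg _) (by positivity)
  have h4 := abs_le.1 h3
  have h5 : s ^ 2 ≤ (‖x‖ / 2) ^ 2 := by
    rw [← sq_abs]
    exact pow_le_pow_left₀ (abs_nonneg _) (by linarith) 2
  have h6 : sqDist s x = ‖x‖ ^ 2 - 2 * (s * x 0) + s ^ 2 := by
    rw [h1]
    simp only [sqDist]
    ring
  constructor
  · have h7 : 0 ≤ (x 0 - s) ^ 2 := sq_nonneg _
    have h8 : |x 0 * s| ≤ ‖x‖ * a := by
      rw [abs_mul]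
      exact mul_le_mul h2 hs (abs_nonneg _) (norm_nonneg _)
    have h9 : |s * x 0| ≤ ‖x‖ * |s| := by
      rw [abs_mul, mul_comm]
      exact mul_le_mul_of_nonneg_right h2 (abs_nonneg _)
    have h10 := (abs_le.1 h9).2
    have h11 : sqDist s x ≥ (‖x‖ - |s|) ^ 2 := by
      rw [h6, ← sq_abs s]
      nlinarith
    have h12 : (‖x‖ / 2) ^ 2 ≤ (‖x‖ - |s|) ^ 2 :=
      pow_le_pow_left₀ (by positivity) (by linarith) 2
    linarith
  · nlinarith

lemma abs_pd_logDist_le (hs : |s| ≤ a) (hx : 2 * a ≤ ‖x‖) (hx0 : 0 < ‖x‖) (j : Fin 2) :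
    |pd j (logDist s) x| ≤ 8 * ‖x‖⁻¹ := by
  obtain ⟨h1, h2⟩ := sqDist_bounds hs hx
  have h3 : 0 < sqDist s x := lt_of_lt_of_le (by positivity) h1
  have h4 : ∀ y : ℝ, y ^ 2 ≤ sqDist s x → |y / sqDist s x| ≤ 8 * ‖x‖⁻¹ := by
    intro y hy
    have h5 : |y| ≤ 2 * ‖x‖ := by
      refine abs_le_of_sq_le_sq ?_ (by positivity)
      nlinarith
    rw [abs_div, abs_of_pos h3, div_le_iff₀ h3]
    calc |y| ≤ 2 * ‖x‖ := h5
      _ = 8 * ‖x‖⁻¹ * (‖x‖ ^ 2 / 4) := by field_simp; ring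
      _ ≤ _ := by gcongr
  rcases Fin.exists_fin_two.1 ⟨j, rfl⟩ with rfl | rfl
  · rw [pd_zero_logDist h3.ne']
    exact h4 _ (by simp only [sqDist]; nlinarith [sq_nonneg (x 1)])
  · rw [pd_one_logDist h3.ne']
    exact h4 _ (by simp only [sqDist]; nlinarith [sq_nonneg (x 0 - s)])

lemma abs_pd_pd_logDist_le (hs : |s| ≤ a) (hx : 2 * a ≤ ‖x‖) (hx0 : 0 < ‖x‖) (i j : Fin 2) :
    |pd i (pd j (logDist s)) x| ≤ 12 * (‖x‖ ^ 2)⁻¹ := by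
  obtain ⟨h1, h2⟩ := sqDist_bounds hs hx
  have h3 : 0 < sqDist s x := lt_of_lt_of_le (by positivity) h1
  have h4 : ∀ y : ℝ, |y| ≤ 3 * sqDist s x → |y / sqDist s x ^ 2| ≤ 12 * (‖x‖ ^ 2)⁻¹ := by
    intro y hy
    rw [abs_div, abs_of_pos (by positivity : 0 < sqDist s x ^ 2), div_le_iff₀ (by positivity)]
    calc |y| ≤ 3 * sqDist s x := hy
      _ = 12 * (‖x‖ ^ 2)⁻¹ * (‖x‖ ^ 2 / 4) * sqDist s x := by field_simp; ring
      _ ≤ 12 * (‖x‖ ^ 2)⁻¹ * sqDist s x * sqDist s x := by gcongr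
      _ = _ := by ring
  have h00 : |pd 0 (pd 0 (logDist s)) x| ≤ 12 * (‖x‖ ^ 2)⁻¹ := by
    rw [pd_zero_zero_logDist h3.ne']
    have := h4 (sqDist s x - 2 * (x 0 - s) ^ 2) (by
      rw [abs_le]
      simp only [sqDist]
      constructor <;> nlinarith [sq_nonneg (x 0 - s), sq_nonneg (x 1)])
    convert this using 2
    field_simp
  have h01 : |pd 0 (pd 1 (logDist s)) x| ≤ 12 * (‖x‖ ^ 2)⁻¹ := by
    rw [pd_zero_one_logDist h3.ne']
    refine h4 _ ?_
    rw [abs_le]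
    simp only [sqDist]
    constructor <;>
      nlinarith [sq_nonneg (x 0 - s), sq_nonneg (x 1), sq_nonneg (x 0 - s + x 1),
        sq_nonneg (x 0 - s - x 1)]
  rcases Fin.exists_fin_two.1 ⟨i, rfl⟩ with rfl | rfl <;>
    rcases Fin.exists_fin_two.1 ⟨j, rfl⟩ with rfl | rfl
  · exact h00
  · exact h01
  · rw [pd_comm (contDiffAt_logDist h3.ne') 1 0]
    exact h01
  · rw [pd_one_one_logDist h3.ne', abs_neg]
    exact h00

/-- Both squared focal distances lie between `‖x‖² / 4` and `4 ‖x‖²`, so their logarithms differ by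
at most `log 16`. Boundedness is all that reciprocity needs, as `w` supplies the decay. -/
lemma abs_bipolar_le (ha : 0 < a) (hx : 2 * a ≤ ‖x‖) : |bipolar a x| ≤ Real.log 16 := by
  have hx0 : 0 < ‖x‖ := by linarith
  have hlog : ∀ {s}, |s| ≤ a → Real.log (‖x‖ ^ 2 / 4) ≤ Real.log (sqDist s x) ∧
      Real.log (sqDist s x) ≤ Real.log (‖x‖ ^ 2 / 4) + Real.log 16 := by
    intro s hs
    obtain ⟨h1, h2⟩ := sqDist_bounds hs hx
    have h3 : 0 < sqDist s x := lt_of_lt_of_le (by positivity) h1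
    refine ⟨Real.log_le_log (by positivity) h1, ?_⟩
    rw [← Real.log_mul (by positivity) (by norm_num)]
    exact Real.log_le_log h3 (by linarith)
  have h1 := hlog (s := a) (abs_of_pos ha).le
  have h2 := hlog (s := -a) (by rw [abs_neg, abs_of_pos ha])
  have h3 : 0 < Real.log 16 := Real.log_pos (by norm_num)
  simp only [bipolar, logDist]
  rw [abs_le]
  constructor <;> linarith [h1.1, h1.2, h2.1, h2.2]

lemma norm_fderiv_le_sum {F : Plane → Plane} (hF : DifferentiableAt ℝ F x) {B : ℝ}
    (h : ∀ i j : Fin 2, |pd j (fun y => F y i) x| ≤ B) : ‖fderiv ℝ F x‖ ≤ 4 * B := by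
  have hB : 0 ≤ B := (abs_nonneg _).trans (h 0 0)
  refine ContinuousLinearMap.opNorm_le_bound _ (by positivity) fun v => ?_
  have h2 : ∀ v : Plane, ‖v‖ ≤ |v 0| + |v 1| := by
    intro v
    rw [EuclideanSpace.norm_eq]
    refine Real.sqrt_le_iff.2 ⟨by positivity, ?_⟩
    simp only [Fin.sum_univ_two, Real.norm_eq_abs]
    nlinarith [abs_nonneg (v 0), abs_nonneg (v 1)]
  have hi : ∀ i : Fin 2, |fderiv ℝ F x v i| ≤ 2 * B * ‖v‖ := by
    intro i
    rw [← fderiv_component hF, apply_eq_sum]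
    refine (abs_add_le _ _).trans ?_
    rw [abs_mul, abs_mul]
    have k0 := mul_le_mul (abs_apply_le_norm v 0) (h i 0) (abs_nonneg _) (norm_nonneg _)
    have k1 := mul_le_mul (abs_apply_le_norm v 1) (h i 1) (abs_nonneg _) (norm_nonneg _)
    simp only [pd] at k0 k1
    linarith
  linarith [h2 (fderiv ℝ F x v), hi 0, hi 1]

lemma eventually_two_mul_le_norm (ha : 0 < a) :
    ∀ᶠ x in Bornology.cobounded Plane, 2 * a ≤ ‖x‖ ∧ 0 < ‖x‖ ∧ sqDist (-a) x ≠ 0 ∧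
      sqDist a x ≠ 0 := by
  refine (Metric.hasBasis_cobounded_compl_closedBall (0 : Plane)).eventually_iff.2
    ⟨2 * a, trivial, fun x hx => ?_⟩
  have h : 2 * a < ‖x‖ := by simpa using hx
  have h0 : 0 < ‖x‖ := by linarith
  have hpos : 0 < ‖x‖ ^ 2 / 4 := by positivity
  refine ⟨h.le, h0, (hpos.trans_le (sqDist_bounds (a := a) ?_ h.le).1).ne',
    (hpos.trans_le (sqDist_bounds (a := a) ?_ h.le).1).ne'⟩
  · rw [abs_neg, abs_of_pos ha]
  · rw [abs_of_pos ha]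

lemma abs_pd_bipolar_le (ha : 0 < a) (hx : 2 * a ≤ ‖x‖) (hx0 : 0 < ‖x‖)
    (h1 : sqDist (-a) x ≠ 0) (h2 : sqDist a x ≠ 0) (i j : Fin 2) :
    |pd j (bipolar a) x| ≤ 16 * ‖x‖⁻¹ ∧ |x 0 * pd i (pd j (bipolar a)) x| ≤ 24 * ‖x‖⁻¹ := by
  have hs1 : |-a| ≤ a := by rw [abs_neg, abs_of_pos ha]
  have hs2 : |a| ≤ a := by rw [abs_of_pos ha]
  constructor
  · rw [pd_bipolar h1 h2]
    refine (abs_sub _ _).trans ?_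
    linarith [abs_pd_logDist_le hs1 hx hx0 j, abs_pd_logDist_le hs2 hx hx0 j]
  · rw [pd_pd_bipolar h1 h2, abs_mul]
    have h3 : |pd i (pd j (logDist (-a))) x - pd i (pd j (logDist a)) x|
        ≤ 24 * (‖x‖ ^ 2)⁻¹ := by
      refine (abs_sub _ _).trans ?_
      linarith [abs_pd_pd_logDist_le hs1 hx hx0 i j, abs_pd_pd_logDist_le hs2 hx hx0 i j]
    calc _ ≤ ‖x‖ * (24 * (‖x‖ ^ 2)⁻¹) :=
          mul_le_mul (abs_apply_le_norm x 0) h3 (abs_nonneg _) (norm_nonneg _)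
      _ = 24 * ‖x‖⁻¹ := by field_simp

lemma harmonicVelocity_bipolar_isBigO (ha : 0 < a) :
    harmonicVelocity (bipolar a) =O[Bornology.cobounded Plane] fun _ => (1 : ℝ) := by
  refine Asymptotics.IsBigO.of_bound (Real.log 16 + 32) ?_
  filter_upwards [eventually_two_mul_le_norm ha] with x ⟨hx, hx0, h1, h2⟩
  have hb := abs_bipolar_le ha hx
  have hj : ∀ j : Fin 2, |x 0 * pd j (bipolar a) x| ≤ 16 := by
    intro j
    rw [abs_mul]
    calc _ ≤ ‖x‖ * (16 * ‖x‖⁻¹) := mul_le_mul (abs_apply_le_norm x 0)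
          (abs_pd_bipolar_le ha hx hx0 h1 h2 0 j).1 (abs_nonneg _) (norm_nonneg _)
      _ = 16 := by field_simp
  have hlog : 0 < Real.log 16 := Real.log_pos (by norm_num)
  rw [norm_one, mul_one]
  have hsq : ‖harmonicVelocity (bipolar a) x‖ ^ 2 ≤ (Real.log 16 + 32) ^ 2 := by
    rw [norm_sq_eq]
    have e0 : |harmonicVelocity (bipolar a) x 0| ≤ 16 := hj 1
    have e1 : |harmonicVelocity (bipolar a) x 1| ≤ Real.log 16 + 16 := by
      refine (abs_sub _ _).trans ?_
      rw [abs_neg]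
      exact add_le_add hb (hj 0)
    rw [← sq_abs (harmonicVelocity (bipolar a) x 0), ← sq_abs (harmonicVelocity (bipolar a) x 1)]
    nlinarith [abs_nonneg (harmonicVelocity (bipolar a) x 0),
      abs_nonneg (harmonicVelocity (bipolar a) x 1)]
  exact le_of_sq_le_sq hsq (by positivity)

lemma fderiv_harmonicVelocity_bipolar_isBigO (ha : 0 < a) :
    (fun x => fderiv ℝ (harmonicVelocity (bipolar a)) x)
      =O[Bornology.cobounded Plane] fun x => ‖x‖⁻¹ := by
  refine Asymptotics.IsBigO.of_bound (4 * 56) ?_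
  filter_upwards [eventually_two_mul_le_norm ha] with x ⟨hx, hx0, h1, h2⟩
  have hH : ContDiffAt ℝ 3 (bipolar a) x := contDiffAt_bipolar h1 h2
  have hb := abs_pd_bipolar_le ha hx hx0 h1 h2
  have hsingle : ∀ j : Fin 2, |(EuclideanSpace.single j (1 : ℝ) : Plane) 0| ≤ 1 := by
    intro j
    rcases Fin.exists_fin_two.1 ⟨j, rfl⟩ with rfl | rfl <;> simp
  have hpos : 0 < ‖x‖⁻¹ := inv_pos.2 hx0
  have hterm : ∀ j k : Fin 2,
      |(EuclideanSpace.single j (1 : ℝ) : Plane) 0 * pd k (bipolar a) x| ≤ 16 * ‖x‖⁻¹ := by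
    intro j k
    rw [abs_mul]
    exact (mul_le_of_le_one_left (abs_nonneg _) (hsingle j)).trans (hb 0 k).1
  rw [norm_inv, norm_norm, mul_assoc]
  refine norm_fderiv_le_sum ((contDiffAt_harmonicVelocity hH).differentiableAt (by norm_num))
    fun i j => ?_
  rcases Fin.exists_fin_two.1 ⟨i, rfl⟩ with rfl | rfl
  · rw [pd_harmonicVelocity_zero hH]
    refine (abs_add_le _ _).trans ?_
    linarith [hterm j 1, (hb j 1).2]
  · rw [pd_harmonicVelocity_one hH]
    refine (abs_sub _ _).trans ?_
    rw [abs_neg]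
    have := abs_add_le ((EuclideanSpace.single j (1 : ℝ) : Plane) 0 * pd 0 (bipolar a) x)
      (x 0 * pd j (pd 0 (bipolar a)) x)
    linarith [hterm j 0, (hb j 0).2, (hb 0 j).1]

lemma pressure_bipolar_isBigO (ha : 0 < a) :
    (fun x => 2 * μ * pd 1 (bipolar a) x) =O[Bornology.cobounded Plane] fun x => ‖x‖⁻¹ := by
  refine Asymptotics.IsBigO.const_mul_left (Asymptotics.IsBigO.of_bound 16 ?_) _
  filter_upwards [eventually_two_mul_le_norm ha] with x ⟨hx, hx0, h1, h2⟩
  rw [norm_inv, norm_norm, Real.norm_eq_abs]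
  exact (abs_pd_bipolar_le ha hx hx0 h1 h2 0 1).1

/-- Half the distance between the foci. -/
def focus (R δ : ℝ) : ℝ := Real.sqrt (R * δ + δ ^ 2 / 4)

lemma focus_pos (hR : 0 < R) (hδ : 0 < δ) : 0 < focus R δ := Real.sqrt_pos.2 (by positivity)

lemma focus_sq (hR : 0 < R) (hδ : 0 < δ) : focus R δ ^ 2 = R * δ + δ ^ 2 / 4 :=
  Real.sq_sqrt (by positivity)

lemma center_apply_one (i : Fin 2) : center R δ i 1 = 0 := by
  rcases Fin.exists_fin_two.1 ⟨i, rfl⟩ with rfl | rfl <;> simp [center]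

lemma center_zero_apply_zero : center R δ 0 0 = -(R + δ / 2) := by
  simp [center]
  ring

lemma center_one_apply_zero : center R δ 1 0 = R + δ / 2 := by simp [center]

lemma isFocalCircle (hR : 0 < R) (hδ : 0 < δ) {i : Fin 2}
    (hx : x ∈ Metric.sphere (center R δ i) R) :
    IsFocalCircle R (focus R δ) (center R δ i 0) x where
  radius_pos := hR
  sq_eq := by
    rw [focus_sq hR hδ]
    rcases Fin.exists_fin_two.1 ⟨i, rfl⟩ with rfl | rfl
    · rw [center_zero_apply_zero]; ring
    · rw [center_one_apply_zero]; ring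
  mem := by
    have h := dist_sq_eq x (center R δ i)
    rw [Metric.mem_sphere.1 hx, center_apply_one, sub_zero] at h
    exact h.symm
  foci_ne := (focus_pos hR hδ).ne'

/-- Each focus lies strictly inside one of the disks, so the singularities of the bipolar coordinate
stay away from the fluid and its boundary. -/
lemma sqDist_focus_ne_zero (hR : 0 < R) (hδ : 0 < δ)
    (hx : x ∈ closure (exteriorDomain R δ)) :
    sqDist (-focus R δ) x ≠ 0 ∧ sqDist (focus R δ) x ≠ 0 := by
  have ha := focus_pos hR hδ
  have hsq := focus_sq hR hδ
  have hK : ∀ i, R ^ 2 ≤ (x 0 - center R δ i 0) ^ 2 + x 1 ^ 2 := by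
    intro i
    have h1 := pow_le_pow_left₀ hR.le (le_dist_of_mem_closure hR hx i) 2
    rwa [dist_sq_eq, center_apply_one, sub_zero] at h1
  have hz : ∀ {s}, sqDist s x = 0 → x 0 = s ∧ x 1 = 0 := by
    intro s h
    simp only [sqDist] at h
    have h1 : (x 0 - s) ^ 2 = 0 := by nlinarith [sq_nonneg (x 0 - s), sq_nonneg (x 1)]
    have h2 : x 1 ^ 2 = 0 := by nlinarith [sq_nonneg (x 0 - s), sq_nonneg (x 1)]
    exact ⟨by linarith [pow_eq_zero_iff two_ne_zero |>.1 h1], pow_eq_zero_iff two_ne_zero |>.1 h2⟩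
  have hlt : (R + δ / 2 - focus R δ) ^ 2 < R ^ 2 := by
    have : focus R δ < R + δ / 2 := by
      refine lt_of_pow_lt_pow_left₀ 2 (by positivity) ?_
      nlinarith [pow_pos hR 2]
    nlinarith
  constructor <;> intro h0 <;> obtain ⟨e0, e1⟩ := hz h0
  · have := hK 0
    rw [e0, e1, center_zero_apply_zero] at this
    nlinarith
  · have := hK 1
    rw [e0, e1, center_one_apply_zero] at this
    nlinarith

lemma isStokesFlow_bipolar (hR : 0 < R) (hδ : 0 < δ) :
    IsStokesFlow R δ μ (harmonicVelocity (bipolar (focus R δ)))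
      (fun x => 2 * μ * pd 1 (bipolar (focus R δ)) x) := by
  refine isStokesFlow_harmonicVelocity (fun x hx => ?_) fun x hx => ?_
  · obtain ⟨h1, h2⟩ := sqDist_focus_ne_zero hR hδ hx
    exact contDiffAt_bipolar h1 h2
  · obtain ⟨h1, h2⟩ := sqDist_focus_ne_zero hR hδ hx
    filter_upwards [eventually_sqDist_ne_zero h1, eventually_sqDist_ne_zero h2] with y k1 k2
    exact pd_one_one_bipolar k1 k2

/-- The force exerted by the bipolar flow, tested with the boundary values of the perturbation. -/
lemma boundaryForce_bipolar (hR : 0 < R) (hδ : 0 < δ) (hw : IsPerturbation R δ μ 1 c w q)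
    (i : Fin 2) :
    boundaryForce R δ μ (harmonicVelocity (bipolar (focus R δ)))
      (fun x => 2 * μ * pd 1 (bipolar (focus R δ)) x) i w
      = 2 * μ * focus R δ * (c i 1 * (∫ t in (0 : ℝ)..(2 * Real.pi),
        1 / (center R δ i 0 + R * Real.cos t)) - 2 * Real.pi) := by
  set a := focus R δ with ha
  set D := center R δ i 0 with hD
  have hfc : ∀ t, IsFocalCircle R a D (center R δ i + R • unitVec t) := fun t =>
    isFocalCircle hR hδ (circle_mem_sphere hR i t)
  have hx0 : ∀ t, (center R δ i + R • unitVec t) 0 = D + R * Real.cos t := by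
    intro t
    simp [unitVec, hD]
  have hx1 : ∀ t, (center R δ i + R • unitVec t) 1 = R * Real.sin t := by
    intro t
    simp [unitVec, center_apply_one]
  have hne : ∀ t, D + R * Real.cos t ≠ 0 := fun t => by
    rw [← hx0]
    exact (hfc t).coord_ne
  have hint : IntervalIntegrable (fun t => 1 / (D + R * Real.cos t)) volume 0 (2 * Real.pi) :=
    (continuous_const.div (by fun_prop) hne : Continuous fun t => 1 / (D + R * Real.cos t)
      ).intervalIntegrable _ _
  -- This is the part of the integrand with zero mean. It contains all dependence on `c i 0` and `c
  -- i 2`, which is why only the vertical velocity survives.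
  have hzero : ∫ t in (0 : ℝ)..(2 * Real.pi), (2 * Real.cos t ^ 2 - 1
      + (c i 0 * Real.sin t - c i 1 * Real.cos t + (c i 2 + 1) * D * Real.cos t) / R) = 0 := by
    refine intervalIntegral_eq_zero_of_hasDerivAt
      (G := fun t => Real.sin t * Real.cos t + (c i 0 * -Real.cos t - c i 1 * Real.sin t
        + (c i 2 + 1) * D * Real.sin t) / R) (fun t => ?_) (by fun_prop) (by simp)
    have hs := Real.hasDerivAt_sin t
    have hc := Real.hasDerivAt_cos t
    refine ((hs.fun_mul hc).fun_add ((((hc.fun_neg.const_mul (c i 0)).fun_sub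
      (hs.const_mul (c i 1))).fun_add (hs.const_mul ((c i 2 + 1) * D))).div_const R)).congr_deriv ?_
    rw [neg_neg]
    linear_combination -Real.sin_sq_add_cos_sq t
  have hcongr : boundaryForce R δ μ (harmonicVelocity (bipolar a))
      (fun x => 2 * μ * pd 1 (bipolar a) x) i w
      = ∫ t in (0 : ℝ)..(2 * Real.pi), (2 * μ * a * (c i 1 * (1 / (D + R * Real.cos t)) - 1
        + (2 * Real.cos t ^ 2 - 1
        + (c i 0 * Real.sin t - c i 1 * Real.cos t + (c i 2 + 1) * D * Real.cos t) / R))) := by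
    unfold boundaryForce
    refine intervalIntegral.integral_congr fun t _ => ?_
    have hxK := circle_mem_closure hR hδ i le_rfl (by linarith : R < R + δ) t
    obtain ⟨s1, s2⟩ := sqDist_focus_ne_zero hR hδ hxK
    have t0 := (hfc t).traction_zero
    have t1 := (hfc t).traction_one
    have hst : ∀ k l, stress (closure (exteriorDomain R δ)) μ (harmonicVelocity (bipolar a))
        (fun x => 2 * μ * pd 1 (bipolar a) x) (center R δ i + R • unitVec t) k l = _ := fun k l =>
      congrFun (congrFun (stress_harmonicVelocity (μ := μ) hR hδ hxK (contDiffAt_bipolar s1 s2)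
        (pd_one_one_bipolar s1 s2)) k) l
    simp only [dotProduct, Matrix.mulVec, Fin.sum_univ_two, hst,
      hw.boundary i _ (circle_mem_sphere hR i t), Fin.sum_univ_three]
    have y0 := hx0 t
    have y1 := hx1 t
    generalize center R δ i + R • unitVec t = X at *
    simp [rigidMotion, shearFlow, unitVec]
    rw [y0] at t0 t1 ⊢
    rw [y1] at t0 t1 ⊢
    generalize pd 0 (bipolar a) X = A at *
    generalize pd 1 (bipolar a) X = B at *
    generalize pd 0 (pd 0 (bipolar a)) X = M at *
    generalize pd 0 (pd 1 (bipolar a)) X = N at *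
    have hinv : (D + R * Real.cos t) * (D + R * Real.cos t)⁻¹ = 1 := mul_inv_cancel₀ (hne t)
    have hRR : R * R⁻¹ = 1 := mul_inv_cancel₀ hR.ne'
    rw [add_sub_cancel_left, div_eq_mul_inv _ (R ^ 2), sq, mul_inv] at t0 t1
    have hcs := Real.sin_sq_add_cos_sq t
    -- The coefficients of `t0` and `t1` are `2 μ` times the two components of `w` on the circle;
    -- the other terms cancel `R` and `x` against their inverses and use `sin² + cos² = 1`.
    linear_combination 2 * μ * (c i 0 + (c i 2 - 1) * (R * Real.sin t)) * t0
      + 2 * μ * (c i 1 - (c i 2 + 1) * (D + R * Real.cos t)) * t1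
      + 2 * μ * a * ((c i 0 + (c i 2 - 1) * (R * Real.sin t)) * Real.sin t * R⁻¹
        - (c i 1 - (c i 2 + 1) * (D + R * Real.cos t)) * Real.cos t * R⁻¹) * hRR
      + 2 * μ * a * ((c i 2 - 1) * Real.sin t ^ 2 + (c i 2 + 1) * Real.cos t ^ 2) * hRR
      - 2 * μ * a * (c i 2 + 1) * hinv + 2 * μ * a * (c i 2 - 1) * hcs
  rw [hcongr, intervalIntegral.integral_const_mul, intervalIntegral.integral_add
    ((hint.const_mul _).sub (by simp)) (Continuous.intervalIntegrable (by fun_prop) _ _), hzero,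
    intervalIntegral.integral_sub (hint.const_mul _) (by simp),
    intervalIntegral.integral_const_mul]
  simp

/-- The boundary values of the bipolar flow are rigid motions. -/
lemma exists_rigid_bipolar (hR : 0 < R) (hδ : 0 < δ) :
    ∃ b : Fin 2 → Fin 3 → ℝ, ∀ i : Fin 2, ∀ x ∈ Metric.sphere (center R δ i) R,
      harmonicVelocity (bipolar (focus R δ)) x = ∑ j : Fin 3, b i j • rigidMotion j x := by
  refine ⟨fun i => ![0, -(1 / 2 * (Real.log (center R δ i 0 + focus R δ)
    - Real.log (center R δ i 0 - focus R δ))) - focus R δ * center R δ i 0 / R ^ 2,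
    -focus R δ / R ^ 2], fun i x hx => ?_⟩
  rw [(isFocalCircle hR hδ hx).harmonicVelocity_eq, Fin.sum_univ_three]
  ext k
  rcases Fin.exists_fin_two.1 ⟨k, rfl⟩ with rfl | rfl <;> simp [rigidMotion]
  ring

/-- The relative velocity of the disks orthogonal to the line of centers. -/
lemma IsPerturbation.relative_velocity (hR : 0 < R) (hδ : 0 < δ) (hμ : 0 < μ)
    (hw : IsPerturbation R δ μ 1 c w q) : c 1 1 - c 0 1 = 2 * focus R δ := by
  have ha := focus_pos hR hδ
  obtain ⟨b, hb⟩ := exists_rigid_bipolar hR hδ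
  have key := sum_boundaryForce_eq_zero hR hδ hμ hw (isStokesFlow_bipolar hR hδ) hb
    (harmonicVelocity_bipolar_isBigO ha) (fderiv_harmonicVelocity_bipolar_isBigO ha)
    (pressure_bipolar_isBigO ha)
  have hsq := focus_sq hR hδ
  have i1 := integral_inv_add_cos (D := R + δ / 2) (a := focus R δ) hR (by rw [hsq]; ring) ha.ne'
    (by positivity)
  -- The left circle has a negative centre, so the focus is taken with a negative sign too. The
  -- integral changes sign, and the difference of the vertical velocities appears.
  have i0 := integral_inv_add_cos (D := -(R + δ / 2)) (a := -focus R δ) hR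
    (by rw [neg_sq (focus R δ), hsq]; ring) (neg_ne_zero.2 ha.ne')
    (by rw [neg_mul_neg]; positivity)
  rw [Fin.sum_univ_two, boundaryForce_bipolar hR hδ hw, boundaryForce_bipolar hR hδ hw,
    center_zero_apply_zero, center_one_apply_zero, i0, i1, ← mul_add] at key
  have hne : 2 * μ * focus R δ ≠ 0 := by positivity
  have h := (mul_eq_zero.1 key).resolve_left hne
  have hpi := Real.pi_pos
  field_simp at h
  rw [mul_zero] at h
  have := (mul_eq_zero.1 h).resolve_left (by positivity)
  linarith

end BipolarFlow

/-! ### The energy inequality. -/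

section Energy

variable {R δ μ s : ℝ} {v w z : Plane → Plane} {q : Plane → ℝ} {x : Plane}
  {c : Fin 2 → Fin 3 → ℝ}

/-- A divergence-free field with compact support that agrees with the shear flow in a given disk. -/
lemma exists_shearFlow_extension {ρ : ℝ} (hρ : 0 < ρ) :
    ∃ v : Plane → Plane, ContDiff ℝ 1 v ∧ HasCompactSupport v ∧
      (∀ x, pd 0 (fun y => v y 0) x + pd 1 (fun y => v y 1) x = 0) ∧
      ∀ x, ‖x‖ ≤ ρ → v x = shearFlow x := by
  let η : ContDiffBump (0 : Plane) := ⟨ρ + 1, ρ + 2, by linarith, by linarith⟩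
  -- A stream function of the shear. Cutting off the stream function rather than the velocity keeps
  -- the field divergence-free.
  set Ψ : Plane → ℝ := fun x => (x 1 * x 1 - x 0 * x 0) * (1 / 2) with hΨ
  set Θ : Plane → ℝ := fun x => η x * Ψ x with hΘ
  have hΨc : ContDiff ℝ 2 Ψ :=
    (((contDiff_coord 1).mul (contDiff_coord 1)).sub ((contDiff_coord 0).mul
      (contDiff_coord 0))).mul contDiff_const
  have hΘc : ContDiff ℝ 2 Θ := η.contDiff.mul hΨc
  have hpd : ∀ j, ContDiff ℝ 1 (pd j Θ) := fun j =>
    contDiff_iff_contDiffAt.2 fun x => contDiffAt_pd_one hΘc.contDiffAt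
  have hs : HasCompactSupport Θ := η.hasCompactSupport.mul_right
  refine ⟨fun x => !₂[pd 1 Θ x, -pd 0 Θ x], ?_, ?_, fun x => ?_, fun x hx => ?_⟩
  · refine contDiff_euclidean.2 fun i => ?_
    rcases Fin.exists_fin_two.1 ⟨i, rfl⟩ with rfl | rfl
    · exact hpd 1
    · exact (hpd 0).neg
  · refine HasCompactSupport.intro hs fun x hx => ?_
    have h : ∀ j, pd j Θ x = 0 := by
      intro j
      have h0 : Θ =ᶠ[𝓝 x] fun _ => 0 := notMem_tsupport_iff_eventuallyEq.1 hx
      rw [pd_congr h0, pd_const]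
    ext i
    rcases Fin.exists_fin_two.1 ⟨i, rfl⟩ with rfl | rfl <;> simp [h]
  · have h : pd 1 (fun y => -pd 0 Θ y) x = -pd 1 (pd 0 Θ) x := pd_neg
    change pd 0 (pd 1 Θ) x + pd 1 (fun y => -pd 0 Θ y) x = 0
    rw [h, pd_comm hΘc.contDiffAt 0 1, add_neg_cancel]
  · have hnear : Θ =ᶠ[𝓝 x] Ψ := by
      have hopen : IsOpen {y : Plane | ‖y‖ < ρ + 1} := isOpen_lt continuous_norm continuous_const
      filter_upwards [hopen.mem_nhds (show ‖x‖ < ρ + 1 by linarith)] with y hy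
      have : η y = 1 := η.one_of_mem_closedBall (by
        rw [Metric.mem_closedBall, dist_zero_right]
        exact le_of_lt hy)
      simp only [hΘ, this, one_mul]
    have h0 : DifferentiableAt ℝ (fun y : Plane => y 0) x := differentiableAt_coord 0
    have h1 : DifferentiableAt ℝ (fun y : Plane => y 1) x := differentiableAt_coord 1
    have hpdΨ : ∀ j : Fin 2, pd j Ψ x = x 1 * (EuclideanSpace.single j (1 : ℝ) : Plane) 1
        - x 0 * (EuclideanSpace.single j (1 : ℝ) : Plane) 0 := by
      intro j
      rw [hΨ, pd_mul ((h1.fun_mul h1).fun_sub (h0.fun_mul h0)) (differentiableAt_const _),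
        pd_sub (h1.fun_mul h1) (h0.fun_mul h0), pd_mul h1 h1, pd_mul h0 h0, pd_coord, pd_coord,
        pd_const]
      ring
    ext i
    rcases Fin.exists_fin_two.1 ⟨i, rfl⟩ with rfl | rfl <;>
      simp [pd_congr hnear, hpdΨ, shearFlow]

/-- Half the dissipation density of a divergence-free field. -/
def dissipation (v : Plane → Plane) (x : Plane) : ℝ :=
  2 * pd 0 (fun y => v y 0) x ^ 2
    + 1 / 2 * (pd 1 (fun y => v y 0) x + pd 0 (fun y => v y 1) x) ^ 2

lemma dissipation_nonneg : 0 ≤ dissipation v x := by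
  unfold dissipation
  positivity

lemma integrable_dissipation (hv : ContDiff ℝ 1 v) (hs : HasCompactSupport v) :
    Integrable (dissipation v) := by
  have hpd : ∀ i j : Fin 2, Continuous (pd j fun y => v y i) := fun i j =>
    ((contDiff_euclidean.1 hv i).continuous_fderiv (by norm_num)).clm_apply continuous_const
  refine Continuous.integrable_of_hasCompactSupport ?_ ?_
  · unfold dissipation
    have a := hpd 0 0
    have b := hpd 0 1
    have c := hpd 1 0
    fun_prop
  · refine HasCompactSupport.intro hs fun x hx => ?_
    have h : ∀ i j : Fin 2, pd j (fun y => v y i) x = 0 := by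
      intro i j
      have h0 : (fun y => v y i) =ᶠ[𝓝 x] fun _ => 0 := by
        filter_upwards [notMem_tsupport_iff_eventuallyEq.1 hx] with y hy
        rw [hy]
        rfl
      rw [pd_congr h0, pd_const]
    simp [dissipation, h]

/-- The field `w₀ (∂₁ w₁, -∂₀ w₁)`, whose divergence is the Jacobian determinant of `w`. -/
def detField (K : Set Plane) (w : Plane → Plane) (x : Plane) : Plane :=
  !₂[w x 0 * fderivWithin ℝ w K x (EuclideanSpace.single 1 1) 1,
    -(w x 0 * fderivWithin ℝ w K x (EuclideanSpace.single 0 1) 1)]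

lemma detField_eventuallyEq (hw : ContDiffOn ℝ 2 w (exteriorDomain R δ))
    (hx : x ∈ exteriorDomain R δ) :
    detField (closure (exteriorDomain R δ)) w =ᶠ[𝓝 x] fun y =>
      !₂[w y 0 * pd 1 (fun y => w y 1) y, -(w y 0 * pd 0 (fun y => w y 1) y)] := by
  filter_upwards [isOpen_exteriorDomain.mem_nhds hx] with y hy
  have hd := (hw.contDiffAt (isOpen_exteriorDomain.mem_nhds hy)).differentiableAt (by norm_num)
  simp only [detField, fderivWithin_of_mem_nhds (closure_mem_nhds hy), pd, fderiv_component hd]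

lemma contDiffOn_detField (hw : ContDiffOn ℝ 2 w (exteriorDomain R δ)) :
    ContDiffOn ℝ 1 (detField (closure (exteriorDomain R δ)) w) (exteriorDomain R δ) := by
  intro x hx
  refine (ContDiffAt.congr_of_eventuallyEq ?_ (detField_eventuallyEq hw hx)).contDiffWithinAt
  have hx2 := hw.contDiffAt (isOpen_exteriorDomain.mem_nhds hx)
  have h0 : ContDiffAt ℝ 1 (fun y => w y 0) x := (contDiffAt_coord hx2 0).of_le (by norm_num)
  refine contDiffAt_euclidean.2 fun i => ?_
  rcases Fin.exists_fin_two.1 ⟨i, rfl⟩ with rfl | rfl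
  · exact h0.mul (contDiffAt_pd_one (contDiffAt_coord hx2 1))
  · exact (h0.mul (contDiffAt_pd_one (contDiffAt_coord hx2 1))).neg

/-- The determinant is a null Lagrangian: the second derivatives of `w₁` cancel by symmetry. -/
lemma divergence_detField (hw : ContDiffOn ℝ 2 w (exteriorDomain R δ))
    (hx : x ∈ exteriorDomain R δ) :
    divergence (detField (closure (exteriorDomain R δ)) w) x
      = pd 0 (fun y => w y 0) x * pd 1 (fun y => w y 1) x
        - pd 1 (fun y => w y 0) x * pd 0 (fun y => w y 1) x := by
  have hnhds := isOpen_exteriorDomain.mem_nhds hx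
  have hx2 := hw.contDiffAt hnhds
  have hd := ((contDiffOn_detField hw).contDiffAt hnhds).differentiableAt (by norm_num)
  have h0 : DifferentiableAt ℝ (fun y => w y 0) x :=
    (contDiffAt_coord hx2 0).differentiableAt (by norm_num)
  have h1 : ∀ j : Fin 2, DifferentiableAt ℝ (pd j fun y => w y 1) x := fun j =>
    (contDiffAt_pd_one (contDiffAt_coord hx2 1)).differentiableAt (by norm_num)
  have e0 : (fun y => detField (closure (exteriorDomain R δ)) w y 0) =ᶠ[𝓝 x]
      fun y => w y 0 * pd 1 (fun y => w y 1) y :=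
    (detField_eventuallyEq hw hx).mono fun y hy => congrArg (fun v : Plane => v 0) hy
  have e1 : (fun y => detField (closure (exteriorDomain R δ)) w y 1) =ᶠ[𝓝 x]
      fun y => -(w y 0 * pd 0 (fun y => w y 1) y) :=
    (detField_eventuallyEq hw hx).mono fun y hy => congrArg (fun v : Plane => v 1) hy
  rw [divergence_eq hd, pd_congr e0, pd_congr e1, pd_neg, pd_mul h0 (h1 1), pd_mul h0 (h1 0),
    pd_comm (contDiffAt_coord hx2 1) 0 1]
  ring

lemma continuousOn_detField (hw : IsStokesFlow R δ μ w q) (hR : 0 < R) (hδ : 0 < δ) :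
    ContinuousOn (detField (closure (exteriorDomain R δ)) w) (closure (exteriorDomain R δ)) := by
  have h0 : ContinuousOn (fun x => w x 0) (closure (exteriorDomain R δ)) :=
    (EuclideanSpace.proj (𝕜 := ℝ) (0 : Fin 2)).continuous.comp_continuousOn
      hw.contDiffOn_velocity_closure.continuousOn
  refine (PiLp.continuous_toLp 2 _).comp_continuousOn (continuousOn_pi.2 fun i => ?_)
  rcases Fin.exists_fin_two.1 ⟨i, rfl⟩ with rfl | rfl
  · exact h0.mul (hw.continuousOn_jacobian hR hδ 1 1)
  · exact (h0.mul (hw.continuousOn_jacobian hR hδ 1 0)).neg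

lemma detField_isBigO (hR : 0 < R) (hδ : 0 < δ) {a b : Plane → ℝ}
    (hw0 : w =O[Bornology.cobounded Plane] a)
    (hw1 : (fun x => fderiv ℝ w x) =O[Bornology.cobounded Plane] b) :
    detField (closure (exteriorDomain R δ)) w =O[Bornology.cobounded Plane]
      fun x => a x * b x := by
  refine Asymptotics.IsBigO.trans (Asymptotics.IsBigO.of_bound 2 ?_)
    (hw0.norm_left.mul hw1.norm_left)
  filter_upwards [eventually_mem_exteriorDomain hR hδ] with x hx
  have hb : ∀ j : Fin 2, |fderiv ℝ w x (EuclideanSpace.single j 1) 1| ≤ ‖fderiv ℝ w x‖ := by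
    intro j
    refine (abs_apply_le_norm _ 1).trans ?_
    simpa using (fderiv ℝ w x).le_opNorm (EuclideanSpace.single j 1)
  have hm : ∀ j : Fin 2, |w x 0 * fderiv ℝ w x (EuclideanSpace.single j 1) 1|
      ≤ ‖w x‖ * ‖fderiv ℝ w x‖ := by
    intro j
    rw [abs_mul]
    exact mul_le_mul (abs_apply_le_norm _ 0) (hb j) (abs_nonneg _) (norm_nonneg _)
  rw [norm_mul, norm_norm, norm_norm]
  have hP : 0 ≤ ‖w x‖ * ‖fderiv ℝ w x‖ := by positivity
  refine le_of_sq_le_sq ?_ (by positivity)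
  rw [norm_sq_eq]
  have e0 : detField (closure (exteriorDomain R δ)) w x 0
      = w x 0 * fderiv ℝ w x (EuclideanSpace.single 1 1) 1 := by
    simp [detField, fderivWithin_of_mem_nhds (closure_mem_nhds hx)]
  have e1 : detField (closure (exteriorDomain R δ)) w x 1
      = -(w x 0 * fderiv ℝ w x (EuclideanSpace.single 0 1) 1) := by
    simp [detField, fderivWithin_of_mem_nhds (closure_mem_nhds hx)]
  rw [e0, e1, neg_sq, ← sq_abs (_ * _), ← sq_abs (w x 0 * fderiv ℝ w x
    (EuclideanSpace.single 0 1) 1)]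
  nlinarith [hm 0, hm 1, abs_nonneg (w x 0 * fderiv ℝ w x (EuclideanSpace.single 0 1) 1),
    abs_nonneg (w x 0 * fderiv ℝ w x (EuclideanSpace.single 1 1) 1)]

lemma hasDerivAt_circle (c : Plane) (R t : ℝ) :
    HasDerivAt (fun t => c + R • unitVec t)
      ((-(R * Real.sin t)) • EuclideanSpace.single 0 1
        + (R * Real.cos t) • EuclideanSpace.single 1 1) t := by
  have h : unitVec = fun t => Real.cos t • (EuclideanSpace.single 0 1 : Plane)
      + Real.sin t • (EuclideanSpace.single 1 1 : Plane) := by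
    funext t
    ext i
    rcases Fin.exists_fin_two.1 ⟨i, rfl⟩ with rfl | rfl <;> simp [unitVec]
  rw [h]
  refine (((((Real.hasDerivAt_cos t).smul_const _).fun_add
    ((Real.hasDerivAt_sin t).smul_const _)).const_smul R).const_add c).congr_deriv ?_
  module

/-- The flux of the determinant field depends only on the rigid motions of the disks. -/
lemma circleFlux_detField (hR : 0 < R) (hδ : 0 < δ) (hw : IsPerturbation R δ μ s c w q)
    (i : Fin 2) :
    circleFlux (center R δ i) (detField (closure (exteriorDomain R δ)) w) R
      = Real.pi * R ^ 2 * (c i 2 ^ 2 - s ^ 2) := by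
  have hx0 : ∀ t, (center R δ i + R • unitVec t) 0 = center R δ i 0 + R * Real.cos t := by
    intro t
    simp [unitVec]
  have hx1 : ∀ t, (center R δ i + R • unitVec t) 1 = R * Real.sin t := by
    intro t
    simp [unitVec, center_apply_one]
  have hw0 : ∀ t, w (center R δ i + R • unitVec t) 0 = c i 0 + (c i 2 - s) * (R * Real.sin t) := by
    intro t
    rw [hw.boundary i _ (circle_mem_sphere hR i t), Fin.sum_univ_three]
    have y1 := hx1 t
    generalize center R δ i + R • unitVec t = X at *
    simp [rigidMotion, shearFlow, y1]
    ring
  have hw1 : ∀ t, w (center R δ i + R • unitVec t) 1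
      = c i 1 - (c i 2 + s) * (center R δ i 0 + R * Real.cos t) := by
    intro t
    rw [hw.boundary i _ (circle_mem_sphere hR i t), Fin.sum_univ_three]
    have y0 := hx0 t
    generalize center R δ i + R • unitVec t = X at *
    simp [rigidMotion, shearFlow, y0]
    ring
  -- The flux of the determinant field is the line integral of `w₀ dw₁`. Only the tangential
  -- derivative of `w₁` enters, and the chain rule computes it from the boundary values.
  have hder : ∀ t, fderivWithin ℝ w (closure (exteriorDomain R δ)) (center R δ i + R • unitVec t)
        (EuclideanSpace.single 1 1) 1 * (R * Real.cos t)
      - fderivWithin ℝ w (closure (exteriorDomain R δ)) (center R δ i + R • unitVec t)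
        (EuclideanSpace.single 0 1) 1 * (R * Real.sin t)
      = (c i 2 + s) * (R * Real.sin t) := by
    intro t
    have hK : ∀ t, center R δ i + R • unitVec t ∈ closure (exteriorDomain R δ) := fun t =>
      circle_mem_closure hR hδ i le_rfl (by linarith) t
    have h1 := (hw.contDiffOn_velocity_closure.differentiableOn (by norm_num) _ (hK t)
      ).hasFDerivWithinAt.comp_hasDerivAt (f := fun t => center R δ i + R • unitVec t) t
        (hasDerivAt_circle (center R δ i) R t) (Eventually.of_forall hK)
    have h2 := (EuclideanSpace.proj (𝕜 := ℝ) (1 : Fin 2)).hasFDerivAt.comp_hasDerivAt t h1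
    have h3 : HasDerivAt (fun t => w (center R δ i + R • unitVec t) 1)
        ((c i 2 + s) * (R * Real.sin t)) t := by
      simp only [hw1]
      refine ((((Real.hasDerivAt_cos t).const_mul R).const_add (center R δ i 0)).const_mul
        (c i 2 + s) |>.const_sub (c i 1)).congr_deriv ?_
      ring
    rw [← h2.unique h3]
    simp
    ring
  have hcongr : circleFlux (center R δ i) (detField (closure (exteriorDomain R δ)) w) R
      = ∫ t in (0 : ℝ)..(2 * Real.pi), ((c i 2 ^ 2 - s ^ 2) * R ^ 2 / 2
        + ((c i 2 + s) * R * c i 0 * Real.sin t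
        + (c i 2 ^ 2 - s ^ 2) * R ^ 2 * (Real.sin t ^ 2 - 1 / 2))) := by
    refine intervalIntegral.integral_congr fun t _ => ?_
    have h := hder t
    have h0 := hw0 t
    simp only [detField]
    simp
    rw [h0]
    linear_combination (c i 0 + (c i 2 - s) * (R * Real.sin t)) * h
  have hzero : ∫ t in (0 : ℝ)..(2 * Real.pi), ((c i 2 + s) * R * c i 0 * Real.sin t
        + (c i 2 ^ 2 - s ^ 2) * R ^ 2 * (Real.sin t ^ 2 - 1 / 2)) = 0 := by
    refine intervalIntegral_eq_zero_of_hasDerivAt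
      (G := fun t => (c i 2 + s) * R * c i 0 * -Real.cos t
        + (c i 2 ^ 2 - s ^ 2) * R ^ 2 * (-1 / 2 * (Real.sin t * Real.cos t)))
      (fun t => ?_) (by fun_prop) (by simp)
    have hs := Real.hasDerivAt_sin t
    have hc := Real.hasDerivAt_cos t
    refine ((hc.fun_neg.const_mul _).fun_add (((hs.fun_mul hc).const_mul (-1 / 2)).const_mul
      _)).congr_deriv ?_
    linear_combination (-(c i 2 ^ 2 - s ^ 2) * R ^ 2 / 2) * Real.sin_sq_add_cos_sq t
  rw [hcongr, intervalIntegral.integral_add (by simp)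
    (Continuous.intervalIntegrable (by fun_prop) _ _), hzero]
  simp
  ring

/-- The energy inequality. -/
lemma IsPerturbation.setIntegral_le (hR : 0 < R) (hδ : 0 < δ) (hμ : 0 < μ)
    (hw : IsPerturbation R δ μ s c w q) (hv : ContDiff ℝ 1 v) (hvs : HasCompactSupport v)
    (hvdiv : ∀ x, pd 0 (fun y => v y 0) x + pd 1 (fun y => v y 1) x = 0)
    (hvb : ∀ i : Fin 2, ∀ x ∈ Metric.sphere (center R δ i) R, v x = shearFlow x)
    {k : Plane → ℝ} (hk : IntegrableOn k (exteriorDomain R δ))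
    (hle : ∀ x ∈ exteriorDomain R δ, k x ≤ 1 / 2 * (pd 0 (fun y => w y 0) x ^ 2
      + pd 1 (fun y => w y 0) x ^ 2 + pd 0 (fun y => w y 1) x ^ 2 + pd 1 (fun y => w y 1) x ^ 2)
      - s ^ 2 * dissipation v x) :
    ∫ x in exteriorDomain R δ, k x ≤ -(Real.pi * R ^ 2 * ∑ i, (c i 2 ^ 2 - s ^ 2)) := by
  -- Adding `s v` cancels the shear on the boundary. As `z` is rigid there, the equilibrium
  -- conditions make the flux of its stress field vanish.
  set z : Plane → Plane := fun x => w x + s • v x with hz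
  have hw1 : ContDiffOn ℝ 1 w (exteriorDomain R δ) := hw.contDiffOn_velocity.of_le (by norm_num)
  have hz1 : ContDiffOn ℝ 1 z (exteriorDomain R δ) := hw1.add (hv.const_smul s).contDiffOn
  have hzK : ContinuousOn z (closure (exteriorDomain R δ)) :=
    hw.contDiffOn_velocity_closure.continuousOn.add (hv.continuous.const_smul s).continuousOn
  have hinv : (fun x : Plane => ‖x‖⁻¹) =O[Bornology.cobounded Plane] fun _ => (1 : ℝ) :=
    (tendsto_inv_atTop_zero.comp tendsto_norm_cobounded_atTop).isBigO_one ℝ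
  have hwO : w =O[Bornology.cobounded Plane] fun _ => (1 : ℝ) := hw.decay.velocity.trans hinv
  have hvO : (fun x => s • v x) =O[Bornology.cobounded Plane] fun _ => (1 : ℝ) := by
    have : (fun x => s • v x) =ᶠ[Bornology.cobounded Plane] fun _ => 0 := by
      have hb := hvs.isBounded
      filter_upwards [Bornology.isBounded_def.1 hb] with x hx
      rw [image_eq_zero_of_notMem_tsupport hx, smul_zero]
    exact this.trans_isBigO (Asymptotics.isBigO_zero _ _)
  have o1 : stressField (closure (exteriorDomain R δ)) μ w q z =O[Bornology.cobounded Plane]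
      fun x => (‖x‖ ^ 2)⁻¹ := by
    simpa using stressField_isBigO hR hδ hμ hw.decay.gradient hw.decay.pressure (hwO.add hvO)
  have o2 : detField (closure (exteriorDomain R δ)) w =O[Bornology.cobounded Plane]
      fun x => (‖x‖ ^ 2)⁻¹ := by
    simpa using detField_isBigO hR hδ hwO hw.decay.gradient
  have d1 := hw.toIsStokesFlow.contDiffOn_stressField hz1
  have d2 := contDiffOn_detField (δ := δ) (R := R) hw.contDiffOn_velocity
  have c1 := hw.toIsStokesFlow.continuousOn_stressField hR hδ hzK
  have c2 := continuousOn_detField hw.toIsStokesFlow hR hδ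
  have hzb : ∀ i : Fin 2, ∀ x ∈ Metric.sphere (center R δ i) R,
      z x = ∑ j : Fin 3, c i j • rigidMotion j x := by
    intro i x hx
    simp only [hz, hw.boundary i x hx, hvb i x hx, sub_add_cancel]
  have key := setIntegral_le_neg_sum_circleFlux hR hδ ((d1.const_smul μ⁻¹).add d2)
    ((c1.const_smul μ⁻¹).add c2) ((o1.const_smul_left μ⁻¹).add o2) hk fun x hx => ?_
  · refine key.trans_eq ?_
    congr 1
    rw [Finset.mul_sum]
    refine Finset.sum_congr rfl fun i _ => ?_
    have e := circleFlux_add hR hδ (c1.const_smul μ⁻¹) c2 i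
    refine e.trans ?_
    have e2 : circleFlux (center R δ i)
        (μ⁻¹ • stressField (closure (exteriorDomain R δ)) μ w q z) R
        = μ⁻¹ * circleFlux (center R δ i)
          (stressField (closure (exteriorDomain R δ)) μ w q z) R := by
      unfold circleFlux
      rw [← intervalIntegral.integral_const_mul]
      refine intervalIntegral.integral_congr fun t _ => ?_
      simp only [Pi.smul_apply, PiLp.smul_apply, smul_eq_mul]
      ring
    rw [e2, circleFlux_stressField, hw.toIsStokesFlow.boundaryForce_sum hR hδ i (hzb i),
      circleFlux_detField hR hδ hw]
    simp [hw.equilibrium]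
  · have hnhds := isOpen_exteriorDomain.mem_nhds hx
    have e1 := (d1.contDiffAt hnhds).differentiableAt (by norm_num)
    have e2 := (d2.contDiffAt hnhds).differentiableAt (by norm_num)
    have hsmul : divergence
        (fun y => μ⁻¹ • stressField (closure (exteriorDomain R δ)) μ w q z y) x
        = μ⁻¹ * divergence (stressField (closure (exteriorDomain R δ)) μ w q z) x := by
      simp only [divergence, fderiv_fun_const_smul e1, _root_.smul_apply, PiLp.smul_apply,
        smul_eq_mul]
      ring
    have hpdz : ∀ i j : Fin 2, pd j (fun y => z y i) x
        = pd j (fun y => w y i) x + s * pd j (fun y => v y i) x := by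
      intro i j
      have a1 : DifferentiableAt ℝ (fun y => w y i) x :=
        (contDiffAt_coord (hw1.contDiffAt hnhds) i).differentiableAt (by norm_num)
      have a2 : DifferentiableAt ℝ (fun y => v y i) x :=
        (contDiffAt_coord hv.contDiffAt i).differentiableAt (by norm_num)
      rw [← pd_const_mul s a2, ← pd_add a1 (a2.const_mul s)]
      rfl
    have hdw := hw.incompressible x hx
    have hdv := hvdiv x
    have hdz : pd 0 (fun y => z y 0) x + pd 1 (fun y => z y 1) x = 0 := by
      rw [hpdz, hpdz]
      linear_combination hdw + s * hdv
    refine (hle x hx).trans ?_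
    have hdiv := divergence_add (e1.const_smul μ⁻¹) e2
    refine le_of_le_of_eq ?_ hdiv.symm
    refine le_of_le_of_eq ?_ (congrArg (· + _) hsmul.symm)
    rw [hw.toIsStokesFlow.divergence_stressField hz1 hx hdz,
      divergence_detField hw.contDiffOn_velocity hx, inv_mul_cancel_left₀ hμ.ne']
    simp only [hpdz, dissipation]
    have h11 : pd 1 (fun y => w y 1) x = -pd 0 (fun y => w y 0) x := by linarith
    have g11 : pd 1 (fun y => v y 1) x = -pd 0 (fun y => v y 0) x := by linarith
    rw [h11, g11]
    -- Young's inequality bounds `2 e(w) : e(w + s v)` below by `|e(w)|² - s² |e(v)|²`. For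
    -- divergence-free `w`, `|e(w)|² = |∇w|² / 2 - det ∇w`, and the added determinant leaves the
    -- full gradient.
    nlinarith [sq_nonneg (pd 0 (fun y => w y 0) x + s * pd 0 (fun y => v y 0) x),
      sq_nonneg (pd 1 (fun y => w y 0) x + pd 0 (fun y => w y 1) x
        + s * (pd 1 (fun y => v y 0) x + pd 0 (fun y => v y 1) x))]

end Energy

/-! ### Uniqueness, and the two velocity estimates. -/

section Rigidity

variable {R δ μ : ℝ} {w : Plane → Plane} {q : Plane → ℝ} {c : Fin 2 → Fin 3 → ℝ} {x : Plane}

lemma norm_le_of_mem_sphere (hR : 0 < R) (hδ : 0 < δ) {i : Fin 2}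
    (hx : x ∈ Metric.sphere (center R δ i) R) : ‖x‖ ≤ 2 * R + δ := by
  have h := norm_sub_norm_le x (center R δ i)
  rw [← dist_eq_norm, hx, norm_center hR hδ i] at h
  linarith

/-- The energy inequality for rigid boundary values. -/
lemma IsPerturbation.setIntegral_le_of_rigid (hR : 0 < R) (hδ : 0 < δ) (hμ : 0 < μ)
    (hw : IsPerturbation R δ μ 0 c w q) {k : Plane → ℝ}
    (hk : IntegrableOn k (exteriorDomain R δ))
    (hle : ∀ x ∈ exteriorDomain R δ, k x ≤ 1 / 2 * (pd 0 (fun y => w y 0) x ^ 2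
      + pd 1 (fun y => w y 0) x ^ 2 + pd 0 (fun y => w y 1) x ^ 2
      + pd 1 (fun y => w y 1) x ^ 2)) :
    ∫ x in exteriorDomain R δ, k x ≤ -(Real.pi * R ^ 2 * ∑ i, c i 2 ^ 2) := by
  obtain ⟨v, hv, hvs, hvdiv, hvb⟩ := exists_shearFlow_extension (ρ := 2 * R + δ) (by positivity)
  have h := hw.setIntegral_le hR hδ hμ hv hvs hvdiv
    (fun i x hx => hvb x (norm_le_of_mem_sphere hR hδ hx)) hk fun x hx => by
      simpa using hle x hx
  simpa using h

/-- For `s = 0` the right-hand side of the energy inequality is nonpositive, so already `k = 0`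
forces the angular velocities to vanish. -/
lemma IsPerturbation.angular_velocity_eq_zero (hR : 0 < R) (hδ : 0 < δ) (hμ : 0 < μ)
    (hw : IsPerturbation R δ μ 0 c w q) (i : Fin 2) : c i 2 = 0 := by
  have h := hw.setIntegral_le_of_rigid hR hδ hμ (k := fun _ => 0) integrableOn_zero
    fun x _ => by positivity
  rw [integral_zero] at h
  have hsum : ∑ i, c i 2 ^ 2 ≤ 0 := by
    by_contra! hpos
    have : 0 < Real.pi * R ^ 2 * ∑ i, c i 2 ^ 2 := by positivity
    linarith
  have := (Finset.single_le_sum (fun j _ => sq_nonneg (c j 2)) (Finset.mem_univ i)).trans hsum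
  exact pow_eq_zero_iff two_ne_zero |>.1 (le_antisymm this (sq_nonneg _))

/-- A perturbation with rigid boundary values has vanishing gradient. -/
lemma IsPerturbation.fderiv_eq_zero (hR : 0 < R) (hδ : 0 < δ) (hμ : 0 < μ)
    (hw : IsPerturbation R δ μ 0 c w q) (hx : x ∈ exteriorDomain R δ) : fderiv ℝ w x = 0 := by
  set g : Plane → ℝ := fun x => 1 / 2 * (pd 0 (fun y => w y 0) x ^ 2
      + pd 1 (fun y => w y 0) x ^ 2 + pd 0 (fun y => w y 1) x ^ 2
      + pd 1 (fun y => w y 1) x ^ 2) with hg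
  have hg0 : ∀ y, 0 ≤ g y := fun y => by positivity
  have hgx : g x = 0 := by
    by_contra hne
    have hpos : 0 < g x := lt_of_le_of_ne (hg0 x) (Ne.symm hne)
    have hpd : ∀ i j : Fin 2, ContinuousAt (pd j fun y => w y i) x := fun i j =>
      (contDiffAt_pd_one (contDiffAt_coord (hw.contDiffAt hx) i)).continuousAt
    have hcont : ContinuousAt g x :=
      continuousAt_const.mul (((((hpd 0 0).pow 2).add ((hpd 0 1).pow 2)).add
        ((hpd 1 0).pow 2)).add ((hpd 1 1).pow 2))
    have hev : ∀ᶠ y in 𝓝 x, g x / 2 < g y ∧ y ∈ exteriorDomain R δ :=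
      (hcont.eventually (lt_mem_nhds (by linarith))).and (isOpen_exteriorDomain.mem_nhds hx)
    obtain ⟨r, hr, hball⟩ := Metric.eventually_nhds_iff_ball.1 hev
    have hfin : volume (Metric.ball x r) ≠ ⊤ := measure_ball_lt_top.ne
    -- A small bump below the energy density is an admissible minorant. It contradicts the energy
    -- inequality without integrability of the density itself.
    have hind : Integrable ((Metric.ball x r).indicator fun _ => g x / 2) :=
      (integrable_indicator_iff measurableSet_ball).2 (integrableOn_const hfin)
    have h := hw.setIntegral_le_of_rigid hR hδ hμ hind.integrableOn fun y _ => by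
      by_cases hy : y ∈ Metric.ball x r
      · rw [indicator_of_mem hy]
        exact (hball y hy).1.le
      · rw [indicator_of_notMem hy]
        exact hg0 y
    rw [setIntegral_indicator measurableSet_ball,
      inter_eq_right.2 fun y hy => (hball y hy).2, setIntegral_const, smul_eq_mul] at h
    have hvol : 0 < volume.real (Metric.ball x r) :=
      ENNReal.toReal_pos (Metric.measure_ball_pos volume x hr).ne' hfin
    have h1 : 0 < volume.real (Metric.ball x r) * (g x / 2) := by positivity
    have h2 : 0 ≤ Real.pi * R ^ 2 * ∑ i, c i 2 ^ 2 := by positivity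
    linarith
  have h0 : ∀ i j : Fin 2, |pd j (fun y => w y i) x| ≤ 0 := by
    intro i j
    simp only [hg] at hgx
    refine (abs_eq_zero.2 (pow_eq_zero_iff two_ne_zero |>.1 ?_)).le
    have a := sq_nonneg (pd 0 (fun y => w y 0) x)
    have b := sq_nonneg (pd 1 (fun y => w y 0) x)
    have c := sq_nonneg (pd 0 (fun y => w y 1) x)
    have d := sq_nonneg (pd 1 (fun y => w y 1) x)
    rcases Fin.exists_fin_two.1 ⟨i, rfl⟩ with rfl | rfl <;>
      rcases Fin.exists_fin_two.1 ⟨j, rfl⟩ with rfl | rfl <;> linarith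
  have h := norm_fderiv_le_sum (hw.differentiableAt hx) h0
  rw [mul_zero] at h
  exact norm_le_zero_iff.1 h

/-- A perturbation with rigid boundary values does not move the disks vertically. -/
lemma IsPerturbation.vertical_velocity_eq_zero (hR : 0 < R) (hδ : 0 < δ) (hμ : 0 < μ)
    (hw : IsPerturbation R δ μ 0 c w q) : c 1 1 = 0 := by
  set e : Plane := EuclideanSpace.single 0 1 with he
  -- The horizontal ray from the rightmost point of the right disk never meets the disks again.
  -- Along it `w` is constant, and decay at infinity makes that constant zero.
  set γ : ℝ → Plane := fun t => center R δ 1 + (R + t) • e with hγ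
  have hγ0 : ∀ t, γ t 0 = R + δ / 2 + (R + t) := fun t => by
    simp [hγ, he, center_one_apply_zero]
  have hdist : ∀ i t, 0 ≤ t → R + t ≤ dist (γ t) (center R δ i) := by
    intro i t ht
    have h := abs_apply_le_norm (γ t - center R δ i) 0
    rw [PiLp.sub_apply, hγ0, ← dist_eq_norm] at h
    refine le_trans ?_ ((le_abs_self _).trans h)
    rcases Fin.exists_fin_two.1 ⟨i, rfl⟩ with rfl | rfl
    · rw [center_zero_apply_zero]
      linarith
    · rw [center_one_apply_zero]
      linarith
  have hmem : ∀ t, 0 < t → γ t ∈ exteriorDomain R δ := fun t ht =>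
    (mem_exteriorDomain hR).2 fun i => lt_of_lt_of_le (by linarith) (hdist i t ht.le)
  have hmemK : ∀ t, 0 ≤ t → γ t ∈ closure (exteriorDomain R δ) := fun t ht =>
    (mem_closure_exteriorDomain hR hδ).2 fun i => le_trans (by linarith) (hdist i t ht)
  have hγd : ∀ t, HasDerivAt γ e t := fun t =>
    ((((hasDerivAt_id t).const_add R).smul_const e).const_add (center R δ 1)).congr_deriv
      (one_smul ℝ e)
  have hγc : Continuous γ := continuous_iff_continuousAt.2 fun t => (hγd t).continuousAt
  have hder : ∀ t, 0 < t → HasDerivAt (fun t => w (γ t) 1) 0 t := by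
    intro t ht
    have h := (hw.differentiableAt (hmem t ht)).hasFDerivAt.comp_hasDerivAt t (hγd t)
    have h2 := (EuclideanSpace.proj (𝕜 := ℝ) (1 : Fin 2)).hasFDerivAt.comp_hasDerivAt t h
    rw [hw.fderiv_eq_zero hR hδ hμ (hmem t ht)] at h2
    exact h2.congr_deriv (by simp)
  have hcont : ContinuousOn (fun t => w (γ t) 1) (Ici 0) :=
    (EuclideanSpace.proj (𝕜 := ℝ) (1 : Fin 2)).continuous.comp_continuousOn
      (hw.contDiffOn_velocity_closure.continuousOn.comp hγc.continuousOn fun t ht => hmemK t ht)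
  have hconst : ∀ t, 0 < t → w (γ t) 1 = w (γ 0) 1 := by
    intro t ht
    obtain ⟨r, hr, h⟩ := exists_deriv_eq_slope (fun t => w (γ t) 1) ht
      (hcont.mono Icc_subset_Ici_self)
      fun s hs => (hder s hs.1).differentiableAt.differentiableWithinAt
    rw [(hder r hr.1).deriv, eq_comm, div_eq_zero_iff] at h
    rcases h with h | h <;> linarith
  have hγinf : Tendsto γ atTop (Bornology.cobounded Plane) := by
    rw [← tendsto_norm_atTop_iff_cobounded]
    refine tendsto_atTop_mono' _ ?_ tendsto_id
    filter_upwards [eventually_ge_atTop 0] with t ht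
    have h := abs_apply_le_norm (γ t) 0
    rw [hγ0] at h
    refine le_trans ?_ ((le_abs_self _).trans h)
    rw [id]
    linarith
  have hw0 : Tendsto w (Bornology.cobounded Plane) (𝓝 0) :=
    hw.decay.velocity.trans_tendsto
      (tendsto_inv_atTop_zero.comp tendsto_norm_cobounded_atTop)
  have hlim : Tendsto (fun t => w (γ t) 1) atTop (𝓝 0) :=
    ((EuclideanSpace.proj (𝕜 := ℝ) (1 : Fin 2)).continuous.tendsto' 0 0 rfl).comp
      (hw0.comp hγinf)
  have hzero : w (γ 0) 1 = 0 :=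
    tendsto_nhds_unique (tendsto_const_nhds.congr' (by
      filter_upwards [eventually_gt_atTop 0] with t ht
      exact (hconst t ht).symm)) hlim
  have hsphere : γ 0 ∈ Metric.sphere (center R δ 1) R := by
    simp [hγ, he, abs_of_pos hR, norm_smul]
  rw [hw.boundary 1 _ hsphere, Fin.sum_univ_three,
    hw.angular_velocity_eq_zero hR hδ hμ 1] at hzero
  simpa [rigidMotion] using hzero

/-- The vertical velocity of the right disk. -/
lemma IsPerturbation.vertical_velocity (hR : 0 < R) (hδ : 0 < δ) (hμ : 0 < μ)
    (hw : IsPerturbation R δ μ 1 c w q) : c 1 1 = focus R δ := by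
  have h1 := (hw.symmetrize hR hδ).vertical_velocity_eq_zero hR hδ hμ
  have h2 := hw.relative_velocity hR hδ hμ
  have h3 : c 1 1 + c 0 1 = 0 := h1
  linarith

/-- The angular velocities are bounded in terms of the dissipation of any extension of the shear
flow. -/
lemma IsPerturbation.sum_angular_velocity_sq_le (hR : 0 < R) (hδ : 0 < δ) (hμ : 0 < μ)
    (hw : IsPerturbation R δ μ 1 c w q) {v : Plane → Plane} (hv : ContDiff ℝ 1 v)
    (hvs : HasCompactSupport v)
    (hvdiv : ∀ x, pd 0 (fun y => v y 0) x + pd 1 (fun y => v y 1) x = 0)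
    (hvb : ∀ i : Fin 2, ∀ x ∈ Metric.sphere (center R δ i) R, v x = shearFlow x) :
    ∑ i, c i 2 ^ 2 ≤ 2 + (∫ x, dissipation v x) / (Real.pi * R ^ 2) := by
  have hint := integrable_dissipation hv hvs
  have h := hw.setIntegral_le hR hδ hμ hv hvs hvdiv hvb (k := fun x => -dissipation v x)
    hint.neg.integrableOn fun x _ => by
      have : 0 ≤ 1 / 2 * (pd 0 (fun y => w y 0) x ^ 2 + pd 1 (fun y => w y 0) x ^ 2
        + pd 0 (fun y => w y 1) x ^ 2 + pd 1 (fun y => w y 1) x ^ 2) := by positivity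
      linarith
  rw [integral_neg] at h
  have h2 := setIntegral_le_integral (s := exteriorDomain R δ) hint
    (Eventually.of_forall fun _ => dissipation_nonneg)
  have hP : 0 < Real.pi * R ^ 2 := by positivity
  rw [← sub_le_iff_le_add', le_div_iff₀ hP]
  simp only [Fin.sum_univ_two] at h ⊢
  linarith

/-- Subadditivity of the square root, applied to `R δ + (δ / 2)²`, gives the explicit error constant
`1 / 2`. -/
lemma abs_focus_sub_sqrt_le (hR : 0 < R) (hδ : 0 < δ) :
    |focus R δ - Real.sqrt (R * δ)| ≤ δ / 2 := by
  have h1 : Real.sqrt (R * δ) ≤ focus R δ := Real.sqrt_le_sqrt (by nlinarith [sq_nonneg δ])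
  have h2 : focus R δ ≤ Real.sqrt (R * δ) + δ / 2 := by
    refine Real.sqrt_le_iff.2 ⟨by positivity, ?_⟩
    have h := Real.sq_sqrt (show 0 ≤ R * δ by positivity)
    nlinarith [mul_nonneg (Real.sqrt_nonneg (R * δ)) hδ.le]
  rw [abs_of_nonneg (by linarith)]
  linarith

end Rigidity

end StokesTwoDisks

end


/-! ### The main theorem. -/

theorem corollary5p3 (R μ : ℝ) (hR : 0 < R) (hμ : 0 < μ) :
    ∃ C δ₀ : ℝ, 0 < δ₀ ∧ ∀ δ : ℝ, 0 < δ → δ < δ₀ →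
      ∀ (c : Fin 2 → Fin 3 → ℝ) (u : StokesTwoDisks.Plane → StokesTwoDisks.Plane)
        (p : StokesTwoDisks.Plane → ℝ),
        StokesTwoDisks.IsEquilibriumFlow R δ μ StokesTwoDisks.shearFlow c u p →
          |c 1 1 - Real.sqrt (R * δ)| ≤ C * δ ∧ |c 1 2| ≤ C := by
  -- The disk of radius `3 R` contains both boundary circles for every `δ < R`. One extension of the
  -- shear thus serves all such `δ`, and the bound on the angular velocity is uniform.
  obtain ⟨v, hv, hvs, hvdiv, hvb⟩ :=
    StokesTwoDisks.exists_shearFlow_extension (ρ := 3 * R) (by positivity)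
  set M := ∫ x, StokesTwoDisks.dissipation v x with hM
  refine ⟨max (1 / 2) (Real.sqrt (2 + M / (Real.pi * R ^ 2))), R, hR, fun δ hδ hδR c u p h => ?_⟩
  have hw := h.isPerturbation hR hδ
  constructor
  · rw [hw.vertical_velocity hR hδ hμ]
    refine (StokesTwoDisks.abs_focus_sub_sqrt_le hR hδ).trans ?_
    rw [div_eq_inv_mul, ← one_div]
    exact mul_le_mul_of_nonneg_right (le_max_left _ _) hδ.le
  · refine le_trans (Real.abs_le_sqrt ?_) (le_max_right _ _)
    have hsum := hw.sum_angular_velocity_sq_le hR hδ hμ hv hvs hvdiv fun i x hx =>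
      hvb x ((StokesTwoDisks.norm_le_of_mem_sphere hR hδ hx).trans (by linarith))
    exact (Finset.single_le_sum (fun j _ => sq_nonneg (c j 2)) (Finset.mem_univ 1)).trans hsum
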